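/- Let $d\in\{2,3\}$ and let $\Omega\subset\mathbb R^d$ be a bounded convex open set (for example a convex polygon or polyhedron). Write $(\cdot,\cdot)$ and $\|\cdot\|$ for the inner product and norm of $L^2(\Omega)$, $L^2(\Omega)^d$ or $L^2(\Omega)^{d\times d}$. Let $\delta,\gamma,\lambda,\mu_0,\mathscr T,\eta,\nu_w,\nu_f,\chi_0>0$ be constants, and let $\nu,\chi:\mathbb R\to\mathbb R$ be Lipschitz functions with $\min\{\nu_w,\nu_f\}\le\nu\le\max\{\nu_w,\nu_f\}$ and $0\le\chi\le\chi_0$. Let $F$ be the truncated double well potential, $F(s)=(s+1)^2$ for $s\le-1$, $F(s)=\tfrac14(s^2-1)^2$ for $-1\le s\le1$, $F(s)=(s-1)^2$ for $s\ge1$, and let $f=F'$. Let $T_F>0$, $K\ge1$ an integer, $\tau=T_F/K$, $t^k=k\tau$; let $h_a\in C^1([0,T_F];L^2(\Omega)^d)$ be the applied magnetic field and $h_a^k=h_a(t^k)$. Let $G_h,Y_h,X_h\subset H^1(\Omega)$, $M_h\subset L^2(\Omega)^d$, $U_h\subset H^1_0(\Omega)^d$ and $P_h\subset L^2(\Omega)$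 be finite dimensional subspaces (for the phase field, chemical potential, magnetic potential, magnetization, velocity and pressure) with $Y_h=G_h$ and $\nabla X_h\subset M_h$. Let $b_h:U_h\times U_h\times U_h\to\mathbb R$ and $b_h^m:U_h\times M_h\times M_h\to\mathbb R$ be trilinear forms, each skew symmetric in its last two arguments. Put $T(V)=\tfrac12(\nabla V+\nabla V^{\top})$. Given $(\theta^{k-1},M^{k-1},U^{k-1})\in G_h\times M_h\times U_h$, the $k$-th step of the scheme asks for $(\theta^k,\psi^k,M^k,\Phi^k,U^k,P^k)\in G_h\times Y_h\times M_h\times X_h\times U_h\times P_h$ such that, with $H^k=\nabla\Phi^k$, $\delta_t a^k=a^k-a^{k-1}$, $\nu_\theta=\nu(\theta^{k-1})$, $\chi_\theta=\chi(\theta^{k-1})$, $$\begin{aligned} &\big(\tfrac{\delta_t\theta^k}{\tau},\Lambda\big)-(U^k\theta^{k-1},\nabla\Lambda)-\gamma(\nabla\psi^k,\nabla\Lambda)=0,\\ &(\psi^k,\Upsilon)+\delta(\nabla\theta^k,\nabla\Upsilon)+\tfrac1\delta(f(\theta^{k-1}),\Upsilon)+\tfrac1\eta(\delta_t\theta^k,\Upsilon)=0,\\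 &\big(\tfrac{\delta_tM^k}{\tau},Z\big)-b_h^m(U^k,Z,M^k)+\tfrac1{\mathscr T}(M^k,Z)=\tfrac1{\mathscr T}(\chi_\theta H^k,Z),\\ &(\nabla\Phi^k,\nabla X)=(h_a^k-M^k,\nabla X),\\ &\big(\tfrac{\delta_tU^k}{\tau},V\big)+b_h(U^{k-1},U^k,V)+(\nu_\theta T(U^k),T(V))-(P^k,\operatorname{div}V)=\mu_0b_h^m(V,H^k,M^k)+\tfrac\lambda\delta(\theta^{k-1}\nabla\psi^k,V),\\ &(Q,\operatorname{div}U^k)=0 \end{aligned}$$ for all $(\Lambda,\Upsilon,Z,X,V,Q)\in G_h\times Y_h\times M_h\times X_h\times U_h\times P_h$. Assume $\chi_0\le4$ and $\eta\le\delta$. Then: 1. For every $k=1,\dots,K$ and every $(\theta^{k-1},M^{k-1},U^{k-1})\in G_h\times M_h\times U_h$, the $k$-th step has a solution. Consequently, for all initial data $(\theta^0,M^0,U^0)\in G_h\times M_h\times U_h$ there are $\Phi^0\in X_h$ with $(\nabla\Phi^0,\nabla X)=(h_a^0-M^0,\nabla X)$ for all $X\in X_h$, and a sequence of solutions of the steps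 $k=1,\dots,K$ starting from these data. 2. Every sequence $(\theta^k,\psi^k,M^k,\Phi^k,U^k,P^k)_{1\le k\le K}$ that starts from some $(\theta^0,M^0,U^0)\in G_h\times M_h\times U_h$ and $\Phi^0\in X_h$ with $(\nabla\Phi^0,\nabla X)=(h_a^0-M^0,\nabla X)$ for all $X\in X_h$, and that solves all the steps $k=1,\dots,K$, satisfies $$\mathscr E^K+\sum_{k=1}^K\big(\mathscr D_n^k+\tau\,\mathscr D_p^k\big)\le\mathscr E^0+\sum_{k=1}^K\tau\,\mathscr F^k,$$ where $$\begin{aligned} \mathscr E^k&=\tfrac12\|U^k\|^2+\tfrac{\mu_0}2\|M^k\|^2+\tfrac{\mu_0}2\|\nabla\Phi^k\|^2+\tfrac\lambda2\|\nabla\theta^k\|^2+\tfrac\lambda{\delta^2}\int_\Omega F(\theta^k)\,dx,\\ \mathscr D_n^k&=\tfrac12\|\delta_tU^k\|^2+\tfrac{\mu_0}2\|\delta_tM^k\|^2+\tfrac{\mu_0}2\|\delta_t\nabla\Phi^k\|^2+\tfrac\lambda2\|\delta_t\nabla\theta^k\|^2,\\ \mathscr D_p^k&=\tfrac{\mu_0}{\mathscr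 T}\big(1-\tfrac{\chi_0}4\big)\|M^k\|^2+\tfrac{\mu_0}{2\mathscr T}\|\nabla\Phi^k\|^2+\|\sqrt{\nu(\theta^{k-1})}\,T(U^k)\|^2+\tfrac{\lambda\gamma}\delta\|\nabla\psi^k\|^2,\\ \mathscr F^k&=\tfrac{\mu_0}{\mathscr T}\|h_a^k\|^2+\tfrac{\mu_0\mathscr T}{\tau}\int_{t^{k-1}}^{t^k}\|\partial_th_a(s)\|^2\,ds. \end{aligned}$$ -/

import Mathlib

open MeasureTheory
open scoped ContDiff

noncomputable section

namespace Ferro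

/-- Scalar fields of class `L²(Ω)`, `Ω ⊆ ℝᵈ`. -/
abbrev L2 {d : ℕ} (Ω : Set (EuclideanSpace ℝ (Fin d))) : Type :=
  Lp ℝ 2 (volume.restrict Ω)

/-- Vector fields of class `L²(Ω)ᵈ`, given by their components; the inner product is
`(a, b) = ∑ i, ∫_Ω aᵢ bᵢ`. -/
abbrev L2v {d : ℕ} (Ω : Set (EuclideanSpace ℝ (Fin d))) : Type :=
  PiLp 2 (fun _ : Fin d => L2 Ω)

/-- Test functions `φ ∈ C_c^∞(Ω)`. -/
def IsTest {d : ℕ} (Ω : Set (EuclideanSpace ℝ (Fin d))) (φ : EuclideanSpace ℝ (Fin d) → ℝ) :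
    Prop :=
  ContDiff ℝ ∞ φ ∧ HasCompactSupport φ ∧ tsupport φ ⊆ Ω

/-- The classical partial derivative `∂φ/∂xᵢ`. -/
def partialD {d : ℕ} (i : Fin d) (φ : EuclideanSpace ℝ (Fin d) → ℝ)
    (x : EuclideanSpace ℝ (Fin d)) : ℝ :=
  fderiv ℝ φ x (EuclideanSpace.single i 1)

theorem IsTest.integrable_mul {d : ℕ} {Ω : Set (EuclideanSpace ℝ (Fin d))}
    {φ : EuclideanSpace ℝ (Fin d) → ℝ} (h : IsTest Ω φ) (u : L2 Ω) :
    Integrable (fun x => u x * φ x) (volume.restrict Ω) :=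
  (Lp.memLp u).integrable_mul (q := 2) ((h.1.continuous.memLp_of_hasCompactSupport h.2.1).restrict Ω)

theorem IsTest.integrable_mul_partialD {d : ℕ} {Ω : Set (EuclideanSpace ℝ (Fin d))}
    {φ : EuclideanSpace ℝ (Fin d) → ℝ} (h : IsTest Ω φ) (i : Fin d) (u : L2 Ω) :
    Integrable (fun x => u x * partialD i φ x) (volume.restrict Ω) := by
  have hc : Continuous (partialD i φ) :=
    (h.1.continuous_fderiv (by simp)).clm_apply continuous_const
  have hs : HasCompactSupport (partialD i φ) := h.2.1.fderiv_apply (𝕜 := ℝ) _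
  exact (Lp.memLp u).integrable_mul (q := 2) ((hc.memLp_of_hasCompactSupport hs).restrict Ω)

/-- The Sobolev space `H¹(Ω)`: pairs `(u, g)` with `u ∈ L²(Ω)`, `g ∈ L²(Ω)ᵈ` and `g` the weak
gradient of `u` (which is unique when `Ω` is open). -/
def H1 {d : ℕ} (Ω : Set (EuclideanSpace ℝ (Fin d))) : Submodule ℝ (L2 Ω × L2v Ω) where
  carrier := {p | ∀ φ, IsTest Ω φ → ∀ i : Fin d,
    ∫ x in Ω, p.1 x * partialD i φ x = - ∫ x in Ω, p.2 i x * φ x}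
  zero_mem' := by
    intro φ _ i
    have h0 : ∀ w : EuclideanSpace ℝ (Fin d) → ℝ,
        ∫ x in Ω, (0 : L2 Ω) x * w x = 0 := by
      intro w
      rw [integral_congr_ae (g := fun _ => (0 : ℝ)) ?_, integral_zero]
      filter_upwards [Lp.coeFn_zero ℝ 2 (volume.restrict Ω)] with x hx
      rw [hx, Pi.zero_apply, zero_mul]
    change ∫ x in Ω, (0 : L2 Ω) x * partialD i φ x = - ∫ x in Ω, (0 : L2 Ω) x * φ x
    rw [h0, h0, neg_zero]
  add_mem' := by
    intro p q hp hq φ hφ i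
    have h1 : ∫ x in Ω, (p + q).1 x * partialD i φ x
        = (∫ x in Ω, p.1 x * partialD i φ x) + ∫ x in Ω, q.1 x * partialD i φ x := by
      rw [← integral_add (hφ.integrable_mul_partialD i p.1) (hφ.integrable_mul_partialD i q.1)]
      refine integral_congr_ae ?_
      filter_upwards [Lp.coeFn_add p.1 q.1] with x hx
      simp only [Prod.fst_add, hx, Pi.add_apply]
      ring
    have h2 : ∫ x in Ω, (p + q).2 i x * φ x
        = (∫ x in Ω, p.2 i x * φ x) + ∫ x in Ω, q.2 i x * φ x := by
      rw [← integral_add (hφ.integrable_mul (p.2 i)) (hφ.integrable_mul (q.2 i))]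
      refine integral_congr_ae ?_
      filter_upwards [Lp.coeFn_add (p.2 i) (q.2 i)] with x hx
      simp only [Prod.snd_add, PiLp.add_apply, hx, Pi.add_apply]
      ring
    rw [h1, h2, hp φ hφ i, hq φ hφ i]
    ring
  smul_mem' := by
    intro c p hp φ hφ i
    have h1 : ∫ x in Ω, (c • p).1 x * partialD i φ x
        = c * ∫ x in Ω, p.1 x * partialD i φ x := by
      rw [← integral_const_mul]
      refine integral_congr_ae ?_
      filter_upwards [Lp.coeFn_smul c p.1] with x hx
      simp only [Prod.smul_fst, hx, Pi.smul_apply, smul_eq_mul]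
      ring
    have h2 : ∫ x in Ω, (c • p).2 i x * φ x = c * ∫ x in Ω, p.2 i x * φ x := by
      rw [← integral_const_mul]
      refine integral_congr_ae ?_
      filter_upwards [Lp.coeFn_smul c (p.2 i)] with x hx
      simp only [Prod.smul_snd, PiLp.smul_apply, hx, Pi.smul_apply, smul_eq_mul]
      ring
    rw [h1, h2, hp φ hφ i]
    ring

/-- The function underlying an element of `H¹(Ω)`. -/
def val {d : ℕ} {Ω : Set (EuclideanSpace ℝ (Fin d))} : H1 Ω →ₗ[ℝ] L2 Ω :=
  (LinearMap.fst ℝ (L2 Ω) (L2v Ω)).comp (H1 Ω).subtype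

/-- The weak gradient of an element of `H¹(Ω)`. -/
def grad {d : ℕ} {Ω : Set (EuclideanSpace ℝ (Fin d))} : H1 Ω →ₗ[ℝ] L2v Ω :=
  (LinearMap.snd ℝ (L2 Ω) (L2v Ω)).comp (H1 Ω).subtype

/-- The elements of `H¹(Ω)` that are (a.e. equal to) test functions. -/
def testSubmodule {d : ℕ} (Ω : Set (EuclideanSpace ℝ (Fin d))) : Submodule ℝ (H1 Ω) where
  carrier := {u | ∃ φ, IsTest Ω φ ∧ val u =ᵐ[volume.restrict Ω] φ}
  zero_mem' := by
    refine ⟨fun _ => 0, ⟨contDiff_const, HasCompactSupport.zero, ?_⟩, ?_⟩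
    · have : tsupport (fun _ : EuclideanSpace ℝ (Fin d) => (0 : ℝ)) = ∅ := by
        simp
      simp [this]
    · rw [map_zero]
      exact Lp.coeFn_zero ℝ 2 (volume.restrict Ω)
  add_mem' := by
    rintro u v ⟨φ, hφ, hu⟩ ⟨ψ, hψ, hv⟩
    refine ⟨φ + ψ, ⟨hφ.1.add hψ.1, hφ.2.1.add hψ.2.1,
      (tsupport_add φ ψ).trans (Set.union_subset hφ.2.2 hψ.2.2)⟩, ?_⟩
    rw [map_add]
    exact (Lp.coeFn_add _ _).trans (hu.add hv)
  smul_mem' := by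
    rintro c u ⟨φ, hφ, hu⟩
    refine ⟨c • φ, ⟨contDiff_const.smul hφ.1, hφ.2.1.smul_left (f := fun _ => c),
      (tsupport_smul_subset_right (fun _ => c) φ).trans hφ.2.2⟩, ?_⟩
    rw [map_smul]
    exact (Lp.coeFn_smul _ _).trans (hu.const_smul c)

/-- `H¹₀(Ω)`: the closure of `C_c^∞(Ω)` in `H¹(Ω)`. -/
def H10 {d : ℕ} (Ω : Set (EuclideanSpace ℝ (Fin d))) : Submodule ℝ (H1 Ω) :=
  (testSubmodule Ω).topologicalClosure

/-- A vector field in `H¹(Ω)ᵈ`, as a field in `L²(Ω)ᵈ`. -/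
def vval {d : ℕ} {Ω : Set (EuclideanSpace ℝ (Fin d))} (U : Fin d → H1 Ω) : L2v Ω :=
  WithLp.toLp 2 (fun i => val (U i))

/-- The divergence `∑ i, ∂ᵢ Uᵢ`. -/
def dvg {d : ℕ} {Ω : Set (EuclideanSpace ℝ (Fin d))} (U : Fin d → H1 Ω) : L2 Ω :=
  ∑ i, grad (U i) i

/-- The entries `(∂ⱼ Uᵢ + ∂ᵢ Uⱼ) / 2` of the symmetric gradient `T(U)`. -/
def symGrad {d : ℕ} {Ω : Set (EuclideanSpace ℝ (Fin d))} (U : Fin d → H1 Ω) (i j : Fin d) :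
    L2 Ω :=
  (1 / 2 : ℝ) • (grad (U i) j + grad (U j) i)

/-- The weighted pairing `(w a, b) = ∑ i, ∫_Ω w aᵢ bᵢ` of two vector fields. -/
def wInner {d : ℕ} {Ω : Set (EuclideanSpace ℝ (Fin d))} (w : EuclideanSpace ℝ (Fin d) → ℝ)
    (a b : L2v Ω) : ℝ :=
  ∑ i, ∫ x in Ω, w x * a i x * b i x

/-- The viscous form `(w T(U), T(V)) = ∑ i j, ∫_Ω w T(U)ᵢⱼ T(V)ᵢⱼ`. -/
def viscForm {d : ℕ} {Ω : Set (EuclideanSpace ℝ (Fin d))} (w : EuclideanSpace ℝ (Fin d) → ℝ)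
    (U V : Fin d → H1 Ω) : ℝ :=
  ∑ i, ∑ j, ∫ x in Ω, w x * symGrad U i j x * symGrad V i j x

/-- The truncated double well potential `F`. -/
def wellF (s : ℝ) : ℝ :=
  if s ≤ -1 then (s + 1) ^ 2 else if s ≤ 1 then (1 / 4) * (s ^ 2 - 1) ^ 2 else (s - 1) ^ 2

/-- `f = F'`. -/
def wellf (s : ℝ) : ℝ := deriv wellF s

/-- The constitutive data of the two-phase ferrofluid model. -/
structure Params where
  /-- interface thickness `δ` -/
  del : ℝ
  /-- mobility `γ` -/
  mob : ℝ
  /-- capillary coefficient `λ` -/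
  cap : ℝ
  /-- magnetic constant `μ₀` -/
  mu0 : ℝ
  /-- relaxation time -/
  tau : ℝ
  /-- stabilization parameter `η` -/
  eta : ℝ
  /-- viscosity of the non-magnetic phase -/
  nuw : ℝ
  /-- viscosity of the ferrofluid -/
  nuf : ℝ
  /-- magnetic susceptibility `χ₀` of the ferrofluid -/
  chi0 : ℝ
  /-- viscosity as a function of the phase -/
  nu : ℝ → ℝ
  /-- susceptibility as a function of the phase -/
  chi : ℝ → ℝ
  del_pos : 0 < del
  mob_pos : 0 < mob
  cap_pos : 0 < cap
  mu0_pos : 0 < mu0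
  tau_pos : 0 < tau
  eta_pos : 0 < eta
  nuw_pos : 0 < nuw
  nuf_pos : 0 < nuf
  chi0_pos : 0 < chi0
  nu_lipschitz : ∃ L, LipschitzWith L nu
  chi_lipschitz : ∃ L, LipschitzWith L chi
  nu_lower : ∀ s, min nuw nuf ≤ nu s
  nu_upper : ∀ s, nu s ≤ max nuw nuf
  chi_nonneg : ∀ s, 0 ≤ chi s
  chi_le : ∀ s, chi s ≤ chi0

/-- The finite dimensional spaces of a Galerkin discretization on `Ω`. -/
structure Spaces {d : ℕ} (Ω : Set (EuclideanSpace ℝ (Fin d))) where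
  /-- phase field -/
  phase : Submodule ℝ (H1 Ω)
  /-- chemical potential -/
  chem : Submodule ℝ (H1 Ω)
  /-- magnetization -/
  mag : Submodule ℝ (L2v Ω)
  /-- magnetic potential -/
  pot : Submodule ℝ (H1 Ω)
  /-- velocity -/
  vel : Submodule ℝ (Fin d → H1 Ω)
  /-- pressure -/
  pres : Submodule ℝ (L2 Ω)
  phase_fin : FiniteDimensional ℝ phase
  chem_fin : FiniteDimensional ℝ chem
  mag_fin : FiniteDimensional ℝ mag
  pot_fin : FiniteDimensional ℝ pot
  vel_fin : FiniteDimensional ℝ vel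
  pres_fin : FiniteDimensional ℝ pres
  /-- velocities lie in `H¹₀(Ω)ᵈ` -/
  vel_zero : ∀ U ∈ vel, ∀ i, U i ∈ H10 Ω

/-- The discrete unknowns at one time level. -/
structure State {d : ℕ} {Ω : Set (EuclideanSpace ℝ (Fin d))} (S : Spaces Ω) where
  /-- phase field -/
  θ : S.phase
  /-- chemical potential -/
  ψ : S.chem
  /-- magnetization -/
  M : S.mag
  /-- magnetic potential -/
  Φ : S.pot
  /-- velocity -/
  U : S.vel
  /-- pressure -/
  P : S.pres

section Scheme

variable {d : ℕ} {Ω : Set (EuclideanSpace ℝ (Fin d))} {S : Spaces Ω}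

/-- The discrete magnetostatic problem `(∇Φ, ∇X) = (h - M, ∇X)` for all `X` in the potential
space. -/
def SolvesPotential (h : L2v Ω) (x : State S) : Prop :=
  ∀ X : S.pot, inner ℝ (grad (x.Φ : H1 Ω)) (grad (X : H1 Ω))
    = inner ℝ (h - (x.M : L2v Ω)) (grad (X : H1 Ω))

/-- One time step of the scheme: `x` solves the fully coupled system, where `y` is the previous
time level, `dt` the time step, `h` the applied field at the new time level. The effective
field is `H = ∇Φ`, an element of the magnetization space by `hgrad`. -/
structure SolvesStep (p : Params) (hgrad : ∀ X ∈ S.pot, grad X ∈ S.mag)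
    (bh : S.vel →ₗ[ℝ] S.vel →ₗ[ℝ] S.vel →ₗ[ℝ] ℝ) (bm : S.vel →ₗ[ℝ] S.mag →ₗ[ℝ] S.mag →ₗ[ℝ] ℝ)
    (dt : ℝ) (h : L2v Ω) (y x : State S) : Prop where
  cahn1 : ∀ Λ : S.phase,
    inner ℝ ((1 / dt) • (val (x.θ : H1 Ω) - val (y.θ : H1 Ω))) (val (Λ : H1 Ω))
      - wInner (val (y.θ : H1 Ω)) (vval (x.U : Fin d → H1 Ω)) (grad (Λ : H1 Ω))
      - p.mob * inner ℝ (grad (x.ψ : H1 Ω)) (grad (Λ : H1 Ω)) = 0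
  cahn2 : ∀ Υ : S.chem,
    inner ℝ (val (x.ψ : H1 Ω)) (val (Υ : H1 Ω))
      + p.del * inner ℝ (grad (x.θ : H1 Ω)) (grad (Υ : H1 Ω))
      + (1 / p.del) * (∫ z in Ω, wellf (val (y.θ : H1 Ω) z) * val (Υ : H1 Ω) z)
      + (1 / p.eta) * inner ℝ (val (x.θ : H1 Ω) - val (y.θ : H1 Ω)) (val (Υ : H1 Ω)) = 0
  magnetization : ∀ Z : S.mag,
    inner ℝ ((1 / dt) • ((x.M : L2v Ω) - (y.M : L2v Ω))) (Z : L2v Ω)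
      - bm x.U Z x.M
      + (1 / p.tau) * inner ℝ (x.M : L2v Ω) (Z : L2v Ω)
      = (1 / p.tau) *
        wInner (fun z => p.chi (val (y.θ : H1 Ω) z)) (grad (x.Φ : H1 Ω)) (Z : L2v Ω)
  potential : SolvesPotential h x
  momentum : ∀ V : S.vel,
    inner ℝ ((1 / dt) • (vval (x.U : Fin d → H1 Ω) - vval (y.U : Fin d → H1 Ω)))
        (vval (V : Fin d → H1 Ω))
      + bh y.U x.U V
      + viscForm (fun z => p.nu (val (y.θ : H1 Ω) z)) (x.U : Fin d → H1 Ω) (V : Fin d → H1 Ω)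
      - inner ℝ (x.P : L2 Ω) (dvg (V : Fin d → H1 Ω))
      = p.mu0 * bm V ⟨grad (x.Φ : H1 Ω), hgrad _ x.Φ.2⟩ x.M
        + (p.cap / p.del) *
          wInner (val (y.θ : H1 Ω)) (grad (x.ψ : H1 Ω)) (vval (V : Fin d → H1 Ω))
  incompressible : ∀ Q : S.pres, inner ℝ (Q : L2 Ω) (dvg (x.U : Fin d → H1 Ω)) = 0

/-- The energy `ℰ` of a time level. -/
def energy (p : Params) (x : State S) : ℝ :=
  (1 / 2) * ‖vval (x.U : Fin d → H1 Ω)‖ ^ 2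
    + (p.mu0 / 2) * ‖(x.M : L2v Ω)‖ ^ 2
    + (p.mu0 / 2) * ‖grad (x.Φ : H1 Ω)‖ ^ 2
    + (p.cap / 2) * ‖grad (x.θ : H1 Ω)‖ ^ 2
    + (p.cap / p.del ^ 2) * ∫ z in Ω, wellF (val (x.θ : H1 Ω) z)

/-- The numerical dissipation `𝒟ₙ` of the increments from `y` to `x`. -/
def numDissipation (p : Params) (y x : State S) : ℝ :=
  (1 / 2) * ‖vval (x.U : Fin d → H1 Ω) - vval (y.U : Fin d → H1 Ω)‖ ^ 2
    + (p.mu0 / 2) * ‖(x.M : L2v Ω) - (y.M : L2v Ω)‖ ^ 2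
    + (p.mu0 / 2) * ‖grad (x.Φ : H1 Ω) - grad (y.Φ : H1 Ω)‖ ^ 2
    + (p.cap / 2) * ‖grad (x.θ : H1 Ω) - grad (y.θ : H1 Ω)‖ ^ 2

/-- The physical dissipation `𝒟ₚ` at the time level `x`; the viscosity is evaluated, as in the
scheme, at the phase field of the previous time level `y`. -/
def physDissipation (p : Params) (y x : State S) : ℝ :=
  (p.mu0 / p.tau) * (1 - p.chi0 / 4) * ‖(x.M : L2v Ω)‖ ^ 2
    + (p.mu0 / (2 * p.tau)) * ‖grad (x.Φ : H1 Ω)‖ ^ 2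
    + viscForm (fun z => p.nu (val (y.θ : H1 Ω) z)) (x.U : Fin d → H1 Ω) (x.U : Fin d → H1 Ω)
    + (p.cap * p.mob / p.del) * ‖grad (x.ψ : H1 Ω)‖ ^ 2

end Scheme

/-- The forcing `ℱ` of step `k`, for the applied field `ha : [0, T] → L²(Ω)ᵈ` and the time step
`dt`. -/
def forcing {d : ℕ} {Ω : Set (EuclideanSpace ℝ (Fin d))} (p : Params) (T dt : ℝ)
    (ha : ℝ → L2v Ω) (k : ℕ) : ℝ :=
  (p.mu0 / p.tau) * ‖ha (k * dt)‖ ^ 2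
    + (p.mu0 * p.tau / dt) *
      ∫ s in (((k : ℝ) - 1) * dt)..(k * dt), ‖derivWithin ha (Set.Icc 0 T) s‖ ^ 2

end Ferro

end

noncomputable section

namespace Ferro

/-! Stability. One step is tested with Λ = ψᵏ, Υ = θᵏ − θᵏ⁻¹, Z = Mᵏ, Z = Hᵏ, V = Uᵏ and Q = Pᵏ, and
the potential equation of both levels k and k − 1 is tested with Φᵏ. Convection and the pressure
drop out, the capillary force cancels against the transport of θ, and the magnetic force cancels
against the transport of M tested with H. Three inequalities close the balance. Since F'' ≤ 2, the
Taylor remainder of F is at most (δₜθ)², which the stabilization absorbs because η ≤ δ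
(`wellF_le_quadratic`). The relaxation term obeys (χH, M) ≤ (χH, H) + (χ₀/4)‖M‖², and (χH, H) is
supplied by the test with H (`wInner_le`). Young's inequality treats the applied field and its
increment, each time spending a quarter of the dissipation of H. This is `energy_balance`;
`energy_estimate` telescopes.

Solvability. The good magnetic unknown is N = M − H. With P the projection onto the discrete
gradients, H = P(h − M) gives H = ½P(h − N), an affine function of N. Tested with (U, N), the two
magnetic terms add up to −b(U, M, M) = 0, so the nonlinearity does no work, and the linear part in N
is definite because χ₀ ≤ 4 (`magnetic_form_pos`). The phase field is an affine function of ψ, with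
monotone linear part (`exists_phase_elimination`). The velocity is sought among discretely
divergence free fields and the pressure recovered as a multiplier (`exists_multiplier`). What is
left is a definite linear problem plus a polynomial term without power on a finite dimensional
space. It is solvable because a C¹ field pointing outwards on large spheres has a zero, a
consequence of the C¹ no-retraction theorem (`no_contDiff_retraction`), proved by the volume
polynomial argument.

Function spaces. The coupling (Uθ, ∇Λ) has to be linear in U for arbitrary θ ∈ H¹ and U ∈ H¹₀, which
requires θUᵢ ∈ L². Hölder reduces this to θ, U ∈ L⁴ if d = 2, and to θ ∈ L³, U ∈ L⁶ if d = 3. For U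
in three dimensions the Sobolev inequality for test functions suffices. For θ, convexity provides
cutoffs ρ that decrease along a cone of directions, so |∇ρ| is controlled by the radial derivative
−(x − x₀)·∇ρ, and integration by parts removes the latter. The Gagliardo–Nirenberg inequality for
(ρθ)² then holds uniformly in ρ (`memLp_val_mul_val`). -/

/-! ### No retraction onto the sphere, zeros of outward fields, coercive Galerkin problems. -/

/-- The determinant of `1 + A` is a fixed linear combination of those of `1 + tᵢ A`, for any
`n + 1` distinct nodes `tᵢ`. -/
theorem exists_weights_det_one_add {E : Type*} [NormedAddCommGroup E] [NormedSpace ℝ E]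
    [FiniteDimensional ℝ E] {t : ℕ → ℝ} (ht : Function.Injective t) :
    ∃ w : ℕ → ℝ, ∀ A : E →L[ℝ] E, (1 + A).det =
      ∑ i ∈ Finset.range (Module.finrank ℝ E + 1), w i * (1 + t i • A).det := by
  classical
  set s := Finset.range (Module.finrank ℝ E + 1)
  -- The map r ↦ det(1 + rA) is a polynomial of degree at most dim E, so its value at 1 is
  -- interpolated from the nodes; the Lagrange weights do not see A.
  refine ⟨fun i => (Lagrange.basis s t i).eval 1, fun A => ?_⟩
  let b := Module.finBasis ℝ E
  let M := LinearMap.toMatrix b b (A : E →ₗ[ℝ] E)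
  let q : Polynomial ℝ :=
    Matrix.det ((Polynomial.X : Polynomial ℝ) • M.map Polynomial.C
      + (1 : Matrix _ _ ℝ).map Polynomial.C)
  have hq : ∀ r : ℝ, q.eval r = (1 + r • A).det := by
    intro r
    have h1 : (1 + r • A).det = Matrix.det (1 + r • M) := by
      rw [ContinuousLinearMap.det, ← LinearMap.det_toMatrix b]
      congr 1
      simp [M]
    rw [h1, ← Polynomial.coe_evalRingHom, RingHom.map_det]
    congr 1
    ext i j
    simp [Matrix.one_apply, apply_ite, add_comm, mul_comm (M i j)]
  have hdeg : q.degree < s.card := by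
    refine lt_of_le_of_lt Polynomial.degree_le_natDegree ?_
    have := Polynomial.natDegree_det_X_add_C_le M 1
    simp only [Fintype.card_fin] at this
    simp only [s, Finset.card_range]
    exact_mod_cast Nat.lt_succ_of_le this
  have key := Lagrange.eq_interpolate (s := s) (v := t) ht.injOn hdeg
  have h1 := congrArg (Polynomial.eval 1) key
  rw [hq, one_smul, Lagrange.interpolate_apply, Polynomial.eval_finsetSum] at h1
  rw [h1]
  refine Finset.sum_congr rfl fun i _ => ?_
  simp [hq, mul_comm]

variable {E : Type*} [NormedAddCommGroup E] [InnerProductSpace ℝ E] [FiniteDimensional ℝ E]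

/-- A small `C¹` perturbation of the identity that fixes a sphere and preserves the ball is
volume preserving on the ball. -/
theorem exists_forall_integral_det_eq [MeasurableSpace E] [BorelSpace E] {f : E → E} {R : ℝ}
    (hf : ContDiff ℝ 1 f)
    (hfR : ∀ x, ‖x‖ ≤ R → ‖f x‖ ≤ R) (hfix : ∀ x, ‖x‖ = R → f x = x) :
    ∃ δ > 0, ∀ t : ℝ, 0 ≤ t → t < δ →
      ∫ x in Metric.ball (0 : E) R, (1 + t • (fderiv ℝ f x - 1)).det
        = volume.real (Metric.ball (0 : E) R) := by
  have hcont : Continuous fun x => fderiv ℝ f x - 1 :=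
    (hf.continuous_fderiv (by simp)).sub continuous_const
  obtain ⟨C, hC⟩ := (isCompact_closedBall (0 : E) R).exists_bound_of_continuousOn hcont.continuousOn
  set K : ℝ := max C 1
  have hK : 0 < K := lt_of_lt_of_le one_pos (le_max_right _ _)
  have hdetc : Continuous fun A : E →L[ℝ] E => A.det := ContinuousLinearMap.continuous_det
  obtain ⟨ε, hε, hεdet⟩ : ∃ ε > 0, ∀ A : E →L[ℝ] E, ‖A‖ < ε → 0 < (1 + A).det := by
    have h1 : 0 < (1 + (0 : E →L[ℝ] E)).det := by
      have : (1 + (0 : E →L[ℝ] E)).det = 1 := by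
        rw [add_zero]; exact LinearMap.det_id
      rw [this]; exact one_pos
    have h2 : Continuous fun A : E →L[ℝ] E => (1 + A).det :=
      hdetc.comp (continuous_const.add continuous_id)
    obtain ⟨ε, hε, h⟩ := Metric.eventually_nhds_iff.1
      (h2.continuousAt.eventually (lt_mem_nhds h1))
    exact ⟨ε, hε, fun A hA => h (by simpa using hA)⟩
  -- The three bounds on t serve, in this order, positivity of the determinant, injectivity and
  -- openness of `F` (a perturbation of the identity with Lipschitz constant below 1/2), and `F x`
  -- being a convex combination of x and f x with positive weight on x.
  refine ⟨min (ε / K) (min (1 / (2 * K)) 1), by positivity, fun t ht0 ht => ?_⟩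
  have ht1 : t * K < ε := by
    rw [← lt_div_iff₀ hK]; exact ht.trans_le (min_le_left _ _)
  have ht2 : t * K < 1 / 2 := by
    have : t < 1 / (2 * K) := ht.trans_le ((min_le_right _ _).trans (min_le_left _ _))
    rw [lt_div_iff₀ (by positivity)] at this
    linarith
  have ht3 : t < 1 := ht.trans_le ((min_le_right _ _).trans (min_le_right _ _))
  let F : E → E := fun x => x + t • (f x - x)
  have hfd : ∀ x, HasFDerivAt f (fderiv ℝ f x) x := fun x =>
    (hf.differentiable (by simp) x).hasFDerivAt
  have hFd : ∀ x, HasFDerivAt F (1 + t • (fderiv ℝ f x - 1)) x := fun x =>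
    (hasFDerivAt_id x).add (((hfd x).sub (hasFDerivAt_id x)).const_smul t)
  have hlip : ∀ x ∈ Metric.closedBall (0 : E) R, ∀ y ∈ Metric.closedBall (0 : E) R,
      ‖(f y - y) - (f x - x)‖ ≤ K * ‖y - x‖ := by
    intro x hx y hy
    exact (convex_closedBall (0 : E) R).norm_image_sub_le_of_norm_hasFDerivWithin_le
      (f := fun x => f x - x) (f' := fun x => fderiv ℝ f x - 1)
      (fun z _ => ((hfd z).sub (hasFDerivAt_id z)).hasFDerivWithinAt)
      (fun z hz => (hC z hz).trans (le_max_left _ _)) hx hy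
  have happ : ApproximatesLinearOn F ((ContinuousLinearEquiv.refl ℝ E : E ≃L[ℝ] E) : E →L[ℝ] E)
      (Metric.ball (0 : E) R) ⟨1 / 2, by norm_num⟩ := by
    intro x hx y hy
    have h := hlip y (Metric.ball_subset_closedBall hy) x (Metric.ball_subset_closedBall hx)
    have e : F x - F y - ((ContinuousLinearEquiv.refl ℝ E : E ≃L[ℝ] E) : E →L[ℝ] E) (x - y)
        = t • ((f x - x) - (f y - y)) := by
      simp only [F, ContinuousLinearEquiv.coe_refl, ContinuousLinearMap.coe_id', id]
      module
    rw [e, norm_smul, Real.norm_of_nonneg ht0]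
    change t * _ ≤ (1 / 2 : ℝ) * _
    nlinarith [norm_nonneg (x - y)]
  have hhalf : ∀ e : E ≃L[ℝ] E, e = ContinuousLinearEquiv.refl ℝ E →
      Subsingleton E ∨ (⟨1 / 2, by norm_num⟩ : NNReal) < ‖(e.symm : E →L[ℝ] E)‖₊⁻¹ := by
    rintro e rfl
    rcases subsingleton_or_nontrivial E with h | h
    · exact Or.inl h
    · right
      have : ‖((ContinuousLinearEquiv.refl ℝ E).symm : E →L[ℝ] E)‖₊ = 1 := by
        ext
        simp
      rw [this, inv_one]
      change (1 / 2 : ℝ) < 1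
      norm_num
  have hinj : Set.InjOn F (Metric.ball 0 R) := happ.injOn (hhalf _ rfl)
  have hopen : IsOpen (F '' Metric.ball 0 R) := by
    refine happ.open_image (ContinuousLinearEquiv.toNonlinearRightInverse _) Metric.isOpen_ball ?_
    exact hhalf _ rfl
  have hFcont : Continuous F := by
    have := hf.continuous
    fun_prop
  have hmaps : ∀ x ∈ Metric.ball (0 : E) R, F x ∈ Metric.ball (0 : E) R := by
    intro x hx
    rw [mem_ball_zero_iff] at hx ⊢
    have e : F x = (1 - t) • x + t • f x := by simp only [F]; module
    rw [e]
    calc ‖(1 - t) • x + t • f x‖ ≤ (1 - t) * ‖x‖ + t * ‖f x‖ := by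
          refine (norm_add_le _ _).trans ?_
          rw [norm_smul, norm_smul, Real.norm_of_nonneg ht0, Real.norm_of_nonneg (by linarith)]
      _ ≤ (1 - t) * ‖x‖ + t * R := by gcongr; exact hfR x hx.le
      _ < R := by nlinarith
  -- The image is open, and relatively closed in the connected ball: a limit point is the image of a
  -- point of the closed ball, and boundary points are fixed, hence stay outside the open ball.
  have himage : F '' Metric.ball 0 R = Metric.ball 0 R := by
    refine Set.Subset.antisymm (Set.image_subset_iff.2 hmaps) ?_
    rcases (Metric.ball (0 : E) R).eq_empty_or_nonempty with h0 | ⟨z, hz⟩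
    · rw [h0]; exact Set.empty_subset _
    refine (convex_ball (0 : E) R).isPreconnected.subset_of_closure_inter_subset hopen
      ⟨F z, hmaps z hz, Set.mem_image_of_mem F hz⟩ ?_
    rintro y ⟨hy, hyR⟩
    have hcl : IsClosed (F '' Metric.closedBall 0 R) :=
      ((isCompact_closedBall (0 : E) R).image hFcont).isClosed
    have hy' : y ∈ F '' Metric.closedBall 0 R :=
      (hcl.closure_subset_iff.2 (Set.image_mono Metric.ball_subset_closedBall)) hy
    obtain ⟨x, hx, rfl⟩ := hy'
    rw [mem_closedBall_zero_iff] at hx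
    rcases hx.lt_or_eq with h | h
    · exact Set.mem_image_of_mem F (by simpa using h)
    · have : F x = x := by simp [F, hfix x h]
      rw [mem_ball_zero_iff, this, h] at hyR
      exact absurd hyR (lt_irrefl _)
  have hcv := integral_image_eq_integral_abs_det_fderiv_smul volume
    (Metric.isOpen_ball.measurableSet (s := Metric.ball (0 : E) R))
    (fun x _ => (hFd x).hasFDerivWithinAt) hinj (fun _ => (1 : ℝ))
  rw [himage] at hcv
  simp only [integral_const, smul_eq_mul, mul_one] at hcv
  rw [measureReal_restrict_apply_univ] at hcv
  rw [hcv]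
  refine setIntegral_congr_fun Metric.isOpen_ball.measurableSet fun x hx => ?_
  have : ‖t • (fderiv ℝ f x - 1)‖ < ε := by
    rw [norm_smul, Real.norm_of_nonneg ht0]
    refine lt_of_le_of_lt ?_ ht1
    gcongr
    exact (hC x (Metric.ball_subset_closedBall hx)).trans (le_max_left _ _)
  exact (abs_of_pos (hεdet _ this)).symm

/-- There is no `C¹` retraction of a ball onto its boundary sphere. -/
theorem no_contDiff_retraction {f : E → E} {R : ℝ} (hR : 0 < R) (hf : ContDiff ℝ 1 f)
    (hfR : ∀ x, ‖x‖ ≤ R → ‖f x‖ = R) (hfix : ∀ x, ‖x‖ = R → f x = x) : False := by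
  borelize E
  obtain ⟨δ, hδ, hvol⟩ := exists_forall_integral_det_eq hf (fun x hx => (hfR x hx).le) hfix
  -- The shift by 2 keeps the first node strictly below `δ`.
  let t : ℕ → ℝ := fun i => δ / (i + 2)
  have ht : Function.Injective t := by
    intro i j hij
    simp only [t] at hij
    rw [div_eq_div_iff (by positivity) (by positivity)] at hij
    have := mul_left_cancel₀ hδ.ne' hij
    exact_mod_cast (by linarith : (i : ℝ) = j)
  obtain ⟨w, hw⟩ := exists_weights_det_one_add (E := E) ht
  have hcont : Continuous fun x => fderiv ℝ f x - 1 :=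
    (hf.continuous_fderiv (by simp)).sub continuous_const
  have hint : ∀ r : ℝ, IntegrableOn (fun x => (1 + r • (fderiv ℝ f x - 1)).det)
      (Metric.ball (0 : E) R) := by
    intro r
    have : Continuous fun x => (1 + r • (fderiv ℝ f x - 1)).det :=
      ContinuousLinearMap.continuous_det.comp (continuous_const.add (hcont.const_smul r))
    exact (this.continuousOn.integrableOn_compact (isCompact_closedBall (0 : E) R)).mono_set
      Metric.ball_subset_closedBall
  -- The volume identity, known for small t only, extends to t = 1 by interpolation; the weights sum
  -- to 1, as A = 0 shows.
  have h1 : ∫ x in Metric.ball (0 : E) R, (1 + (fderiv ℝ f x - 1)).det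
      = volume.real (Metric.ball (0 : E) R) := by
    simp_rw [fun x => hw (fderiv ℝ f x - 1)]
    rw [integral_finsetSum _ fun i _ => (hint (t i)).const_mul (w i)]
    have h2 : ∀ i ∈ Finset.range (Module.finrank ℝ E + 1),
        ∫ x in Metric.ball (0 : E) R, w i * (1 + t i • (fderiv ℝ f x - 1)).det
          = w i * volume.real (Metric.ball (0 : E) R) := by
      intro i _
      rw [integral_const_mul, hvol (t i) (by positivity) ?_]
      exact (div_lt_self hδ (by linarith [(Nat.cast_nonneg i : (0 : ℝ) ≤ i)]))
    rw [Finset.sum_congr rfl h2, ← Finset.sum_mul]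
    have h3 := hw 0
    have h4 : (1 : E →L[ℝ] E).det = 1 := LinearMap.det_id
    simp only [add_zero, smul_zero, h4, mul_one] at h3
    rw [← h3, one_mul]
  have h0 : ∫ x in Metric.ball (0 : E) R, (1 + (fderiv ℝ f x - 1)).det = 0 := by
    rw [← integral_zero E ℝ (μ := volume.restrict (Metric.ball (0 : E) R))]
    refine setIntegral_congr_fun Metric.isOpen_ball.measurableSet fun x hx => ?_
    rw [add_sub_cancel]
    -- An invertible derivative would reach f x itself, but ‖f‖² is constant, so the range of the
    -- derivative is orthogonal to f x ≠ 0.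
    by_contra hne
    have hsurj : Function.Surjective (fderiv ℝ f x) :=
      (LinearMap.equivOfDetNeZero (fderiv ℝ f x : E →ₗ[ℝ] E) hne).surjective
    have hd : HasFDerivAt f (fderiv ℝ f x) x := (hf.differentiable (by simp) x).hasFDerivAt
    have hin := hd.inner ℝ hd
    have hc : (fun y => inner ℝ (f y) (f y)) =ᶠ[nhds x] fun _ => R ^ 2 := by
      filter_upwards [Metric.isOpen_ball.mem_nhds hx] with y hy
      rw [real_inner_self_eq_norm_sq, hfR y (by simpa using (Metric.ball_subset_closedBall hy))]
    have hz := (hasFDerivAt_const (𝕜 := ℝ) (R ^ 2) x).congr_of_eventuallyEq hc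
    obtain ⟨v, hv⟩ := hsurj (f x)
    have := congrArg (fun L : E →L[ℝ] ℝ => L v) (hin.unique hz)
    simp [hv, hfR x (by simpa using (Metric.ball_subset_closedBall hx))] at this
    exact hR.ne' this
  rw [h0] at h1
  have : 0 < volume.real (Metric.ball (0 : E) R) :=
    ENNReal.toReal_pos (Metric.measure_ball_pos volume _ hR).ne' measure_ball_lt_top.ne
  exact this.ne h1

/-- A `C¹` vector field that points outwards outside a ball has a zero. -/
theorem exists_eq_zero_of_inner_pos {F : E → E} (hF : ContDiff ℝ 1 F) {R : ℝ}
    (hpos : ∀ x, R ≤ ‖x‖ → 0 < inner ℝ (F x) x) : ∃ x, F x = 0 := by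
  by_contra! hne
  wlog hR : 0 < R generalizing R
  · exact this (R := 1) (fun x hx => hpos x (by linarith)) one_pos
  let φ : ContDiffBump (0 : E) := ⟨R, 2 * R, hR, by linarith⟩
  -- `G` interpolates between `F` on the ball of radius R and the identity outside radius 2R. It
  -- never vanishes: in the transition region both parts have positive inner product with x.
  -- Normalizing it gives the forbidden retraction.
  let G : E → E := fun x => φ x • F x + (1 - φ x) • x
  have hφ : ContDiff ℝ 1 φ := φ.contDiff
  have hG : ContDiff ℝ 1 G := (hφ.smul hF).add ((contDiff_const.sub hφ).smul contDiff_id)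
  have hG0 : ∀ x, G x ≠ 0 := by
    intro x hx
    rcases le_total ‖x‖ R with h | h
    · have : φ x = 1 := φ.one_of_mem_closedBall (by simpa using h)
      simp only [G, this, one_smul, sub_self, zero_smul, add_zero] at hx
      exact hne x hx
    · have h1 : inner ℝ (G x) x = φ x * inner ℝ (F x) x + (1 - φ x) * ‖x‖ ^ 2 := by
        simp only [G, inner_add_left, real_inner_smul_left, real_inner_self_eq_norm_sq]
      rw [hx, inner_zero_left] at h1
      have h2 := hpos x h
      have h3 : 0 < ‖x‖ ^ 2 := by have := hR.trans_le h; positivity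
      have h4 := φ.nonneg' x
      have h5 : φ x ≤ 1 := φ.le_one
      rcases h4.eq_or_lt with h6 | h6
      · rw [← h6] at h1; linarith
      · nlinarith [mul_pos h6 h2, mul_nonneg (sub_nonneg.2 h5) h3.le]
  have hGid : ∀ x, 2 * R ≤ ‖x‖ → G x = x := by
    intro x hx
    have : φ x = 0 := φ.zero_of_le_dist (by simpa using hx)
    simp [G, this]
  refine no_contDiff_retraction (f := fun x => (2 * R / ‖G x‖) • G x) (R := 2 * R) (by linarith)
    ?_ ?_ ?_
  · exact (contDiff_const.div (hG.norm ℝ hG0) fun x => norm_ne_zero_iff.2 (hG0 x)).smul hG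
  · intro x _
    rw [norm_smul, Real.norm_of_nonneg (by positivity),
      div_mul_cancel₀ _ (norm_ne_zero_iff.2 (hG0 x))]
  · intro x hx
    simp only [hGid x hx.ge, hx]
    rw [div_self (by linarith), one_smul]

/-- Solvability of `a u v = 0` for all `v`, for a coercive form `a` on a finite dimensional space
that is linear in the second and `C¹` in the first argument. -/
theorem exists_forall_eq_zero_of_coercive {V : Type*} [NormedAddCommGroup V] [NormedSpace ℝ V]
    [FiniteDimensional ℝ V] (a : V → V →ₗ[ℝ] ℝ) (ha : ∀ v, ContDiff ℝ 1 fun u => a u v) {R : ℝ}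
    (hpos : ∀ u, R ≤ ‖u‖ → 0 < a u u) : ∃ u, ∀ v, a u v = 0 := by
  classical
  let W := EuclideanSpace ℝ (Fin (Module.finrank ℝ V))
  let e : V ≃L[ℝ] W := ContinuousLinearEquiv.ofFinrankEq (by simp [W])
  let F : W → W := fun w => WithLp.toLp 2 fun i => a (e.symm w) (e.symm (EuclideanSpace.single i 1))
  have hFin : ∀ w v, inner ℝ (F w) v = a (e.symm w) (e.symm v) := by
    intro w v
    have hv : v = ∑ i, v i • EuclideanSpace.single i (1 : ℝ) := by
      have := (EuclideanSpace.basisFun (Fin (Module.finrank ℝ V)) ℝ).sum_repr v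
      simpa using this.symm
    conv_rhs => rw [hv]
    simp only [map_sum, map_smul, F, smul_eq_mul]
    refine Finset.sum_congr rfl fun i _ => ?_
    simp
  have hF : ContDiff ℝ 1 F := by
    rw [contDiff_euclidean]
    intro i
    exact (ha _).comp e.symm.contDiff
  have hFpos : ∀ w, ‖(e : V →L[ℝ] W)‖ * |R| + 1 ≤ ‖w‖ → 0 < inner ℝ (F w) w := by
    intro w hw
    rw [hFin]
    apply hpos
    by_contra! hlt
    have h1 : ‖w‖ ≤ ‖(e : V →L[ℝ] W)‖ * ‖e.symm w‖ := by
      simpa using (e : V →L[ℝ] W).le_opNorm (e.symm w)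
    have h2 : ‖(e : V →L[ℝ] W)‖ * ‖e.symm w‖ ≤ ‖(e : V →L[ℝ] W)‖ * |R| := by
      gcongr
      exact hlt.le.trans (le_abs_self R)
    linarith
  obtain ⟨w, hw⟩ := exists_eq_zero_of_inner_pos hF hFpos
  refine ⟨e.symm w, fun v => ?_⟩
  have := hFin w (e v)
  rw [hw, inner_zero_left, e.symm_apply_apply] at this
  exact this.symm

/-! ### Mollification in L² and its commutation with weak derivatives. -/

section Mollify

open Filter Topology ContinuousLinearMap
open scoped Convolution ENNReal

/-- The ambient Euclidean space. -/
abbrev Pt (d : ℕ) : Type := EuclideanSpace ℝ (Fin d)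

variable {d : ℕ}

/-- A sequence of bump functions at the origin with shrinking supports. -/
def bump (d n : ℕ) : ContDiffBump (0 : Pt d) :=
  ⟨1 / (n + 1), 2 / (n + 1), by positivity, by gcongr; norm_num⟩

theorem tendsto_bump_rOut : Tendsto (fun n => (bump d n).rOut) atTop (𝓝 0) := by
  have := (tendsto_one_div_add_atTop_nhds_zero_nat (𝕜 := ℝ)).const_mul 2
  simpa [bump, mul_one_div, div_eq_mul_inv] using this

/-- Mollification with `bump d n`. -/
def mollify (n : ℕ) (f : Pt d → ℝ) : Pt d → ℝ :=
  (bump d n).normed volume ⋆[lsmul ℝ ℝ, volume] f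

theorem mollify_apply (n : ℕ) (f : Pt d → ℝ) (x : Pt d) :
    mollify n f x = ∫ t, (bump d n).normed volume t * f (x - t) := rfl

theorem contDiff_mollify (n : ℕ) {f : Pt d → ℝ} (hf : LocallyIntegrable f) :
    ContDiff ℝ ∞ (mollify n f) :=
  (bump d n).hasCompactSupport_normed.contDiff_convolution_left _ (bump d n).contDiff_normed hf

theorem hasCompactSupport_mollify (n : ℕ) {f : Pt d → ℝ} (hf : HasCompactSupport f) :
    HasCompactSupport (mollify n f) :=
  (bump d n).hasCompactSupport_normed.convolution _ hf

theorem ae_tendsto_mollify {f : Pt d → ℝ} (hf : LocallyIntegrable f) :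
    ∀ᵐ x, Tendsto (fun n => mollify n f x) atTop (𝓝 (f x)) := by
  refine ContDiffBump.ae_convolution_tendsto_right_of_locallyIntegrable (K := 2)
    tendsto_bump_rOut (Eventually.of_forall fun n => ?_) hf
  simp [bump, div_eq_mul_inv]

/-- Jensen's inequality for the probability measure φ dy, obtained from Cauchy–Schwarz against the
constant 1. -/
theorem sq_lintegral_mul_le {φ h : Pt d → ℝ≥0∞} (hφ : Measurable φ) (hh : Measurable h)
    (hφ1 : ∫⁻ y, φ y = 1) : (∫⁻ y, φ y * h y) ^ 2 ≤ ∫⁻ y, φ y * h y ^ 2 := by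
  have h1 := ENNReal.lintegral_mul_le_Lp_mul_Lq (volume.withDensity φ)
    Real.HolderConjugate.two_two hh.aemeasurable (g := fun _ => 1) aemeasurable_const
  simp only [Pi.mul_apply, mul_one, ENNReal.one_rpow] at h1
  rw [lintegral_withDensity_eq_lintegral_mul _ hφ hh,
    lintegral_withDensity_eq_lintegral_mul _ hφ (hh.pow_const _),
    lintegral_withDensity_eq_lintegral_mul _ hφ measurable_const] at h1
  simp only [Pi.mul_apply, mul_one, hφ1, ENNReal.one_rpow, ENNReal.rpow_two] at h1
  calc (∫⁻ y, φ y * h y) ^ 2 ≤ ((∫⁻ y, φ y * h y ^ 2) ^ (1 / 2 : ℝ)) ^ 2 := by gcongr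
    _ = _ := by
      rw [← ENNReal.rpow_two, ← ENNReal.rpow_mul]
      norm_num

theorem eLpNorm_two_sq (f : Pt d → ℝ) : eLpNorm f 2 volume ^ 2 = ∫⁻ x, ‖f x‖ₑ ^ 2 := by
  have := eLpNorm_nnreal_pow_eq_lintegral (f := f) (μ := volume) (p := 2) (by norm_num)
  simpa using this

/-- The mollification error is an average of the differences f(· − y) − f over small y; Jensen
pointwise and Tonelli bound it by the worst of them. -/
theorem eLpNorm_mollify_sub_le {f : Pt d → ℝ} (hfm : Measurable f) (hf : LocallyIntegrable f)
    (n : ℕ) {c : ℝ≥0∞}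
    (hc : ∀ y ∈ Metric.ball (0 : Pt d) (bump d n).rOut,
      eLpNorm (fun x => f (x - y) - f x) 2 volume ≤ c) :
    eLpNorm (mollify n f - f) 2 volume ≤ c := by
  set φ := (bump d n).normed volume
  have hφm : Measurable φ := (bump d n).continuous_normed.measurable
  have hφ0 : ∀ y, 0 ≤ φ y := (bump d n).nonneg_normed
  have hφ1 : ∫⁻ y, ENNReal.ofReal (φ y) = 1 := by
    rw [← ofReal_integral_eq_lintegral_ofReal (bump d n).integrable_normed
      (Eventually.of_forall hφ0), (bump d n).integral_normed, ENNReal.ofReal_one]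
  have hpt : ∀ x, ‖(mollify n f - f) x‖ₑ ^ 2
      ≤ ∫⁻ y, ENNReal.ofReal (φ y) * ‖f (x - y) - f x‖ₑ ^ 2 := by
    intro x
    have hint : Integrable fun t => φ t * f (x - t) :=
      (bump d n).hasCompactSupport_normed.convolutionExists_left (lsmul ℝ ℝ)
        (bump d n).continuous_normed hf x
    have e : (mollify n f - f) x = ∫ t, φ t * (f (x - t) - f x) := by
      simp_rw [mul_sub]
      rw [integral_sub hint ((bump d n).integrable_normed.mul_const _), integral_mul_const,
        (bump d n).integral_normed, one_mul]
      rfl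
    rw [e]
    refine le_trans ?_ (sq_lintegral_mul_le hφm.ennreal_ofReal (by fun_prop) hφ1)
    gcongr
    refine (enorm_integral_le_lintegral_enorm _).trans (lintegral_mono fun t => ?_)
    rw [enorm_mul, Real.enorm_of_nonneg (hφ0 t)]
  have h2 : eLpNorm (mollify n f - f) 2 volume ^ 2 ≤ c ^ 2 := by
    rw [eLpNorm_two_sq]
    calc ∫⁻ x, ‖(mollify n f - f) x‖ₑ ^ 2
        ≤ ∫⁻ x, ∫⁻ y, ENNReal.ofReal (φ y) * ‖f (x - y) - f x‖ₑ ^ 2 := lintegral_mono hpt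
      _ = ∫⁻ y, ∫⁻ x, ENNReal.ofReal (φ y) * ‖f (x - y) - f x‖ₑ ^ 2 :=
          lintegral_lintegral_swap (by fun_prop)
      _ ≤ ∫⁻ y, ENNReal.ofReal (φ y) * c ^ 2 := by
          refine lintegral_mono fun y => ?_
          rw [lintegral_const_mul _ (by fun_prop), ← eLpNorm_two_sq fun x => f (x - y) - f x]
          by_cases hy : y ∈ Metric.ball (0 : Pt d) (bump d n).rOut
          · gcongr
            exact hc y hy
          · have : φ y = 0 := by
              rw [← (bump d n).support_normed_eq (μ := volume)] at hy
              exact Function.notMem_support.1 hy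
            simp [this]
      _ = c ^ 2 := by
          rw [lintegral_mul_const _ hφm.ennreal_ofReal, hφ1, one_mul]
  exact (ENNReal.pow_le_pow_left_iff two_ne_zero).1 h2

theorem tendsto_eLpNorm_translate_sub {f : Pt d → ℝ} (hf : MemLp f 2 volume) :
    Tendsto (fun y => eLpNorm (fun x => f (x - y) - f x) 2 volume) (𝓝 0) (𝓝 0) := by
  let F : Lp ℝ 2 (volume : Measure (Pt d)) := hf.toLp f
  have : Fact ((2 : ℝ≥0∞) ≠ ⊤) := ⟨by norm_num⟩
  have hc : Continuous fun y : Pt d => (DomAddAct.mk (-y) +ᵥ F) :=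
    (DomAddAct.continuous_mk.comp continuous_neg).vadd continuous_const
  have h0 : (DomAddAct.mk (-(0 : Pt d)) +ᵥ F) = F := by simp
  have h1 : Tendsto (fun y : Pt d => (DomAddAct.mk (-y) +ᵥ F) - F) (𝓝 0) (𝓝 0) := by
    have := (hc.tendsto 0).sub_const F
    rwa [h0, sub_self] at this
  have h2 := (tendsto_iff_edist_tendsto_0.1 h1)
  refine h2.congr fun y => ?_
  rw [edist_zero_right, Lp.enorm_def]
  refine eLpNorm_congr_ae ?_
  have hmp : MeasurePreserving (fun x : Pt d => -y +ᵥ x) volume volume :=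
    measurePreserving_vadd _ _
  filter_upwards [Lp.coeFn_sub (DomAddAct.mk (-y) +ᵥ F) F, hf.coeFn_toLp,
    DomAddAct.vadd_Lp_ae_eq (DomAddAct.mk (-y)) F,
    hmp.quasiMeasurePreserving.ae_eq_comp hf.coeFn_toLp] with x hx1 hx2 hx3 hx4
  rw [hx1, Pi.sub_apply, hx3, hx2]
  congr 1
  simp only [Function.comp_apply] at hx4
  change F (-y +ᵥ x) = _
  rw [hx4, vadd_eq_add, neg_add_eq_sub]

theorem tendsto_eLpNorm_mollify_sub {f : Pt d → ℝ} (hfm : Measurable f)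
    (hf : MemLp f 2 volume) :
    Tendsto (fun n => eLpNorm (mollify n f - f) 2 volume) atTop (𝓝 0) := by
  have hloc : LocallyIntegrable f := hf.locallyIntegrable one_le_two
  rw [ENNReal.tendsto_atTop_zero]
  intro ε hε
  obtain ⟨δ, hδ, hball⟩ := Metric.eventually_nhds_iff_ball.1
    ((ENNReal.tendsto_nhds_zero.1 (tendsto_eLpNorm_translate_sub hf)) ε hε)
  obtain ⟨N, hN⟩ := eventually_atTop.1
    ((tendsto_bump_rOut (d := d)).eventually (gt_mem_nhds hδ))
  refine ⟨N, fun n hn => eLpNorm_mollify_sub_le hfm hloc n fun y hy => hball y ?_⟩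
  exact Metric.ball_subset_ball (hN n hn).le hy

/-- `g` is the weak gradient of `w` on the whole space. -/
def HasWeakGrad (w : Pt d → ℝ) (g : Fin d → Pt d → ℝ) : Prop :=
  ∀ ζ : Pt d → ℝ, ContDiff ℝ ∞ ζ → HasCompactSupport ζ → ∀ i,
    ∫ x, w x * partialD i ζ x = - ∫ x, g i x * ζ x

theorem partialD_convolution {φ w : Pt d → ℝ} (hφ : ContDiff ℝ ∞ φ) (hφs : HasCompactSupport φ)
    (hw : LocallyIntegrable w) (i : Fin d) (x : Pt d) :
    partialD i (φ ⋆[lsmul ℝ ℝ, volume] w) x = ∫ t, w t * partialD i φ (x - t) := by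
  have e : (φ ⋆[lsmul ℝ ℝ, volume] w) = (w ⋆[lsmul ℝ ℝ, volume] φ) := by
    funext y
    rw [convolution_eq_swap, convolution_def]
    simp [mul_comm]
  have hd := hφs.hasFDerivAt_convolution_right (lsmul ℝ ℝ) hw (hφ.of_le (by simp)) x
  rw [partialD, e, hd.fderiv, convolution_precompR_apply _ hw (hφs.fderiv (𝕜 := ℝ))
    (hφ.continuous_fderiv (by simp))]
  rfl

theorem partialD_comp_sub_left {φ : Pt d → ℝ} (hφ : ContDiff ℝ ∞ φ) (i : Fin d) (x t : Pt d) :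
    partialD i (fun s => φ (x - s)) t = - partialD i φ (x - t) := by
  have h1 : HasFDerivAt φ (fderiv ℝ φ (x - t)) (x - t) :=
    (hφ.differentiable (by simp) _).hasFDerivAt
  have h2 := h1.comp t ((hasFDerivAt_const x t).sub (hasFDerivAt_id t))
  have h3 : HasFDerivAt (fun s => φ (x - s)) _ t := h2
  rw [partialD, h3.fderiv]
  simp [partialD]

/-- The derivative falls on the kernel, and t ↦ φ(x − t) is itself an admissible test function for
the weak gradient. -/
theorem partialD_mollify (n : ℕ) {w : Pt d → ℝ} {g : Fin d → Pt d → ℝ}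
    (hw : LocallyIntegrable w) (h : HasWeakGrad w g) (i : Fin d) :
    partialD i (mollify n w) = mollify n (g i) := by
  funext x
  have hφ : ContDiff ℝ ∞ ((bump d n).normed volume) := (bump d n).contDiff_normed
  have hφs := (bump d n).hasCompactSupport_normed (μ := (volume : Measure (Pt d)))
  rw [mollify, partialD_convolution hφ hφs hw, mollify_apply]
  generalize (bump d n).normed volume = φ at hφ hφs
  have h1 := h (fun t => φ (x - t)) (hφ.comp (contDiff_const.sub contDiff_id))
    (hφs.comp_homeomorph (Homeomorph.subLeft x)) i
  simp only [partialD_comp_sub_left hφ, mul_neg, integral_neg, neg_inj] at h1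
  rw [h1, ← integral_sub_left_eq_self (fun t => φ t * g i (x - t)) volume x]
  simp only [sub_sub_cancel, mul_comm (φ _)]

end Mollify

/-! ### Gagliardo–Nirenberg inequality and radial integration by parts for compactly supported H¹
functions. -/

section CompactSobolev

open Filter Topology ContinuousLinearMap
open scoped ENNReal

theorem eLpNorm_mul_le {α : Type*} [MeasurableSpace α] {μ : Measure α} {a b : α → ℝ}
    (ha : AEStronglyMeasurable a μ) (hb : AEStronglyMeasurable b μ) :
    eLpNorm (fun x => a x * b x) 1 μ ≤ eLpNorm a 2 μ * eLpNorm b 2 μ := by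
  have := eLpNorm_le_eLpNorm_mul_eLpNorm_of_nnnorm (p := 2) (q := 2) (r := 1) ha hb
    (fun x y : ℝ => x * y) 1 (Eventually.of_forall fun x => by simp)
  simpa using this

theorem tendsto_eLpNorm_mul_sub_mul {α : Type*} [MeasurableSpace α] {μ : Measure α}
    {a b : α → ℝ} {s t : ℕ → α → ℝ}
    (ha : MemLp a 2 μ) (hb : MemLp b 2 μ) (hs : ∀ n, AEStronglyMeasurable (s n) μ)
    (ht : ∀ n, AEStronglyMeasurable (t n) μ)
    (hsa : Tendsto (fun n => eLpNorm (s n - a) 2 μ) atTop (𝓝 0))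
    (htb : Tendsto (fun n => eLpNorm (t n - b) 2 μ) atTop (𝓝 0)) :
    Tendsto (fun n => eLpNorm ((fun x => s n x * t n x) - fun x => a x * b x) 1 μ)
      atTop (𝓝 0) := by
  have hlim : Tendsto (fun n => eLpNorm (s n - a) 2 μ * eLpNorm (t n - b) 2 μ
      + (eLpNorm (s n - a) 2 μ * eLpNorm b 2 μ + eLpNorm a 2 μ * eLpNorm (t n - b) 2 μ))
      atTop (𝓝 0) := by
    have h1 := ENNReal.Tendsto.mul hsa (Or.inr ENNReal.zero_ne_top) htb (Or.inr ENNReal.zero_ne_top)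
    have h2 := ENNReal.Tendsto.mul_const (b := eLpNorm b 2 μ) hsa (Or.inr hb.2.ne)
    have h3 := ENNReal.Tendsto.const_mul (a := eLpNorm a 2 μ) htb (Or.inr ha.2.ne)
    simpa using h1.add (h2.add h3)
  refine tendsto_of_tendsto_of_tendsto_of_le_of_le tendsto_const_nhds hlim (fun _ => zero_le) ?_
  intro n
  have e : ((fun x => s n x * t n x) - fun x => a x * b x)
      = (fun x => (s n - a) x * (t n - b) x)
        + ((fun x => (s n - a) x * b x) + fun x => a x * (t n - b) x) := by
    funext x
    simp only [Pi.sub_apply, Pi.add_apply]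
    ring
  have m1 := (hs n).sub ha.1
  have m2 := (ht n).sub hb.1
  dsimp only
  rw [e]
  refine (eLpNorm_add_le (m1.mul m2) ((m1.mul hb.1).add (ha.1.mul m2)) le_rfl).trans ?_
  gcongr
  · exact eLpNorm_mul_le m1 m2
  · refine (eLpNorm_add_le (m1.mul hb.1) (ha.1.mul m2) le_rfl).trans ?_
    gcongr
    · exact eLpNorm_mul_le m1 hb.1
    · exact eLpNorm_mul_le ha.1 m2

theorem tendsto_integral_mul {α : Type*} [MeasurableSpace α] {μ : Measure α}
    {a b : α → ℝ} {s t : ℕ → α → ℝ}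
    (ha : MemLp a 2 μ) (hb : MemLp b 2 μ) (hs : ∀ n, MemLp (s n) 2 μ)
    (ht : ∀ n, MemLp (t n) 2 μ)
    (hsa : Tendsto (fun n => eLpNorm (s n - a) 2 μ) atTop (𝓝 0))
    (htb : Tendsto (fun n => eLpNorm (t n - b) 2 μ) atTop (𝓝 0)) :
    Tendsto (fun n => ∫ x, s n x * t n x ∂μ) atTop (𝓝 (∫ x, a x * b x ∂μ)) :=
  tendsto_integral_of_L1' _ (ha.integrable_mul (q := 2) hb).1
    (Eventually.of_forall fun n => (hs n).integrable_mul (q := 2) (ht n))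
    (tendsto_eLpNorm_mul_sub_mul ha hb (fun n => (hs n).1) (fun n => (ht n).1) hsa htb)

variable {d : ℕ}

/-- Square integrable functions on the whole space with bounded support and square integrable weak
gradient. -/
structure IsCompactH1 (w : Pt d → ℝ) (g : Fin d → Pt d → ℝ) : Prop where
  measurable : Measurable w
  measurable_grad : ∀ i, Measurable (g i)
  memLp : MemLp w 2 volume
  memLp_grad : ∀ i, MemLp (g i) 2 volume
  compact : HasCompactSupport w
  compact_grad : ∀ i, HasCompactSupport (g i)
  weak : HasWeakGrad w g

theorem norm_fderiv_le_sum (u : Pt d → ℝ) (x : Pt d) :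
    ‖fderiv ℝ u x‖ ≤ ∑ i, ‖partialD i u x‖ := by
  refine ContinuousLinearMap.opNorm_le_bound _ (by positivity) fun v => ?_
  have hv : v = ∑ i, v i • EuclideanSpace.single i (1 : ℝ) := by
    simpa using ((EuclideanSpace.basisFun (Fin d) ℝ).sum_repr v).symm
  conv_lhs => rw [hv]
  simp only [map_sum, map_smul, smul_eq_mul]
  rw [Finset.sum_mul]
  refine (norm_sum_le _ _).trans (Finset.sum_le_sum fun i _ => ?_)
  rw [norm_mul, mul_comm]
  refine mul_le_mul_of_nonneg_left ?_ (norm_nonneg _)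
  exact PiLp.norm_apply_le v i

theorem continuous_partialD {u : Pt d → ℝ} (hu : ContDiff ℝ ∞ u) (i : Fin d) :
    Continuous (partialD i u) :=
  (hu.continuous_fderiv (by simp)).clm_apply continuous_const

theorem hasCompactSupport_partialD {u : Pt d → ℝ} (hu : HasCompactSupport u) (i : Fin d) :
    HasCompactSupport (partialD i u) :=
  hu.fderiv_apply (𝕜 := ℝ) _

theorem partialD_mul {u v : Pt d → ℝ} (hu : ContDiff ℝ ∞ u) (hv : ContDiff ℝ ∞ v) (i : Fin d)
    (x : Pt d) :
    partialD i (fun y => u y * v y) x = u x * partialD i v x + v x * partialD i u x := by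
  have h := ((hu.differentiable (by simp) x).hasFDerivAt).mul
    ((hv.differentiable (by simp) x).hasFDerivAt)
  have h' : HasFDerivAt (fun y => u y * v y) _ x := h
  rw [partialD, h'.fderiv]
  simp [partialD]

/-- The L¹ Sobolev inequality applied to u², with ∇(u²) = 2u∇u. Squaring makes the right-hand side a
product, to be estimated in L¹. -/
theorem eLpNorm_sq_le {p : NNReal} (hp : NNReal.HolderConjugate (Module.finrank ℝ (Pt d)) p)
    {u : Pt d → ℝ} (hu : ContDiff ℝ ∞ u) (hus : HasCompactSupport u) :
    eLpNorm (fun x => u x * u x) p volume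
      ≤ eLpNormLESNormFDerivOneConst (volume : Measure (Pt d)) p *
        (2 * ∑ i, eLpNorm (fun x => u x * partialD i u x) 1 volume) := by
  have hsq : ContDiff ℝ ∞ fun x => u x * u x := hu.mul hu
  refine (eLpNorm_le_eLpNorm_fderiv_one volume (hsq.of_le (by simp)) hus.mul_left hp).trans ?_
  gcongr
  have hm : ∀ i, AEStronglyMeasurable (fun x => ‖u x * partialD i u x‖) volume := fun i =>
    (hu.continuous.mul (continuous_partialD hu i)).norm.aestronglyMeasurable
  calc eLpNorm (fderiv ℝ fun x => u x * u x) 1 volume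
      ≤ eLpNorm ((2 : ℝ) • ∑ i, fun x => ‖u x * partialD i u x‖) 1 volume := by
        refine eLpNorm_mono_real fun x => (norm_fderiv_le_sum _ x).trans ?_
        simp only [Pi.smul_apply, Finset.sum_apply, smul_eq_mul]
        rw [Finset.mul_sum]
        refine Finset.sum_le_sum fun i _ => ?_
        rw [partialD_mul hu hu, ← two_mul, norm_mul, Real.norm_ofNat]
    _ ≤ 2 * ∑ i, eLpNorm (fun x => ‖u x * partialD i u x‖) 1 volume := by
        rw [eLpNorm_const_smul]
        refine mul_le_mul (by simp [enorm]) (eLpNorm_sum_le (fun i _ => hm i) le_rfl) ?_ ?_ <;>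
          simp
    _ = _ := by simp only [eLpNorm_norm]

namespace IsCompactH1

variable {w : Pt d → ℝ} {g : Fin d → Pt d → ℝ}

theorem locallyIntegrable (h : IsCompactH1 w g) : LocallyIntegrable w :=
  h.memLp.locallyIntegrable one_le_two

theorem locallyIntegrable_grad (h : IsCompactH1 w g) (i : Fin d) : LocallyIntegrable (g i) :=
  (h.memLp_grad i).locallyIntegrable one_le_two

/-- The Gagliardo-Nirenberg-Sobolev inequality for `w²`. -/
theorem eLpNorm_sq_le (h : IsCompactH1 w g) {p : NNReal}
    (hp : NNReal.HolderConjugate (Module.finrank ℝ (Pt d)) p) :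
    eLpNorm (fun x => w x * w x) p volume
      ≤ eLpNormLESNormFDerivOneConst (volume : Measure (Pt d)) p *
        (2 * ∑ i, eLpNorm (fun x => w x * g i x) 1 volume) := by
  set C := eLpNormLESNormFDerivOneConst (volume : Measure (Pt d)) p
  have hc : ∀ n, ContDiff ℝ ∞ (mollify n w) := fun n => contDiff_mollify n h.locallyIntegrable
  have hgc : ∀ n i, ContDiff ℝ ∞ (mollify n (g i)) := fun n i =>
    contDiff_mollify n (h.locallyIntegrable_grad i)
  have hae : ∀ᵐ x, Tendsto (fun n => mollify n w x * mollify n w x) atTop (𝓝 (w x * w x)) := by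
    filter_upwards [ae_tendsto_mollify h.locallyIntegrable] with x hx using hx.mul hx
  -- Mollify and pass to the limit: Fatou on the left, L¹ convergence of the products on the right.
  refine (Lp.eLpNorm_lim_le_liminf_eLpNorm
    (fun n => ((hc n).continuous.mul (hc n).continuous).aestronglyMeasurable) _ hae).trans ?_
  have hlim : ∀ i, Tendsto (fun n => eLpNorm (fun x => w x * g i x) 1 volume
      + eLpNorm ((fun x => mollify n w x * mollify n (g i) x) - fun x => w x * g i x) 1 volume)
      atTop (𝓝 (eLpNorm (fun x => w x * g i x) 1 volume)) := by
    intro i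
    have := tendsto_eLpNorm_mul_sub_mul h.memLp (h.memLp_grad i)
      (fun n => (hc n).continuous.aestronglyMeasurable)
      (fun n => (hgc n i).continuous.aestronglyMeasurable)
      (tendsto_eLpNorm_mollify_sub h.measurable h.memLp)
      (tendsto_eLpNorm_mollify_sub (h.measurable_grad i) (h.memLp_grad i))
    simpa using this.const_add (eLpNorm (fun x => w x * g i x) 1 volume)
  have hlim2 : Tendsto (fun n => C * (2 * ∑ i, (eLpNorm (fun x => w x * g i x) 1 volume
      + eLpNorm ((fun x => mollify n w x * mollify n (g i) x) - fun x => w x * g i x) 1 volume)))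
      atTop (𝓝 (C * (2 * ∑ i, eLpNorm (fun x => w x * g i x) 1 volume))) :=
    ENNReal.Tendsto.const_mul (ENNReal.Tendsto.const_mul
      (tendsto_finsetSum _ fun i _ => hlim i) (Or.inr (by norm_num))) (Or.inr (by simp))
  rw [← hlim2.liminf_eq]
  refine liminf_le_liminf (Eventually.of_forall fun n => ?_)
  refine (Ferro.eLpNorm_sq_le hp (hc n) (hasCompactSupport_mollify n h.compact)).trans ?_
  gcongr with i
  rw [partialD_mollify n h.locallyIntegrable h.weak]
  have e : (fun x => mollify n w x * mollify n (g i) x) = (fun x => w x * g i x)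
      + ((fun x => mollify n w x * mollify n (g i) x) - fun x => w x * g i x) := by
    rw [add_sub_cancel]
  have m1 := h.memLp.1.mul (h.memLp_grad i).1
  have m2 := ((hc n).continuous.mul (hgc n i).continuous).aestronglyMeasurable (μ := volume)
  calc eLpNorm (fun x => mollify n w x * mollify n (g i) x) 1 volume
      = eLpNorm ((fun x => w x * g i x)
        + ((fun x => mollify n w x * mollify n (g i) x) - fun x => w x * g i x)) 1 volume := by
        rw [← e]
    _ ≤ _ := eLpNorm_add_le m1 (m2.sub m1) le_rfl

theorem memLp_continuous_mul {a b : Pt d → ℝ} (ha : Continuous a) (hb : MemLp b 2 volume)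
    (hbs : HasCompactSupport b) : MemLp (fun x => a x * b x) 2 volume := by
  obtain ⟨C, hC⟩ := hbs.isCompact.exists_bound_of_continuousOn ha.continuousOn
  refine hb.of_le_mul (c := C) (ha.aestronglyMeasurable.mul hb.1) (Eventually.of_forall fun x => ?_)
  rw [norm_mul]
  by_cases hx : x ∈ tsupport b
  · gcongr
    exact hC x hx
  · simp [image_eq_zero_of_notMem_tsupport hx]

/-- Integration by parts of `(xᵢ - cᵢ) w ∂ᵢ w`. -/
theorem integral_sq_eq (h : IsCompactH1 w g) (c : Pt d) (i : Fin d) :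
    ∫ x, w x * w x = -2 * ∫ x, ((x i - c i) * w x) * g i x := by
  have hc : ∀ n, ContDiff ℝ ∞ (mollify n w) := fun n => contDiff_mollify n h.locallyIntegrable
  have hs : ∀ n, HasCompactSupport (mollify n w) := fun n => hasCompactSupport_mollify n h.compact
  have hgc : ∀ n, ContDiff ℝ ∞ (mollify n (g i)) := fun n =>
    contDiff_mollify n (h.locallyIntegrable_grad i)
  have hgs : ∀ n, HasCompactSupport (mollify n (g i)) := fun n =>
    hasCompactSupport_mollify n (h.compact_grad i)
  have hl : ContDiff ℝ ∞ fun x : Pt d => x i - c i := by fun_prop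
  have hld : ∀ x, partialD i (fun x : Pt d => x i - c i) x = 1 := by
    intro x
    have h1 : HasFDerivAt (fun x : Pt d => x i - c i)
        (EuclideanSpace.proj i : Pt d →L[ℝ] ℝ) x :=
      ((EuclideanSpace.proj i : Pt d →L[ℝ] ℝ).hasFDerivAt).sub_const _
    rw [partialD, h1.fderiv]
    simp
  have hw' := memLp_continuous_mul hl.continuous h.memLp h.compact
  have hg' := memLp_continuous_mul hl.continuous (h.memLp_grad i) (h.compact_grad i)
  have hmw : ∀ n, MemLp (mollify n w) 2 volume := fun n =>
    (hc n).continuous.memLp_of_hasCompactSupport (hs n)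
  have hmg : ∀ n, MemLp (mollify n (g i)) 2 volume := fun n =>
    (hgc n).continuous.memLp_of_hasCompactSupport (hgs n)
  have hcw := tendsto_eLpNorm_mollify_sub h.measurable h.memLp
  have hcg := tendsto_eLpNorm_mollify_sub (h.measurable_grad i) (h.memLp_grad i)
  have hconst : ∀ f : Pt d → ℝ,
      Tendsto (fun _ : ℕ => eLpNorm (f - f) 2 volume) atTop (𝓝 0) := fun f => by simp
  -- The weak gradient is tested with (xᵢ − cᵢ) times the mollified w. In the limit the two
  -- integrals of (xᵢ − cᵢ)wg coincide, which is the source of the factor 2.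
  have key : ∀ n, (∫ x, ((x i - c i) * w x) * mollify n (g i) x) + ∫ x, w x * mollify n w x
      = - ∫ x, ((x i - c i) * g i x) * mollify n w x := by
    intro n
    have h1 := h.weak (fun x => (x i - c i) * mollify n w x) (hl.mul (hc n)) (hs n).mul_left i
    have i1 : Integrable fun x => (x i - c i) * w x * mollify n (g i) x :=
      hw'.integrable_mul (q := 2) (hmg n)
    have i2 : Integrable fun x => w x * mollify n w x := h.memLp.integrable_mul (q := 2) (hmw n)
    rw [← integral_add i1 i2]
    convert! h1 using 2
    · funext x
      rw [partialD_mul hl (hc n), partialD_mollify n h.locallyIntegrable h.weak, hld]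
      ring
    · congr 1
      funext x
      ring
  have l1 := tendsto_integral_mul hw' (h.memLp_grad i) (fun _ => hw') hmg (hconst _) hcg
  have l2 := tendsto_integral_mul h.memLp h.memLp (fun _ => h.memLp) hmw (hconst _) hcw
  have l3 := tendsto_integral_mul hg' h.memLp (fun _ => hg') hmw (hconst _) hcw
  have l4 := tendsto_nhds_unique (l1.add l2) (l3.neg.congr fun n => (key n).symm)
  have e : ∫ x, (x i - c i) * g i x * w x = ∫ x, (x i - c i) * w x * g i x := by
    congr 1
    funext x
    ring
  rw [e] at l4
  linarith

end IsCompactH1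

end CompactSobolev

/-! ### Cutoff functions of a convex set. -/

section ConvexSobolev

open Filter Topology
open scoped ENNReal

variable {d : ℕ}

/-- The points at distance at least `e` from the complement of `Ω`. -/
def erosion (e : ℝ) (Ω : Set (Pt d)) : Set (Pt d) := {x | ∀ y ∉ Ω, e ≤ dist x y}

theorem isClosed_erosion (e : ℝ) (Ω : Set (Pt d)) : IsClosed (erosion e Ω) := by
  have : erosion e Ω = ⋂ y ∈ Ωᶜ, {x | e ≤ dist x y} := by
    ext x
    simp [erosion]
  rw [this]
  exact isClosed_biInter fun y _ => isClosed_le continuous_const (continuous_id.dist continuous_const)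

theorem erosion_subset {e : ℝ} (he : 0 < e) (Ω : Set (Pt d)) : erosion e Ω ⊆ Ω := by
  intro x hx
  by_contra h
  have := hx x h
  rw [dist_self] at this
  linarith

/-- If a point q outside Ω were too close to ax + by, the shift taking ax + by to q would move x and
y to points of Ω, and q would be a convex combination of these. -/
theorem convex_erosion (e : ℝ) {Ω : Set (Pt d)} (hΩ : Convex ℝ Ω) : Convex ℝ (erosion e Ω) := by
  intro x hx y hy a b ha hb hab q hq
  by_contra! hlt
  have hmem : ∀ z ∈ erosion e Ω, z + (q - (a • x + b • y)) ∈ Ω := by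
    intro z hz
    by_contra h
    have := hz _ h
    rw [dist_self_add_right, ← dist_eq_norm, dist_comm] at this
    linarith
  have h := hΩ (hmem x hx) (hmem y hy) ha hb hab
  have e : a • (x + (q - (a • x + b • y))) + b • (y + (q - (a • x + b • y))) = q := by
    obtain rfl : b = 1 - a := by linarith
    module
  exact hq (e ▸ h)

/-- Mollified indicators of convex sets decrease along a cone of directions. -/
theorem exists_cutoff {Ω : Set (Pt d)} (hb : Bornology.IsBounded Ω) (hc : Convex ℝ Ω)
    {x₀ : Pt d} {r : ℝ} (hr : 0 < r) (hball : Metric.ball x₀ (4 * r) ⊆ Ω) {n : ℕ}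
    (hn : (bump d n).rOut ≤ r) :
    ∃ ρ : Pt d → ℝ, IsTest Ω ρ ∧ (∀ x, 0 ≤ ρ x) ∧ (∀ x, ρ x ≤ 1) ∧
      (∀ x i, r * |partialD i ρ x| ≤ - fderiv ℝ ρ x (x - x₀)) ∧
      ∀ x, Metric.ball x (3 * (bump d n).rOut) ⊆ Ω → ρ x = 1 := by
  set e := (bump d n).rOut with he
  have he0 : 0 < e := (bump d n).rOut_pos
  -- Mollifying at scale e costs at most e in distance: with depth 2e the support stays in the
  -- compact erosion of depth e, and the value is 1 wherever the ball of radius 3e fits in Ω.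
  set A := erosion (2 * e) Ω
  have hA : MeasurableSet A := (isClosed_erosion _ _).measurableSet
  let χ : Pt d → ℝ := A.indicator fun _ => 1
  have hχ0 : ∀ x, 0 ≤ χ x := fun x => Set.indicator_nonneg (fun _ _ => zero_le_one) x
  have hχ1 : ∀ x, χ x ≤ 1 := fun x => Set.indicator_le_self' (fun _ _ => zero_le_one) x
  have hχl : LocallyIntegrable χ := (locallyIntegrable_const 1).indicator hA
  have hφ0 : ∀ y, 0 ≤ (bump d n).normed volume y := (bump d n).nonneg_normed
  have hφ : ∀ y, (bump d n).normed volume y ≠ 0 → ‖y‖ < e := by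
    intro y hy
    have : y ∈ Function.support ((bump d n).normed volume) := hy
    rw [(bump d n).support_normed_eq] at this
    simpa using this
  have hsm := contDiff_mollify n hχl
  have hint : ∀ x, Integrable fun t => (bump d n).normed volume t * χ (x - t) := fun x =>
    (bump d n).hasCompactSupport_normed.convolutionExists_left (ContinuousLinearMap.lsmul ℝ ℝ)
      (bump d n).continuous_normed hχl x
  have hmono : ∀ x w, ‖w‖ ≤ r → ∀ s : ℝ, 0 ≤ s →
      mollify n χ (x + s • (x - x₀ + w)) ≤ mollify n χ x := by
    intro x w hw s hs
    rw [mollify_apply, mollify_apply]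
    refine integral_mono (hint _) (hint _) fun t => ?_
    by_cases ht : (bump d n).normed volume t = 0
    · simp [ht]
    refine mul_le_mul_of_nonneg_left ?_ (hφ0 t)
    by_cases hp : x + s • (x - x₀ + w) - t ∈ A
    -- This point has distance at least 4r − r − e ≥ 2e from the complement. The point x − t lies on
    -- the segment between it and the outer point, with weights s/(1 + s) and 1/(1 + s), so
    -- membership of the outer point in the convex set `A` forces that of x − t.
    · have hq : x₀ - w - t ∈ A := by
        intro y hy
        have h1 : 4 * r ≤ dist y x₀ := by
          by_contra! h
          exact hy (hball h)
        have h2 : dist y x₀ ≤ dist y (x₀ - w - t) + dist (x₀ - w - t) x₀ := dist_triangle _ _ _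
        have h3 : dist (x₀ - w - t) x₀ ≤ ‖w‖ + ‖t‖ := by
          rw [dist_eq_norm, show x₀ - w - t - x₀ = -(w + t) by abel, norm_neg]
          exact norm_add_le _ _
        have h4 := hφ t ht
        rw [dist_comm y (x₀ - w - t)] at h2
        linarith
      have hx : x - t ∈ A := by
        have h := convex_erosion (2 * e) hc hp hq (a := 1 / (1 + s)) (b := s / (1 + s))
          (by positivity) (by positivity) (by field_simp)
        have e1 : (1 / (1 + s)) • (x + s • (x - x₀ + w) - t) + (s / (1 + s)) • (x₀ - w - t)
            = x - t := by
          have : (1 + s) ≠ 0 := by positivity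
          rw [div_eq_mul_inv s, mul_comm s, mul_smul, one_div, ← smul_add, inv_smul_eq_iff₀ this]
          module
        exact e1 ▸ h
      simp only [χ, Set.indicator_of_mem hx]
      exact hχ1 _
    · simp only [χ, Set.indicator_of_notMem hp]
      exact hχ0 _
  have hdir : ∀ x w, ‖w‖ ≤ r → fderiv ℝ (mollify n χ) x (x - x₀ + w) ≤ 0 := by
    intro x w hw
    have hd : HasFDerivAt (mollify n χ) (fderiv ℝ (mollify n χ) x) x :=
      (hsm.differentiable (by simp) x).hasFDerivAt
    have hl : HasDerivAt (fun s : ℝ => mollify n χ (x + s • (x - x₀ + w)))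
        (fderiv ℝ (mollify n χ) x (x - x₀ + w)) 0 := by
      have h1 : HasDerivAt (fun s : ℝ => x + s • (x - x₀ + w)) (x - x₀ + w) 0 := by
        simpa using ((hasDerivAt_id (0 : ℝ)).smul_const (x - x₀ + w)).const_add x
      have hd' : HasFDerivAt (mollify n χ) (fderiv ℝ (mollify n χ) x)
          (x + (0 : ℝ) • (x - x₀ + w)) := by simpa using hd
      exact hd'.comp_hasDerivAt (0 : ℝ) h1
    refine le_of_tendsto hl.tendsto_slope_zero_right ?_
    filter_upwards [self_mem_nhdsWithin] with s hs
    have hs' : (0 : ℝ) < s := hs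
    simp only [zero_add, zero_smul, add_zero, smul_eq_mul]
    exact mul_nonpos_of_nonneg_of_nonpos (by positivity)
      (sub_nonpos.2 (hmono x w hw s hs'.le))
  have hsupp : Function.support (mollify n χ) ⊆ erosion e Ω := by
    intro x hx
    by_contra hxe
    apply hx
    rw [mollify_apply]
    refine integral_eq_zero_of_ae (Eventually.of_forall fun t => ?_)
    simp only [Pi.zero_apply, mul_eq_zero]
    by_cases ht : (bump d n).normed volume t = 0
    · exact Or.inl ht
    right
    refine Set.indicator_of_notMem (fun hA => hxe fun y hy => ?_) _
    have h1 := hA y hy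
    have h2 : dist (x - t) y ≤ dist (x - t) x + dist x y := dist_triangle _ _ _
    have h3 : dist (x - t) x = ‖t‖ := by simp
    have h4 := hφ t ht
    linarith
  have hcpt : IsCompact (erosion e Ω) :=
    Metric.isCompact_of_isClosed_isBounded (isClosed_erosion _ _) (hb.subset (erosion_subset he0 _))
  refine ⟨mollify n χ, ⟨hsm, HasCompactSupport.of_support_subset_isCompact hcpt hsupp,
    (closure_minimal hsupp hcpt.isClosed).trans (erosion_subset he0 _)⟩, fun x => ?_, fun x => ?_,
    fun x i => ?_, fun x hx => ?_⟩
  · rw [mollify_apply]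
    exact integral_nonneg fun t => mul_nonneg (hφ0 t) (hχ0 _)
  · rw [mollify_apply, ← (bump d n).integral_normed (μ := volume)]
    exact integral_mono (hint x) (bump d n).integrable_normed fun t =>
      mul_le_of_le_one_right (hφ0 t) (hχ1 _)
  -- The directions x − x₀ ± r eᵢ are both in the cone of decrease; together they bound r|∂ᵢρ|.
  · have h1 := hdir x (r • EuclideanSpace.single i 1) (by simp [norm_smul, abs_of_pos hr])
    have h2 := hdir x ((-r) • EuclideanSpace.single i 1) (by simp [norm_smul, abs_of_pos hr])
    rw [map_add, map_smul, smul_eq_mul] at h1 h2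
    have h3 : r * |partialD i (mollify n χ) x| = |r * partialD i (mollify n χ) x| := by
      rw [abs_mul, abs_of_pos hr]
    rw [h3, abs_le, partialD]
    constructor <;> linarith
  · rw [mollify_apply, ← (bump d n).integral_normed (μ := volume)]
    congr 1
    funext t
    by_cases ht : (bump d n).normed volume t = 0
    · simp [ht]
    have : x - t ∈ A := by
      intro y hy
      have h1 : 3 * e ≤ dist y x := by
        by_contra! h
        exact hy (hx h)
      have h2 : dist y x ≤ dist y (x - t) + dist (x - t) x := dist_triangle _ _ _
      have h3 : dist (x - t) x = ‖t‖ := by simp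
      have h4 := hφ t ht
      rw [dist_comm y (x - t)] at h2
      linarith
    simp [χ, Set.indicator_of_mem this]

theorem exists_cutoff_seq {Ω : Set (Pt d)} (ho : IsOpen Ω) (hb : Bornology.IsBounded Ω)
    (hc : Convex ℝ Ω) {x₀ : Pt d} (hx₀ : x₀ ∈ Ω) :
    ∃ r > 0, ∃ ρ : ℕ → Pt d → ℝ, (∀ n, IsTest Ω (ρ n)) ∧ (∀ n x, 0 ≤ ρ n x) ∧
      (∀ n x, ρ n x ≤ 1) ∧
      (∀ n x i, r * |partialD i (ρ n) x| ≤ - fderiv ℝ (ρ n) x (x - x₀)) ∧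
      ∀ x ∈ Ω, ∀ᶠ n in atTop, ρ n x = 1 := by
  obtain ⟨R, hR, hball⟩ := Metric.isOpen_iff.1 ho x₀ hx₀
  have hr : 0 < R / 4 := by positivity
  obtain ⟨N, hN⟩ := eventually_atTop.1
    ((tendsto_bump_rOut (d := d)).eventually (gt_mem_nhds hr))
  have hball' : Metric.ball x₀ (4 * (R / 4)) ⊆ Ω := by
    rwa [mul_div_cancel₀ _ (by norm_num : (4 : ℝ) ≠ 0)]
  choose ρ h1 h2 h3 h4 h5 using fun n : ℕ =>
    exists_cutoff hb hc hr hball' (hN (n + N) (Nat.le_add_left _ _)).le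
  refine ⟨R / 4, hr, ρ, h1, h2, h3, h4, fun x hx => ?_⟩
  obtain ⟨s, hs, hsb⟩ := Metric.isOpen_iff.1 ho x hx
  have ht : Tendsto (fun n : ℕ => 3 * (bump d (n + N)).rOut) atTop (𝓝 0) := by
    have := (tendsto_bump_rOut (d := d)).const_mul 3
    rw [mul_zero] at this
    exact this.comp (tendsto_add_atTop_nat N)
  filter_upwards [ht.eventually (gt_mem_nhds hs)] with n hn
  exact h5 n x ((Metric.ball_subset_ball hn.le).trans hsb)

end ConvexSobolev

/-! ### Sobolev embedding on bounded convex domains. -/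

section SobolevEmbedding

open Filter Topology
open scoped ENNReal

variable {d : ℕ} {Ω : Set (Pt d)}

theorem integral_indicator_mul (hm : MeasurableSet Ω) (f h : Pt d → ℝ) :
    ∫ x, Ω.indicator f x * h x = ∫ x in Ω, f x * h x := by
  rw [← integral_indicator hm]
  congr 1
  funext x
  by_cases hx : x ∈ Ω <;> simp [hx]

theorem IsTest.mul_right {ρ ζ : Pt d → ℝ} (hρ : IsTest Ω ρ) (hζ : ContDiff ℝ ∞ ζ) :
    IsTest Ω fun x => ρ x * ζ x :=
  ⟨hρ.1.mul hζ, hρ.2.1.mul_right, (tsupport_mul_subset_left).trans hρ.2.2⟩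

theorem measurable_indicator_lp (hm : MeasurableSet Ω) (u : L2 Ω) :
    Measurable (Ω.indicator u) :=
  (Lp.stronglyMeasurable u).measurable.indicator hm

theorem memLp_indicator_lp (hm : MeasurableSet Ω) (u : L2 Ω) :
    MemLp (Ω.indicator u) 2 volume :=
  (memLp_indicator_iff_restrict hm).2 (Lp.memLp u)

/-- Cutting off an element of `H¹(Ω)`. -/
theorem IsTest.isCompactH1 (hm : MeasurableSet Ω) {ρ : Pt d → ℝ} (hρ : IsTest Ω ρ) (θ : H1 Ω) :
    IsCompactH1 (fun x => ρ x * Ω.indicator (val θ) x)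
      (fun i x => ρ x * Ω.indicator (grad θ i) x + partialD i ρ x * Ω.indicator (val θ) x) := by
  have hρc := hρ.1.continuous
  have hdc := fun i => continuous_partialD hρ.1 i
  have hds := fun i => hasCompactSupport_partialD hρ.2.1 i
  have bdd : ∀ {a b : Pt d → ℝ}, Continuous a → HasCompactSupport a → MemLp b 2 volume →
      MemLp (fun x => a x * b x) 2 volume := by
    intro a b ha has hb
    obtain ⟨C, hC⟩ := has.exists_bound_of_continuous ha
    refine hb.of_le_mul (c := C) (ha.aestronglyMeasurable.mul hb.1)
      (Eventually.of_forall fun x => ?_)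
    rw [norm_mul]
    gcongr
    exact hC x
  refine ⟨hρc.measurable.mul (measurable_indicator_lp hm _), fun i =>
    (hρc.measurable.mul (measurable_indicator_lp hm _)).add
      ((hdc i).measurable.mul (measurable_indicator_lp hm _)),
    bdd hρc hρ.2.1 (memLp_indicator_lp hm _), fun i =>
    (bdd hρc hρ.2.1 (memLp_indicator_lp hm _)).add (bdd (hdc i) (hds i) (memLp_indicator_lp hm _)),
    hρ.2.1.mul_right, fun i => hρ.2.1.mul_right.add (hds i).mul_right, ?_⟩
  intro ζ hζ hζs i
  have h := θ.2 _ (hρ.mul_right hζ) i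
  change ∫ x in Ω, val θ x * _ = - ∫ x in Ω, grad θ i x * _ at h
  rw [← integral_indicator_mul hm, ← integral_indicator_mul hm] at h
  have int : ∀ (f : L2 Ω) {a : Pt d → ℝ}, Continuous a → HasCompactSupport a →
      Integrable fun x => Ω.indicator f x * a x := fun f a ha has =>
    (memLp_indicator_lp hm f).integrable_mul (q := 2) (ha.memLp_of_hasCompactSupport has)
  have i1 : ∀ f : L2 Ω, Integrable fun x => Ω.indicator f x * (ρ x * partialD i ζ x) := fun f =>
    int f (hρc.mul (continuous_partialD hζ i)) hρ.2.1.mul_right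
  have i2 : ∀ f : L2 Ω, Integrable fun x => Ω.indicator f x * (ρ x * ζ x) := fun f =>
    int f (hρc.mul hζ.continuous) hρ.2.1.mul_right
  have i3 : ∀ f : L2 Ω, Integrable fun x => Ω.indicator f x * (ζ x * partialD i ρ x) := fun f =>
    int f (hζ.continuous.mul (hdc i)) hζs.mul_right
  have e1 : ∫ x, Ω.indicator (val θ) x * partialD i (fun y => ρ y * ζ y) x
      = (∫ x, Ω.indicator (val θ) x * (ρ x * partialD i ζ x))
        + ∫ x, Ω.indicator (val θ) x * (ζ x * partialD i ρ x) := by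
    rw [← integral_add (i1 (val θ)) (i3 (val θ))]
    congr 1
    funext x
    rw [partialD_mul hρ.1 hζ]
    ring
  rw [e1] at h
  have e2 : ∫ x, (ρ x * Ω.indicator (grad θ i) x + partialD i ρ x * Ω.indicator (val θ) x) * ζ x
      = (∫ x, Ω.indicator (grad θ i) x * (ρ x * ζ x))
        + ∫ x, Ω.indicator (val θ) x * (ζ x * partialD i ρ x) := by
    rw [← integral_add (i2 (grad θ i)) (i3 (val θ))]
    congr 1
    funext x
    ring
  have e3 : ∫ x, ρ x * Ω.indicator (val θ) x * partialD i ζ x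
      = ∫ x, Ω.indicator (val θ) x * (ρ x * partialD i ζ x) := by
    congr 1
    funext x
    ring
  rw [e2, e3]
  linarith

theorem fderiv_eq_sum_partialD (u : Pt d → ℝ) (x v : Pt d) :
    fderiv ℝ u x v = ∑ i, v i * partialD i u x := by
  have hv : v = ∑ i, v i • EuclideanSpace.single i (1 : ℝ) := by
    simpa using ((EuclideanSpace.basisFun (Fin d) ℝ).sum_repr v).symm
  conv_lhs => rw [hv]
  simp only [map_sum, map_smul, smul_eq_mul]
  rfl

/-- The radial bound on the cut-off part of the gradient. -/
theorem exists_bound_cutoff (hm : MeasurableSet Ω) (hb : Bornology.IsBounded Ω) (θ : H1 Ω)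
    (x₀ : Pt d) {r : ℝ} (hr : 0 < r) :
    ∃ B : ℝ, ∀ ρ : Pt d → ℝ, IsTest Ω ρ → (∀ x, 0 ≤ ρ x) → (∀ x, ρ x ≤ 1) →
      (∀ x i, r * |partialD i ρ x| ≤ - fderiv ℝ ρ x (x - x₀)) → ∀ i : Fin d,
      ∫ x, ‖(ρ x * Ω.indicator (val θ) x) *
        (ρ x * Ω.indicator (grad θ i) x + partialD i ρ x * Ω.indicator (val θ) x)‖ ≤ B := by
  obtain ⟨D, hD⟩ : ∃ D : ℝ, ∀ x ∈ Ω, ‖x - x₀‖ ≤ D := by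
    obtain ⟨D, hD⟩ := hb.subset_closedBall x₀
    exact ⟨D, fun x hx => by simpa [dist_eq_norm] using hD hx⟩
  set u : Pt d → ℝ := Ω.indicator (val θ) with hu
  set γ : Fin d → Pt d → ℝ := fun i => Ω.indicator (grad θ i) with hγ
  have hum : MemLp u 2 volume := memLp_indicator_lp hm _
  have hγm : ∀ i, MemLp (γ i) 2 volume := fun i => memLp_indicator_lp hm _
  have hu0 : ∀ x ∉ Ω, u x = 0 := fun x hx => Set.indicator_of_notMem hx _
  have iuu : Integrable fun x => u x * u x := hum.integrable_mul (q := 2) hum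
  have iuγ : ∀ i, Integrable fun x => u x * γ i x := fun i => hum.integrable_mul (q := 2) (hγm i)
  have ibd : ∀ {f a : Pt d → ℝ}, Integrable f → Continuous a → HasCompactSupport a →
      Integrable fun x => f x * a x := by
    intro f a hf ha has
    obtain ⟨C, hC⟩ := has.exists_bound_of_continuous ha
    exact hf.mul_bdd (c := C) ha.aestronglyMeasurable (Eventually.of_forall hC)
  -- A bound for ∫ u²ρ(−(x − x₀)·∇ρ) that does not depend on ρ: the steep factor ∇ρ enters only
  -- through its radial part, and parts turns that into ∫ ρ²u² and ∫ ρ²u (x − x₀)·∇u.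
  let S := d * (∫ x, u x * u x) + D * ∑ i, ∫ x, ‖u x * γ i x‖
  refine ⟨(∑ i, ∫ x, ‖u x * γ i x‖) + (1 / r) * S, fun ρ hρ hρ0 hρ1 hdir i => ?_⟩
  have hH := hρ.isCompactH1 hm θ
  have hρc := hρ.1.continuous
  have hdc := fun i => continuous_partialD hρ.1 i
  have irad : ∀ i : Fin d, Integrable fun x => u x * u x * (ρ x * ((x i - x₀ i) * partialD i ρ x)) :=
    fun i => ibd iuu (hρc.mul (((by fun_prop : Continuous fun x : Pt d => x i - x₀ i)).mul (hdc i)))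
      hρ.2.1.mul_right
  have imix : ∀ i : Fin d, Integrable fun x => u x * γ i x * (ρ x * (ρ x * (x i - x₀ i))) :=
    fun i => ibd (iuγ i) (hρc.mul (hρc.mul (by fun_prop))) hρ.2.1.mul_right
  have isq : Integrable fun x => u x * u x * (ρ x * ρ x) := ibd iuu (hρc.mul hρc) hρ.2.1.mul_right
  -- the radial identity
  have hparts : ∀ i : Fin d, - ∫ x, u x * u x * (ρ x * ((x i - x₀ i) * partialD i ρ x))
      = (1 / 2) * (∫ x, u x * u x * (ρ x * ρ x))
        + ∫ x, u x * γ i x * (ρ x * (ρ x * (x i - x₀ i))) := by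
    intro i
    have h := hH.integral_sq_eq x₀ i
    have e1 : ∫ x, (ρ x * u x) * (ρ x * u x) = ∫ x, u x * u x * (ρ x * ρ x) := by
      congr 1
      funext x
      ring
    have e2 : ∫ x, ((x i - x₀ i) * (ρ x * u x)) * (ρ x * γ i x + partialD i ρ x * u x)
        = (∫ x, u x * γ i x * (ρ x * (ρ x * (x i - x₀ i))))
          + ∫ x, u x * u x * (ρ x * ((x i - x₀ i) * partialD i ρ x)) := by
      rw [← integral_add (imix i) (irad i)]
      congr 1
      funext x
      ring
    rw [e1, e2] at h
    linarith
  have hmixle : ∀ i : Fin d, ∫ x, u x * γ i x * (ρ x * (ρ x * (x i - x₀ i)))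
      ≤ D * ∫ x, ‖u x * γ i x‖ := by
    intro i
    rw [← integral_const_mul]
    refine integral_mono (imix i) ((iuγ i).norm.const_mul _) fun x => ?_
    by_cases hx : x ∈ Ω
    · have h1 : |x i - x₀ i| ≤ D := by
        have := PiLp.norm_apply_le (x - x₀) i
        exact (by simpa using this : |x i - x₀ i| ≤ ‖x - x₀‖).trans (hD x hx)
      have h2 : |ρ x * (ρ x * (x i - x₀ i))| ≤ D := by
        rw [abs_mul, abs_mul, abs_of_nonneg (hρ0 x), ← mul_assoc]
        have h3 : ρ x * ρ x ≤ 1 := mul_le_one₀ (hρ1 x) (hρ0 x) (hρ1 x)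
        calc ρ x * ρ x * |x i - x₀ i| ≤ 1 * D := by gcongr
          _ = D := one_mul D
      calc u x * γ i x * (ρ x * (ρ x * (x i - x₀ i)))
          ≤ |u x * γ i x * (ρ x * (ρ x * (x i - x₀ i)))| := le_abs_self _
        _ = |u x * γ i x| * |ρ x * (ρ x * (x i - x₀ i))| := abs_mul _ _
        _ ≤ |u x * γ i x| * D := by gcongr
        _ = D * ‖u x * γ i x‖ := by rw [mul_comm, Real.norm_eq_abs]
    · simp [hu0 x hx]
  have hsqle : ∫ x, u x * u x * (ρ x * ρ x) ≤ ∫ x, u x * u x := by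
    refine integral_mono isq iuu fun x => ?_
    exact mul_le_of_le_one_right (mul_self_nonneg _) (mul_le_one₀ (hρ1 x) (hρ0 x) (hρ1 x))
  have hsq0 : 0 ≤ ∫ x, u x * u x := integral_nonneg fun x => mul_self_nonneg _
  have hrad : ∫ x, u x * u x * (ρ x * (- fderiv ℝ ρ x (x - x₀))) ≤ S := by
    have e : ∫ x, u x * u x * (ρ x * (- fderiv ℝ ρ x (x - x₀)))
        = ∑ i, - ∫ x, u x * u x * (ρ x * ((x i - x₀ i) * partialD i ρ x)) := by
      rw [Finset.sum_neg_distrib, ← integral_finsetSum _ fun i _ => irad i, ← integral_neg]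
      congr 1
      funext x
      rw [fderiv_eq_sum_partialD, ← Finset.mul_sum, ← Finset.mul_sum]
      simp only [PiLp.sub_apply]
      ring
    rw [e, Finset.sum_congr rfl fun i _ => hparts i, Finset.sum_add_distrib]
    simp only [Finset.sum_const, Finset.card_univ, Fintype.card_fin, nsmul_eq_mul, S]
    rw [Finset.mul_sum]
    refine add_le_add ?_ (Finset.sum_le_sum fun i _ => hmixle i)
    gcongr
    linarith
  have irad' : Integrable fun x => u x * u x * (ρ x * (- fderiv ℝ ρ x (x - x₀))) := by
    refine ibd iuu (hρc.mul ?_) hρ.2.1.mul_right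
    exact ((hρ.1.continuous_fderiv (by simp)).clm_apply
      (continuous_id.sub continuous_const)).neg
  calc ∫ x, ‖(ρ x * u x) * (ρ x * γ i x + partialD i ρ x * u x)‖
      ≤ ∫ x, (‖u x * γ i x‖ + (1 / r) * (u x * u x * (ρ x * (- fderiv ℝ ρ x (x - x₀))))) := by
        refine integral_mono (hH.memLp.integrable_mul (q := 2) (hH.memLp_grad i)).norm
          ((iuγ i).norm.add (irad'.const_mul _)) fun x => ?_
        have e : (ρ x * u x) * (ρ x * γ i x + partialD i ρ x * u x)
            = (ρ x * ρ x) * (u x * γ i x) + u x * u x * (ρ x * partialD i ρ x) := by ring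
        dsimp only
        rw [e]
        refine (norm_add_le _ _).trans (add_le_add ?_ ?_)
        · rw [norm_mul, Real.norm_of_nonneg (mul_nonneg (hρ0 x) (hρ0 x))]
          exact mul_le_of_le_one_left (norm_nonneg _) (mul_le_one₀ (hρ1 x) (hρ0 x) (hρ1 x))
        · rw [norm_mul, norm_mul (ρ x), Real.norm_of_nonneg (mul_self_nonneg (u x)),
            Real.norm_of_nonneg (hρ0 x), Real.norm_eq_abs]
          have h1 := hdir x i
          -- The cone condition: every partial derivative of the cutoff is dominated by its radial
          -- derivative.
          have h2 : |partialD i ρ x| ≤ (1 / r) * (- fderiv ℝ ρ x (x - x₀)) := by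
            rw [one_div, ← div_eq_inv_mul, le_div_iff₀ hr, mul_comm]
            exact h1
          calc u x * u x * (ρ x * |partialD i ρ x|)
              ≤ u x * u x * (ρ x * ((1 / r) * (- fderiv ℝ ρ x (x - x₀)))) := by
                have := mul_self_nonneg (u x)
                have := hρ0 x
                gcongr
            _ = _ := by ring
    _ = (∫ x, ‖u x * γ i x‖)
        + (1 / r) * ∫ x, u x * u x * (ρ x * (- fderiv ℝ ρ x (x - x₀))) := by
        rw [integral_add (iuγ i).norm (irad'.const_mul _), integral_const_mul]
    _ ≤ (∑ i, ∫ x, ‖u x * γ i x‖) + (1 / r) * S := by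
        gcongr
        exact Finset.single_le_sum (f := fun i => ∫ x, ‖u x * γ i x‖)
          (fun i _ => integral_nonneg fun x => norm_nonneg _) (Finset.mem_univ i)

/-- The Sobolev embedding on a bounded convex domain: `θ²` is integrable to the power
`d / (d - 1)` for `θ ∈ H¹(Ω)`. -/
theorem memLp_val_mul_val (ho : IsOpen Ω) (hb : Bornology.IsBounded Ω) (hc : Convex ℝ Ω)
    {p : NNReal} (hp : NNReal.HolderConjugate (Module.finrank ℝ (Pt d)) p) (θ : H1 Ω) :
    MemLp (fun x => val θ x * val θ x) p (volume.restrict Ω) := by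
  rcases Ω.eq_empty_or_nonempty with h0 | ⟨x₀, hx₀⟩
  · have : ∀ f : Pt d → ℝ, MemLp f p (volume.restrict Ω) := fun f => by simp [h0]
    exact this _
  have hm := ho.measurableSet
  obtain ⟨r, hr, ρ, hρ, hρ0, hρ1, hdir, hlim⟩ := exists_cutoff_seq ho hb hc hx₀
  obtain ⟨B, hB⟩ := exists_bound_cutoff hm hb θ x₀ hr
  set u : Pt d → ℝ := Ω.indicator (val θ) with hu
  set C := eLpNormLESNormFDerivOneConst (volume : Measure (Pt d)) p
  have hbound : ∀ n, eLpNorm (fun x => (ρ n x * u x) * (ρ n x * u x)) p volume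
      ≤ C * (2 * ∑ _i : Fin d, ENNReal.ofReal B) := by
    intro n
    have hH := (hρ n).isCompactH1 hm θ
    refine (hH.eLpNorm_sq_le hp).trans ?_
    gcongr with i
    have hi : Integrable fun x => (ρ n x * u x) * (ρ n x * Ω.indicator (grad θ i) x
        + partialD i (ρ n) x * u x) := hH.memLp.integrable_mul (q := 2) (hH.memLp_grad i)
    rw [eLpNorm_one_eq_lintegral_enorm, ← ofReal_integral_norm_eq_lintegral_enorm hi]
    exact ENNReal.ofReal_le_ofReal (hB _ (hρ n) (hρ0 n) (hρ1 n) (hdir n) i)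
  have hae : ∀ᵐ x, Tendsto (fun n => (ρ n x * u x) * (ρ n x * u x)) atTop (𝓝 (u x * u x)) := by
    refine Eventually.of_forall fun x => ?_
    by_cases hx : x ∈ Ω
    · refine tendsto_const_nhds.congr' ?_
      filter_upwards [hlim x hx] with n hn
      simp [hn]
    · simp [hu, hx]
  have hum : Measurable u := measurable_indicator_lp hm _
  -- Fatou, using that the cutoffs are eventually 1 at each point of Ω and that the bound is uniform
  -- in n.
  have hle := (Lp.eLpNorm_lim_le_liminf_eLpNorm (p := p)
    (fun n => (((hρ n).1.continuous.measurable.mul hum).mul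
      ((hρ n).1.continuous.measurable.mul hum)).aestronglyMeasurable) _ hae).trans
    (liminf_le_of_frequently_le' (Frequently.of_forall hbound))
  have hfin : MemLp (fun x => u x * u x) p volume := by
    refine ⟨(hum.mul hum).aestronglyMeasurable, hle.trans_lt ?_⟩
    refine ENNReal.mul_lt_top (by simp) (ENNReal.mul_lt_top (by simp) ?_)
    exact ENNReal.sum_lt_top.2 fun _ _ => ENNReal.ofReal_lt_top
  refine (hfin.restrict Ω).ae_eq ?_
  filter_upwards [ae_restrict_mem hm] with x hx
  simp [hu, hx]

end SobolevEmbedding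

/-! ### Square integrability of products of H¹ and H¹₀ functions. -/

section ProductEstimate

open Filter Topology
open scoped ENNReal

variable {d : ℕ} {Ω : Set (Pt d)}

theorem memLp_of_mul_self {α : Type*} [MeasurableSpace α] {μ : Measure α} {f : α → ℝ}
    (hf : AEStronglyMeasurable f μ) {p q : ℝ≥0∞} (h : MemLp (fun x => f x * f x) p μ)
    (hq : q / 2 = p) : MemLp f q μ := by
  rw [← memLp_norm_rpow_iff hf two_ne_zero (by norm_num), hq]
  convert! h using 2 with x
  simp [sq]

theorem memLp_four_val (ho : IsOpen Ω) (hb : Bornology.IsBounded Ω) (hc : Convex ℝ Ω)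
    (hd : d = 2) (θ : H1 Ω) : MemLp (val θ) 4 (volume.restrict Ω) := by
  refine memLp_of_mul_self (Lp.memLp _).1 (memLp_val_mul_val ho hb hc (p := 2) ?_ θ) ?_
  · rw [finrank_euclideanSpace_fin, hd]
    exact NNReal.HolderConjugate.two_two
  · rw [show (4 : ℝ≥0∞) = 2 * 2 by norm_num, ENNReal.mul_div_cancel_right two_ne_zero (by norm_num)]
    rfl

/-- Here d/(d − 1) = 3/2. The exponent 3 is enough, since 1/3 + 1/6 = 1/2 when the partner is in L⁶.
-/
theorem memLp_three_val (ho : IsOpen Ω) (hb : Bornology.IsBounded Ω) (hc : Convex ℝ Ω)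
    (hd : d = 3) (θ : H1 Ω) : MemLp (val θ) 3 (volume.restrict Ω) := by
  refine memLp_of_mul_self (Lp.memLp _).1 (memLp_val_mul_val ho hb hc (p := 3 / 2) ?_ θ) ?_
  · rw [finrank_euclideanSpace_fin, hd, NNReal.holderConjugate_iff]
    norm_num
  · rw [ENNReal.coe_div two_ne_zero]
    simp

/-- The weak gradient of a test function is its classical gradient. -/
theorem grad_ae_eq_partialD (ho : IsOpen Ω) {u : H1 Ω} {φ : Pt d → ℝ} (hφ : IsTest Ω φ)
    (hu : val u =ᵐ[volume.restrict Ω] φ) (i : Fin d) :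
    grad u i =ᵐ[volume.restrict Ω] partialD i φ := by
  have hdc := continuous_partialD hφ.1 i
  have hds := hasCompactSupport_partialD hφ.2.1 i
  have hmem : MemLp (partialD i φ) 2 (volume.restrict Ω) :=
    (hdc.memLp_of_hasCompactSupport hds).restrict Ω
  have hm' : MemLp (fun x => grad u i x - partialD i φ x) 2 (volume.restrict Ω) :=
    (Lp.memLp (grad u i)).sub hmem
  have hloc : LocallyIntegrableOn (fun x => grad u i x - partialD i φ x) Ω volume := by
    intro x hx
    obtain ⟨s, hs, hxs⟩ := exists_compact_mem_nhds x
    refine ⟨s ∩ Ω, inter_mem (mem_nhdsWithin_of_mem_nhds hxs) self_mem_nhdsWithin, ?_⟩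
    have := (hm'.locallyIntegrable one_le_two).integrableOn_isCompact hs
    rwa [IntegrableOn, Measure.restrict_restrict hs.measurableSet] at this
  have key := ho.ae_eq_zero_of_integral_contDiff_smul_eq_zero hloc ?_
  · filter_upwards [(ae_restrict_iff' ho.measurableSet).2 key] with x hx
    exact sub_eq_zero.1 hx
  intro ζ hζ hζs hζΩ
  have hζt : IsTest Ω ζ := ⟨hζ, hζs, hζΩ⟩
  have h1 := u.2 ζ hζt i
  change ∫ x in Ω, val u x * partialD i ζ x = - ∫ x in Ω, grad u i x * ζ x at h1
  have h2 : ∫ x in Ω, val u x * partialD i ζ x = ∫ x, φ x * partialD i ζ x := by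
    rw [← setIntegral_eq_integral_of_forall_compl_eq_zero (s := Ω)
      (f := fun x => φ x * partialD i ζ x)]
    · refine integral_congr_ae ?_
      filter_upwards [hu] with x hx
      rw [hx]
    · intro x hx
      rw [image_eq_zero_of_notMem_tsupport fun h => hx (hφ.2.2 h), zero_mul]
  have h3 : ∫ x, φ x * partialD i ζ x = - ∫ x, partialD i φ x * ζ x := by
    refine integral_mul_fderiv_eq_neg_fderiv_mul_of_integrable (𝕜 := ℝ) ?_ ?_ ?_
      (fun x _ => hφ.1.differentiable (by simp) x) (fun x _ => hζ.differentiable (by simp) x)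
    · exact (hdc.mul hζ.continuous).integrable_of_hasCompactSupport hds.mul_right
    · exact (hφ.1.continuous.mul (continuous_partialD hζ i)).integrable_of_hasCompactSupport
        hφ.2.1.mul_right
    · exact (hφ.1.continuous.mul hζ.continuous).integrable_of_hasCompactSupport hφ.2.1.mul_right
  have h4 : ∫ x, partialD i φ x * ζ x = ∫ x in Ω, partialD i φ x * ζ x := by
    rw [← setIntegral_eq_integral_of_forall_compl_eq_zero (s := Ω)]
    intro x hx
    rw [image_eq_zero_of_notMem_tsupport fun h => hx (hζΩ h), mul_zero]
  have i1 : Integrable (fun x => grad u i x * ζ x) (volume.restrict Ω) := hζt.integrable_mul _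
  have i2 : Integrable (fun x => partialD i φ x * ζ x) (volume.restrict Ω) :=
    ((hdc.mul hζ.continuous).integrable_of_hasCompactSupport hds.mul_right).restrict
  have h5 : ∫ x, ζ x • (grad u i x - partialD i φ x)
      = ∫ x in Ω, ζ x * (grad u i x - partialD i φ x) := by
    rw [← setIntegral_eq_integral_of_forall_compl_eq_zero (s := Ω)]
    · rfl
    · intro x hx
      rw [image_eq_zero_of_notMem_tsupport fun h => hx (hζΩ h), zero_smul]
  have h6 : ∫ x in Ω, ζ x * (grad u i x - partialD i φ x)
      = (∫ x in Ω, grad u i x * ζ x) - ∫ x in Ω, partialD i φ x * ζ x := by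
    rw [← integral_sub i1 i2]
    congr 1
    funext x
    ring
  rw [h5, h6]
  rw [h2, h3, h4] at h1
  linarith

/-- Uniqueness of the weak gradient, read off from the fact that 0 is a test function. -/
theorem grad_eq_zero_of_val_eq_zero (ho : IsOpen Ω) {u : H1 Ω} (hu : val u = 0) : grad u = 0 := by
  ext i : 1
  have h0 : IsTest Ω (fun _ : Pt d => (0 : ℝ)) :=
    ⟨contDiff_const, HasCompactSupport.zero, by simp [tsupport]⟩
  have h := grad_ae_eq_partialD ho h0
    (by rw [hu]; exact Lp.coeFn_zero ℝ 2 (volume.restrict Ω)) i (u := u)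
  refine Lp.ext (h.trans ?_)
  filter_upwards [Lp.coeFn_zero ℝ 2 (volume.restrict Ω)] with x hx
  change partialD i _ x = (0 : L2 Ω) x
  rw [hx]
  simp [partialD]

/-- This makes the L² mass form definite on subspaces of `H1`, whose elements are pairs of a
function and a gradient. -/
theorem val_injective (ho : IsOpen Ω) : Function.Injective (val : H1 Ω →ₗ[ℝ] L2 Ω) := by
  rw [injective_iff_map_eq_zero]
  intro u hu
  exact Subtype.ext (Prod.ext hu (grad_eq_zero_of_val_eq_zero ho hu))

/-- A test function is globally smooth, so the whole-space Sobolev inequality (1/6 = 1/2 − 1/3)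
applies to it. -/
theorem eLpNorm_six_le_of_mem_testSubmodule (ho : IsOpen Ω) (hd : d = 3) {u : H1 Ω}
    (hu : u ∈ testSubmodule Ω) :
    eLpNorm (val u) 6 (volume.restrict Ω)
      ≤ SNormLESNormFDerivOfEqConst ℝ (volume : Measure (Pt d)) (2 : NNReal) * ∑ i, ‖grad u i‖ₑ := by
  obtain ⟨φ, hφ, hφu⟩ := hu
  have hc : ContDiff ℝ 1 φ := hφ.1.of_le (by simp)
  have h1 := eLpNorm_le_eLpNorm_fderiv_of_eq (F := ℝ) volume hc hφ.2.1 (p := 2) (p' := 6)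
    (by norm_num) (by simp [hd]) (by simp [hd]; norm_num)
  have h2 : eLpNorm (val u) 6 (volume.restrict Ω) ≤ eLpNorm φ 6 volume := by
    rw [eLpNorm_congr_ae hφu]
    exact eLpNorm_restrict_le _ _ _ _
  refine h2.trans (h1.trans ?_)
  gcongr
  have hm : ∀ i, AEStronglyMeasurable (fun x => ‖partialD i φ x‖) volume := fun i =>
    (continuous_partialD hφ.1 i).norm.aestronglyMeasurable
  calc eLpNorm (fderiv ℝ φ) 2 volume
      ≤ eLpNorm (∑ i, fun x => ‖partialD i φ x‖) 2 volume :=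
        eLpNorm_mono_real fun x => by simpa using norm_fderiv_le_sum φ x
    _ ≤ ∑ i, eLpNorm (fun x => ‖partialD i φ x‖) 2 volume :=
        eLpNorm_sum_le (fun i _ => hm i) one_le_two
    _ = ∑ i, ‖grad u i‖ₑ := by
        refine Finset.sum_congr rfl fun i _ => ?_
        rw [eLpNorm_norm, Lp.enorm_def, eLpNorm_congr_ae (grad_ae_eq_partialD ho hφ hφu i)]
        refine (eLpNorm_restrict_eq_of_support_subset fun x hx => ?_).symm
        by_contra hxΩ
        have hx' : x ∉ tsupport φ := fun h => hxΩ (hφ.2.2 h)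
        have h0 : fderiv ℝ φ x = 0 := image_eq_zero_of_notMem_tsupport fun h =>
          hx' (tsupport_fderiv_subset ℝ h)
        exact hx (by simp [partialD, h0])

theorem continuous_val : Continuous (val : H1 Ω →ₗ[ℝ] L2 Ω) :=
  continuous_fst.comp continuous_subtype_val

theorem continuous_grad : Continuous (grad : H1 Ω →ₗ[ℝ] L2v Ω) :=
  continuous_snd.comp continuous_subtype_val

/-- The inequality passes from test functions to their closure: Fatou along an a.e. convergent
subsequence, the gradient norms converging. -/
theorem memLp_six_val (ho : IsOpen Ω) (hd : d = 3) {u : H1 Ω} (hu : u ∈ H10 Ω) :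
    MemLp (val u) 6 (volume.restrict Ω) := by
  obtain ⟨s, hs, hsu⟩ := mem_closure_iff_seq_limit.1 hu
  set C := SNormLESNormFDerivOfEqConst ℝ (volume : Measure (Pt d)) (2 : NNReal)
  have hval : Tendsto (fun n => val (s n)) atTop (𝓝 (val u)) := (continuous_val.tendsto u).comp hsu
  have hgrad : ∀ i, Tendsto (fun n => ‖grad (s n) i‖ₑ) atTop (𝓝 ‖grad u i‖ₑ) := by
    intro i
    have h1 : Continuous fun v : H1 Ω => ‖grad v i‖ₑ :=
      (((PiLp.continuous_apply 2 _ i).comp continuous_grad)).enorm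
    exact (h1.tendsto u).comp hsu
  obtain ⟨ns, hns, hae⟩ := (tendstoInMeasure_of_tendsto_Lp hval).exists_seq_tendsto_ae
  have hlim : Tendsto (fun n => C * ∑ i, ‖grad (s (ns n)) i‖ₑ) atTop
      (𝓝 (C * ∑ i, ‖grad u i‖ₑ)) :=
    ENNReal.Tendsto.const_mul
      (tendsto_finsetSum _ fun i _ => (hgrad i).comp hns.tendsto_atTop) (Or.inr (by simp))
  refine ⟨(Lp.memLp _).1, ?_⟩
  refine ((Lp.eLpNorm_lim_le_liminf_eLpNorm (p := 6) (fun n => (Lp.memLp (val (s (ns n)))).1) _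
    hae).trans (liminf_le_liminf (Eventually.of_forall fun n =>
      eLpNorm_six_le_of_mem_testSubmodule ho hd (hs (ns n))))).trans_lt ?_
  rw [hlim.liminf_eq]
  exact ENNReal.mul_lt_top (by simp) (ENNReal.sum_lt_top.2 fun i _ => by simp)

/-- Products of `H¹(Ω)` and `H¹₀(Ω)` functions are square integrable. -/
theorem memLp_val_mul_val_of_mem_H10 (hd : d = 2 ∨ d = 3) (ho : IsOpen Ω)
    (hb : Bornology.IsBounded Ω) (hc : Convex ℝ Ω) (θ : H1 Ω) {u : H1 Ω} (hu : u ∈ H10 Ω) :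
    MemLp (fun x => val θ x * val u x) 2 (volume.restrict Ω) := by
  rcases hd with hd | hd
  · have : ENNReal.HolderTriple 4 4 2 := ⟨by
      rw [← two_mul, show (4 : ℝ≥0∞) = 2 * 2 by norm_num,
        ENNReal.mul_inv (Or.inl two_ne_zero) (Or.inl (by norm_num)), ← mul_assoc,
        ENNReal.mul_inv_cancel two_ne_zero (by norm_num), one_mul]⟩
    exact (memLp_four_val ho hb hc hd u).mul' (memLp_four_val ho hb hc hd θ)
  · have : ENNReal.HolderTriple 3 6 2 := ⟨by
      rw [← ENNReal.toReal_eq_toReal_iff' (by norm_num) (by norm_num),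
        ENNReal.toReal_add (by norm_num) (by norm_num)]
      norm_num⟩
    exact (memLp_six_val ho hd hu).mul' (memLp_three_val ho hb hc hd θ)

end ProductEstimate

/-! ### Quadratic bounds for the truncated double well potential. -/

section DoubleWell

/-- The derivative of the truncated double well potential, in closed form. -/
def wellSlope (s : ℝ) : ℝ :=
  if s ≤ -1 then 2 * (s + 1) else if s ≤ 1 then s ^ 3 - s else 2 * (s - 1)

/-- Taylor with F'' ≤ 2: the second derivative is 2 outside [−1, 1] and 3s² − 1 inside. The
truncation is what makes this global. -/
theorem wellF_le_quadratic (a b : ℝ) :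
    wellF b ≤ wellF a + wellSlope a * (b - a) + (b - a) ^ 2 := by
  unfold wellF wellSlope
  split_ifs with h1 h2 h3 h4 h5 h6 h7 h8
  · nlinarith
  · nlinarith [mul_nonneg (sq_nonneg (a + 1)) (mul_nonneg (by linarith : (0 : ℝ) ≤ 2 - a)
        (by linarith : (0 : ℝ) ≤ -1 - b)),
      mul_nonneg (sq_nonneg (a + 1)) (by nlinarith : (0 : ℝ) ≤ 6 - 3 * a ^ 2 + 2 * a - 1)]
  · nlinarith
  · nlinarith [mul_nonneg (sq_nonneg (b + 1)) (by nlinarith : (0 : ℝ) ≤ 4 - (b - 1) ^ 2)]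
  · nlinarith [mul_nonneg (sq_nonneg (b - a)) (by nlinarith : (0 : ℝ) ≤ 6 - 3 * a ^ 2 - 2 * a * b - b ^ 2)]
  · nlinarith [mul_nonneg (sq_nonneg (b - 1)) (by nlinarith : (0 : ℝ) ≤ 4 - (b + 1) ^ 2)]
  · nlinarith
  · nlinarith [mul_nonneg (sq_nonneg (a - 1)) (mul_nonneg (by linarith : (0 : ℝ) ≤ 2 + a)
        (by linarith : (0 : ℝ) ≤ b - 1)),
      mul_nonneg (sq_nonneg (a - 1)) (by nlinarith : (0 : ℝ) ≤ 6 - 3 * a ^ 2 - 2 * a - 1)]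
  · nlinarith

theorem quadratic_le_wellF (a b : ℝ) :
    wellF a + wellSlope a * (b - a) - (b - a) ^ 2 ≤ wellF b := by
  unfold wellF wellSlope
  split_ifs with h1 h2 h3 h4 h5 h6 h7 h8
  · nlinarith [sq_nonneg (b - a)]
  · nlinarith [mul_nonneg (by linarith : (0 : ℝ) ≤ -1 - a) (by linarith : (0 : ℝ) ≤ b + 1),
      sq_nonneg (b ^ 2 - 1), sq_nonneg (a + 1), sq_nonneg (b + 1)]
  · nlinarith [mul_nonneg (by linarith : (0 : ℝ) ≤ -1 - a) (by linarith : (0 : ℝ) ≤ b + 1),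
      sq_nonneg (b - 1), sq_nonneg (a + 1), sq_nonneg (b + 1)]
  · have h : (0 : ℝ) ≤ (a + 1) * (a ^ 2 - a + 2) * (-1 - b) :=
      mul_nonneg (mul_nonneg (by linarith) (by nlinarith [sq_nonneg a])) (by linarith)
    nlinarith [h, mul_nonneg (sq_nonneg (a + 1)) (by nlinarith [sq_nonneg (a - 1)] :
      (0 : ℝ) ≤ 3 * a ^ 2 - 2 * a + 3), sq_nonneg (b + 1)]
  · nlinarith [mul_nonneg (sq_nonneg (b - a)) (by nlinarith [sq_nonneg (a + b)] :
      (0 : ℝ) ≤ 3 * a ^ 2 + 2 * a * b + b ^ 2 + 2)]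
  · have h : (0 : ℝ) ≤ (1 - a) * (a ^ 2 + a + 2) * (b - 1) :=
      mul_nonneg (mul_nonneg (by linarith) (by nlinarith [sq_nonneg a])) (by linarith)
    nlinarith [h, mul_nonneg (sq_nonneg (a - 1)) (by nlinarith [sq_nonneg (a + 1)] :
      (0 : ℝ) ≤ 3 * a ^ 2 + 2 * a + 3), sq_nonneg (b - 1)]
  · nlinarith [mul_nonneg (by linarith : (0 : ℝ) ≤ a - 1) (by linarith : (0 : ℝ) ≤ 1 - b),
      sq_nonneg (b - 1), sq_nonneg (a - 1), sq_nonneg (b + 1)]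
  · nlinarith [mul_nonneg (by linarith : (0 : ℝ) ≤ a - 1) (by linarith : (0 : ℝ) ≤ 1 - b),
      sq_nonneg (b ^ 2 - 1), sq_nonneg (a - 1), sq_nonneg (b - 1)]
  · nlinarith [sq_nonneg (b - a)]

/-- The graph lies between two parabolas touching at a, so no gluing of one-sided derivatives at ±1
is needed. -/
theorem hasDerivAt_wellF (a : ℝ) : HasDerivAt wellF (wellSlope a) a := by
  rw [hasDerivAt_iff_isLittleO]
  refine Asymptotics.IsBigO.trans_isLittleO (g := fun b => (b - a) ^ 2)
    (Asymptotics.IsBigO.of_bound 1 (Filter.Eventually.of_forall fun b => ?_)) ?_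
  · have h1 := wellF_le_quadratic a b
    have h2 := quadratic_le_wellF a b
    rw [one_mul, Real.norm_eq_abs, Real.norm_of_nonneg (sq_nonneg _), smul_eq_mul, abs_le]
    constructor <;> nlinarith
  · have h : Filter.Tendsto (fun b : ℝ => b - a) (nhds a) (nhds 0) := by
      have h' : Continuous fun b : ℝ => b - a := by fun_prop
      simpa using h'.tendsto a
    exact (Asymptotics.isLittleO_pow_id (𝕜 := ℝ) one_lt_two).comp_tendsto h

theorem wellf_eq : wellf = wellSlope := funext fun a => (hasDerivAt_wellF a).deriv

theorem continuous_wellF : Continuous wellF :=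
  continuous_iff_continuousAt.2 fun a => (hasDerivAt_wellF a).continuousAt

theorem wellF_nonneg (s : ℝ) : 0 ≤ wellF s := by
  unfold wellF
  split_ifs <;> positivity

theorem wellF_le (s : ℝ) : wellF s ≤ 1 + s ^ 2 := by
  have h := wellF_le_quadratic 0 s
  norm_num [wellF, wellSlope] at h
  unfold wellF
  linarith

theorem abs_wellf_le (s : ℝ) : |wellf s| ≤ 2 * |s| + 2 := by
  rw [wellf_eq, wellSlope]
  split_ifs with h1 h2
  · rw [abs_mul, abs_two]
    nlinarith [abs_add_le s 1, abs_one (α := ℝ)]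
  · have h : |s| ≤ 1 := abs_le.2 ⟨by linarith, h2⟩
    have : |s ^ 3 - s| ≤ |s ^ 3| + |s| := abs_sub _ _
    rw [abs_pow] at this
    have h3 : |s| ^ 3 ≤ 1 := pow_le_one₀ (abs_nonneg s) h
    linarith [abs_nonneg s]
  · rw [abs_mul, abs_two]
    have := abs_sub s 1
    rw [abs_one] at this
    linarith

theorem measurable_wellf : Measurable wellf := measurable_deriv _

end DoubleWell

/-! ### The integral forms of the scheme as bilinear forms and operators. -/

section Forms

open scoped ENNReal

variable {d : ℕ} {Ω : Set (Pt d)}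

theorem inner_eq_integral (f g : L2 Ω) : inner ℝ f g = ∫ x in Ω, f x * g x := by
  rw [L2.inner_def]
  refine integral_congr_ae (Filter.Eventually.of_forall fun x => ?_)
  simp [mul_comm]

/-- Multiplication by a function, as a linear map into `L²(Ω)`. -/
theorem exists_linearMap_mul {X : Type*} [AddCommGroup X] [Module ℝ X] (j : X →ₗ[ℝ] L2 Ω)
    (w : Pt d → ℝ) (h : ∀ x, MemLp (fun z => w z * j x z) 2 (volume.restrict Ω)) :
    ∃ A : X →ₗ[ℝ] L2 Ω, ∀ x, A x =ᵐ[volume.restrict Ω] fun z => w z * j x z := by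
  refine ⟨⟨⟨fun x => (h x).toLp _, fun x y => ?_⟩, fun c x => ?_⟩, fun x => (h x).coeFn_toLp⟩
  · refine Lp.ext ?_
    filter_upwards [(h (x + y)).coeFn_toLp, Lp.coeFn_add ((h x).toLp _) ((h y).toLp _),
      (h x).coeFn_toLp, (h y).coeFn_toLp, Lp.coeFn_add (j x) (j y)] with z h1 h2 h3 h4 h5
    rw [h1, h2, Pi.add_apply, h3, h4, map_add, h5, Pi.add_apply, mul_add]
  · refine Lp.ext ?_
    filter_upwards [(h (c • x)).coeFn_toLp, Lp.coeFn_smul c ((h x).toLp _),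
      (h x).coeFn_toLp, Lp.coeFn_smul c (j x)] with z h1 h2 h3 h4
    simp only [RingHom.id_apply]
    rw [h1, h2, Pi.smul_apply, h3, map_smul, h4, Pi.smul_apply, smul_eq_mul, smul_eq_mul]
    ring

theorem exists_linearMap_mul_bounded {w : Pt d → ℝ}
    (hw : AEStronglyMeasurable w (volume.restrict Ω)) {C : ℝ} (hC : ∀ x, |w x| ≤ C) :
    ∃ A : L2 Ω →ₗ[ℝ] L2 Ω, ∀ f, A f =ᵐ[volume.restrict Ω] fun z => w z * f z :=
  exists_linearMap_mul LinearMap.id w fun f =>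
    (Lp.memLp f).of_le_mul (c := C) (hw.mul (Lp.memLp f).1)
      (Filter.Eventually.of_forall fun x => by
        rw [norm_mul]
        exact mul_le_mul_of_nonneg_right (hC x) (norm_nonneg _))

theorem integral_mul_eq_inner {A f : L2 Ω} {w : Pt d → ℝ}
    (hA : A =ᵐ[volume.restrict Ω] fun z => w z * f z) (g : L2 Ω) :
    ∫ x in Ω, w x * f x * g x = inner ℝ A g := by
  rw [inner_eq_integral]
  refine integral_congr_ae ?_
  filter_upwards [hA] with x hx
  rw [hx]

theorem wInner_comm (w : Pt d → ℝ) (a b : L2v Ω) : wInner w a b = wInner w b a := by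
  unfold wInner
  refine Finset.sum_congr rfl fun i _ => ?_
  congr 1
  funext x
  ring

theorem wInner_self_nonneg {w : Pt d → ℝ} (hw : ∀ x, 0 ≤ w x) (a : L2v Ω) : 0 ≤ wInner w a a := by
  refine Finset.sum_nonneg fun i _ => integral_nonneg fun x => ?_
  rw [mul_assoc]
  exact mul_nonneg (hw x) (mul_self_nonneg _)

/-- Factoring the pairing through a multiplication operator on L² classes gives its bilinearity once
and for all. -/
theorem exists_wInner_eq_inner {w : Pt d → ℝ}
    (hw : AEStronglyMeasurable w (volume.restrict Ω)) {C : ℝ} (hC : ∀ x, |w x| ≤ C) :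
    ∃ A : L2v Ω →ₗ[ℝ] L2v Ω, ∀ a b, wInner w a b = inner ℝ (A a) b := by
  obtain ⟨A, hA⟩ := exists_linearMap_mul_bounded hw hC
  refine ⟨⟨⟨fun a => WithLp.toLp 2 fun i => A (a i), fun a b => ?_⟩, fun c a => ?_⟩, fun a b => ?_⟩
  · ext i : 1
    simp
  · ext i : 1
    simp
  · rw [PiLp.inner_apply]
    exact Finset.sum_congr rfl fun i _ => integral_mul_eq_inner (hA (a i)) (b i)

/-- Expand 0 ≤ ∫ w|a − b/2|². The constant C/4 is the origin of the threshold χ₀ ≤ 4. -/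
theorem wInner_le {w : Pt d → ℝ} (hw : AEStronglyMeasurable w (volume.restrict Ω)) {C : ℝ}
    (h0 : ∀ x, 0 ≤ w x) (hC : ∀ x, w x ≤ C) (a b : L2v Ω) :
    wInner w a b ≤ wInner w a a + C / 4 * ‖b‖ ^ 2 := by
  obtain ⟨A, hA⟩ := exists_wInner_eq_inner hw (C := C) fun x => by rw [abs_of_nonneg (h0 x)]; exact hC x
  have h1 := wInner_self_nonneg h0 (a - (1 / 2 : ℝ) • b)
  have h2 : wInner w b b ≤ C * ‖b‖ ^ 2 := by
    rw [← real_inner_self_eq_norm_sq, PiLp.inner_apply, Finset.mul_sum]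
    refine Finset.sum_le_sum fun i _ => ?_
    rw [inner_eq_integral, ← integral_const_mul]
    have hint : Integrable (fun x => b i x * b i x) (volume.restrict Ω) :=
      (Lp.memLp (b i)).integrable_mul (q := 2) (Lp.memLp (b i))
    refine integral_mono_of_nonneg (Filter.Eventually.of_forall fun x => ?_) (hint.const_mul C)
      (Filter.Eventually.of_forall fun x => ?_)
    · dsimp only
      rw [mul_assoc]
      exact mul_nonneg (h0 x) (mul_self_nonneg _)
    · dsimp only
      rw [mul_assoc]
      exact mul_le_mul_of_nonneg_right (hC x) (mul_self_nonneg _)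
  have h3 : wInner w (a - (1 / 2 : ℝ) • b) (a - (1 / 2 : ℝ) • b)
      = wInner w a a - wInner w a b + (1 / 4) * wInner w b b := by
    have hs : wInner w b a = wInner w a b := wInner_comm w b a
    simp only [hA] at hs ⊢
    simp only [map_sub, map_smul, inner_sub_left, inner_sub_right, real_inner_smul_left,
      real_inner_smul_right, hs]
    ring
  linarith

/-- The coupling form `∫ θ Uᵢ gᵢ`, for `θ ∈ H¹(Ω)` and `U ∈ H¹₀(Ω)ᵈ`, is bilinear. -/
theorem exists_coupling (hd : d = 2 ∨ d = 3) (ho : IsOpen Ω) (hb : Bornology.IsBounded Ω)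
    (hc : Convex ℝ Ω) (θ : H1 Ω) (V : Submodule ℝ (Fin d → H1 Ω))
    (hV : ∀ U ∈ V, ∀ i, U i ∈ H10 Ω) :
    ∃ A : V →ₗ[ℝ] L2v Ω, ∀ (U : V) (g : L2v Ω),
      wInner (val θ) (vval (U : Fin d → H1 Ω)) g = inner ℝ (A U) g := by
  -- The product estimate is indispensable here: a non-integrable product would be given the
  -- integral 0, and linearity in U could fail.
  have h := fun i : Fin d => exists_linearMap_mul
    (val.comp ((LinearMap.proj i).comp V.subtype)) (val θ) fun U : V =>
      memLp_val_mul_val_of_mem_H10 hd ho hb hc θ (hV _ U.2 i)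
  choose A hA using h
  refine ⟨⟨⟨fun U => WithLp.toLp 2 fun i => A i U, fun a b => ?_⟩, fun c a => ?_⟩, fun U g => ?_⟩
  · ext i : 1
    simp
  · ext i : 1
    simp
  · rw [PiLp.inner_apply]
    exact Finset.sum_congr rfl fun i _ => integral_mul_eq_inner (hA i U) (g i)

theorem viscForm_self_nonneg {w : Pt d → ℝ} (hw : ∀ x, 0 ≤ w x) (U : Fin d → H1 Ω) :
    0 ≤ viscForm w U U := by
  refine Finset.sum_nonneg fun i _ => Finset.sum_nonneg fun j _ => integral_nonneg fun x => ?_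
  rw [mul_assoc]
  exact mul_nonneg (hw x) (mul_self_nonneg _)

/-- The entries of the symmetric gradient, as linear maps. -/
def symGradₗ (i j : Fin d) : (Fin d → H1 Ω) →ₗ[ℝ] L2 Ω where
  toFun U := symGrad U i j
  map_add' U V := by
    simp only [symGrad, Pi.add_apply, map_add, PiLp.add_apply]
    module
  map_smul' c U := by
    simp only [symGrad, Pi.smul_apply, map_smul, PiLp.smul_apply, RingHom.id_apply]
    module

theorem exists_viscForm_eq {w : Pt d → ℝ}
    (hw : AEStronglyMeasurable w (volume.restrict Ω)) {C : ℝ} (hC : ∀ x, |w x| ≤ C) :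
    ∃ B : (Fin d → H1 Ω) →ₗ[ℝ] (Fin d → H1 Ω) →ₗ[ℝ] ℝ, ∀ U V, viscForm w U V = B U V := by
  obtain ⟨A, hA⟩ := exists_linearMap_mul_bounded hw hC
  refine ⟨∑ i, ∑ j, (innerₗ (L2 Ω)).compl₁₂ (A.comp (symGradₗ i j)) (symGradₗ i j), fun U V => ?_⟩
  simp only [LinearMap.sum_apply, viscForm]
  refine Finset.sum_congr rfl fun i _ => Finset.sum_congr rfl fun j _ => ?_
  exact integral_mul_eq_inner (hA (symGrad U i j)) (symGrad V i j)

theorem memLp_wellf (hb : Bornology.IsBounded Ω) (u : L2 Ω) :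
    MemLp (fun x => wellf (u x)) 2 (volume.restrict Ω) := by
  have : IsFiniteMeasure (volume.restrict Ω) := ⟨by simpa using hb.measure_lt_top⟩
  have h1 : MemLp (fun x => 2 * ‖u x‖ + 2) 2 (volume.restrict Ω) :=
    ((Lp.memLp u).norm.const_mul 2).add (memLp_const 2)
  refine h1.mono (measurable_wellf.comp_aemeasurable (Lp.memLp u).1.aemeasurable).aestronglyMeasurable
    (Filter.Eventually.of_forall fun x => ?_)
  rw [Real.norm_of_nonneg (by positivity : 0 ≤ 2 * ‖u x‖ + 2)]
  exact abs_wellf_le _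

theorem exists_wellf_eq_inner (hb : Bornology.IsBounded Ω) (u : L2 Ω) :
    ∃ f : L2 Ω, ∀ v : L2 Ω, ∫ z in Ω, wellf (u z) * v z = inner ℝ f v := by
  refine ⟨(memLp_wellf hb u).toLp _, fun v => ?_⟩
  rw [inner_eq_integral]
  refine integral_congr_ae ?_
  filter_upwards [(memLp_wellf hb u).coeFn_toLp] with x hx
  rw [hx]

theorem integrable_wellF (hb : Bornology.IsBounded Ω) (u : L2 Ω) :
    Integrable (fun x => wellF (u x)) (volume.restrict Ω) := by
  have : IsFiniteMeasure (volume.restrict Ω) := ⟨by simpa using hb.measure_lt_top⟩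
  have h1 : Integrable (fun x => 1 + (u x) ^ 2) (volume.restrict Ω) :=
    (integrable_const 1).add (Lp.memLp u).integrable_sq
  refine h1.mono (continuous_wellF.comp_aestronglyMeasurable (Lp.memLp u).1)
    (Filter.Eventually.of_forall fun x => ?_)
  rw [Real.norm_of_nonneg (wellF_nonneg _), Real.norm_of_nonneg (by positivity)]
  exact wellF_le _

theorem integral_wellF_le (hb : Bornology.IsBounded Ω) (u v : L2 Ω) :
    ∫ z in Ω, wellF (v z) ≤ (∫ z in Ω, wellF (u z)) + (∫ z in Ω, wellf (u z) * (v - u) z)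
      + ‖v - u‖ ^ 2 := by
  have i1 := integrable_wellF hb u
  have i2 : Integrable (fun z => wellf (u z) * (v - u) z) (volume.restrict Ω) :=
    (memLp_wellf hb u).integrable_mul (q := 2) (Lp.memLp (v - u))
  have i3 : Integrable (fun z => (v - u) z * (v - u) z) (volume.restrict Ω) :=
    (Lp.memLp (v - u)).integrable_mul (q := 2) (Lp.memLp (v - u))
  have i12 : Integrable (fun z => wellF (u z) + wellf (u z) * (v - u) z) (volume.restrict Ω) :=
    i1.add i2
  rw [← real_inner_self_eq_norm_sq, inner_eq_integral, ← integral_add i1 i2, ← integral_add i12 i3]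
  refine integral_mono_ae (integrable_wellF hb v) (i12.add i3) ?_
  filter_upwards [Lp.coeFn_sub v u] with z hz
  rw [hz, Pi.sub_apply, wellf_eq, ← sq]
  exact wellF_le_quadratic _ _

end Forms

/-! ### Time increments of the applied field. -/

section AppliedField

/-- The increment of a `C¹` curve is controlled by the square integral of its derivative. -/
theorem norm_sub_sq_le_integral {E : Type*} [NormedAddCommGroup E] [NormedSpace ℝ E]
    [CompleteSpace E] {h : ℝ → E} {T a b : ℝ} (hh : ContDiffOn ℝ 1 h (Set.Icc 0 T))
    (hT : 0 < T) (ha : 0 ≤ a) (hab : a ≤ b) (hb : b ≤ T) :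
    ‖h b - h a‖ ^ 2 ≤ (b - a) * ∫ s in a..b, ‖derivWithin h (Set.Icc 0 T) s‖ ^ 2 := by
  have hsub : Set.Icc a b ⊆ Set.Icc 0 T := Set.Icc_subset_Icc ha hb
  have hc : ContinuousOn (derivWithin h (Set.Icc 0 T)) (Set.Icc a b) :=
    (hh.continuousOn_derivWithin (uniqueDiffOn_Icc hT) le_rfl).mono hsub
  have hc' : ContinuousOn (derivWithin h (Set.Icc 0 T)) (Set.uIcc a b) := by
    rwa [Set.uIcc_of_le hab]
  have hftc : ∫ s in a..b, derivWithin h (Set.Icc 0 T) s = h b - h a := by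
    refine intervalIntegral.integral_eq_sub_of_hasDerivAt_of_le hab (hh.continuousOn.mono hsub)
      (fun s hs => ?_) hc'.intervalIntegrable
    have hs' : Set.Icc 0 T ∈ nhds s := Icc_mem_nhds (ha.trans_lt hs.1) (hs.2.trans_le hb)
    have := (hh.differentiableOn one_ne_zero s (mem_of_mem_nhds hs')).hasDerivWithinAt
    exact this.hasDerivAt hs'
  rw [← hftc]
  set G := derivWithin h (Set.Icc 0 T)
  have hn : ‖∫ s in a..b, G s‖ ≤ ∫ s in a..b, ‖G s‖ :=
    intervalIntegral.norm_integral_le_integral_norm hab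
  have i1 : IntervalIntegrable (fun s => ‖G s‖) volume a b := hc'.norm.intervalIntegrable
  have i2 : IntervalIntegrable (fun s => ‖G s‖ ^ 2) volume a b :=
    (hc'.norm.pow 2).intervalIntegrable
  rcases hab.eq_or_lt with rfl | hlt
  · simp
  set I := ∫ s in a..b, ‖G s‖
  have hba : 0 < b - a := sub_pos.2 hlt
  -- Cauchy–Schwarz as nonnegativity of the variance of ‖G‖ about its mean.
  have hsq : 0 ≤ ∫ s in a..b, (‖G s‖ ^ 2 - 2 * (I / (b - a)) * ‖G s‖ + (I / (b - a)) ^ 2) := by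
    refine intervalIntegral.integral_nonneg hab fun s _ => ?_
    nlinarith [sq_nonneg (‖G s‖ - I / (b - a))]
  rw [intervalIntegral.integral_add (i2.sub (i1.const_mul _)) intervalIntegrable_const,
    intervalIntegral.integral_sub i2 (i1.const_mul _), intervalIntegral.integral_const_mul,
    intervalIntegral.integral_const, smul_eq_mul] at hsq
  have e : (∫ s in a..b, ‖G s‖ ^ 2) - 2 * (I / (b - a)) * I + (b - a) * (I / (b - a)) ^ 2
      = (∫ s in a..b, ‖G s‖ ^ 2) - I ^ 2 / (b - a) := by
    field_simp
    ring
  rw [e, sub_nonneg, div_le_iff₀ hba] at hsq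
  calc ‖∫ s in a..b, G s‖ ^ 2 ≤ I ^ 2 := by gcongr
    _ ≤ _ := by linarith

end AppliedField

/-! ### The discrete energy estimate. -/

section Energy

variable {d : ℕ} {Ω : Set (Pt d)} {S : Spaces Ω}

theorem norm_sub_sq_eq {E : Type*} [NormedAddCommGroup E] [InnerProductSpace ℝ E] (a b : E) :
    ‖a‖ ^ 2 - ‖b‖ ^ 2 + ‖a - b‖ ^ 2 = 2 * inner ℝ (a - b) a := by
  rw [norm_sub_sq_real, inner_sub_left, real_inner_self_eq_norm_sq, real_inner_comm a b]
  ring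

theorem Params.nu_nonneg (p : Params) (s : ℝ) : 0 ≤ p.nu s :=
  (lt_min p.nuw_pos p.nuf_pos).le.trans (p.nu_lower s)

theorem Params.continuous_nu (p : Params) : Continuous p.nu :=
  let ⟨_, h⟩ := p.nu_lipschitz
  h.continuous

theorem Params.continuous_chi (p : Params) : Continuous p.chi :=
  let ⟨_, h⟩ := p.chi_lipschitz
  h.continuous

theorem aestronglyMeasurable_comp_val {g : ℝ → ℝ} (hg : Continuous g) (θ : H1 Ω) :
    AEStronglyMeasurable (fun z => g (val θ z)) (volume.restrict Ω) :=
  hg.comp_aestronglyMeasurable (Lp.memLp (val θ)).1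

theorem inner_le_sq_add_sq {E : Type*} [NormedAddCommGroup E] [InnerProductSpace ℝ E] (a b : E) :
    inner ℝ a b ≤ ‖a‖ ^ 2 + 1 / 4 * ‖b‖ ^ 2 := by
  have := real_inner_le_norm a b
  nlinarith [sq_nonneg (‖a‖ - 1 / 2 * ‖b‖)]

theorem inner_le_of_sq_le {E : Type*} [NormedAddCommGroup E] [InnerProductSpace ℝ E] {a b : E}
    {dt τ I : ℝ} (hdt : 0 < dt) (hτ : 0 < τ) (ha : ‖a‖ ^ 2 ≤ dt * I) :
    inner ℝ a b ≤ dt / (4 * τ) * ‖b‖ ^ 2 + τ * I := by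
  have h1 := real_inner_le_norm a b
  have e : dt / (4 * τ) * ‖b‖ ^ 2 + τ / dt * ‖a‖ ^ 2 - ‖a‖ * ‖b‖
      = (dt * ‖b‖ - 2 * τ * ‖a‖) ^ 2 / (4 * τ * dt) := by
    field_simp
    ring
  have h2 : 0 ≤ (dt * ‖b‖ - 2 * τ * ‖a‖) ^ 2 / (4 * τ * dt) := by positivity
  have h3 : τ / dt * ‖a‖ ^ 2 ≤ τ * I := by
    calc τ / dt * ‖a‖ ^ 2 ≤ τ / dt * (dt * I) := by gcongr
      _ = τ * I := by field_simp
  linarith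

/-- The scalar balance behind the energy estimate: the tested equations of one time step and the
elementary inequalities imply the discrete energy inequality. -/
theorem energy_balance {dt τ δ η γ l μ χ : ℝ} (hdt : 0 < dt) (hτ : 0 < τ) (hδ : 0 < δ)
    (hη : 0 < η) (hl : 0 < l) (hμ : 0 < μ) (hηδ : η ≤ δ)
    {dψ c gψ gθ fd d2 uu vis b mm m2 cHM mH myH cHH h2 hH hpH hyH I a2 : ℝ}
    {ux uy du mx my dm hx hy dh tx ty dtx wx wy : ℝ}
    (e1 : 1 / dt * dψ - c - γ * gψ = 0)
    (e2 : dψ + δ * gθ + 1 / δ * fd + 1 / η * d2 = 0)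
    (e3 : 1 / dt * uu + 0 + vis - 0 = μ * b + l / δ * c)
    (e4 : 1 / dt * mm - 0 + 1 / τ * m2 = 1 / τ * cHM)
    (e5 : 1 / dt * (mH - myH) - b + 1 / τ * mH = 1 / τ * cHH)
    (e6 : h2 = hH - mH) (e7 : hyH = hpH - myH)
    (nu : ux - uy + du = 2 * uu) (nm : mx - my + dm = 2 * mm)
    (nh : hx - hy + dh = 2 * (h2 - hyH)) (nt : tx - ty + dtx = 2 * gθ)
    (hd2 : 0 ≤ d2) (hwell : wx ≤ wy + fd + d2) (hchi : cHM ≤ cHH + χ / 4 * m2)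
    (hh : hH ≤ a2 + 1 / 4 * h2) (hdh : hH - hpH ≤ dt / (4 * τ) * h2 + τ * I) :
    (1 / 2 * ux + μ / 2 * mx + μ / 2 * hx + l / 2 * tx + l / δ ^ 2 * wx)
      + ((1 / 2 * du + μ / 2 * dm + μ / 2 * dh + l / 2 * dtx)
        + dt * (μ / τ * (1 - χ / 4) * m2 + μ / (2 * τ) * h2 + vis + l * γ / δ * gψ))
      ≤ (1 / 2 * uy + μ / 2 * my + μ / 2 * hy + l / 2 * ty + l / δ ^ 2 * wy)
        + dt * (μ / τ * a2 + μ * τ / dt * I) := by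
  have k1 : l / δ ^ 2 * wx ≤ l / δ ^ 2 * (wy + fd + d2) := by gcongr
  have k2 : dt * μ / τ * cHM ≤ dt * μ / τ * (cHH + χ / 4 * m2) := by gcongr
  have k3 : dt * μ / τ * hH ≤ dt * μ / τ * (a2 + 1 / 4 * h2) := by gcongr
  have k4 : μ * (hH - hpH) ≤ μ * (dt / (4 * τ) * h2 + τ * I) := by gcongr
  -- By η ≤ δ the stabilization dominates the quadratic remainder of the potential in `k1`.
  have k5 : l / δ * (1 / δ) * d2 ≤ l / δ * (1 / η) * d2 := by gcongr
  -- The tested equations with the weights they carry in the energy. In the sum, `c` cancels between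
  -- `f1` and `f3`, and `b` between `f3` and `f5`.
  have f1 : l / δ * dψ = l / δ * dt * (c + γ * gψ) := by
    have : dψ = dt * (c + γ * gψ) := by
      have := congrArg (dt * ·) e1
      field_simp at this
      linarith
    rw [this]
    ring
  have f2 : l / δ * dψ + l * gθ + l / δ ^ 2 * fd + l / δ * (1 / η) * d2 = 0 := by
    have := congrArg (l / δ * ·) e2
    simp only [mul_zero] at this
    rw [← this]
    field_simp
  have f3 : uu + dt * vis = dt * μ * b + l / δ * dt * c := by
    have := congrArg (dt * ·) e3
    simp only [add_zero, sub_zero] at this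
    have e : dt * (1 / dt * uu + vis) = uu + dt * vis := by field_simp
    rw [e] at this
    linarith
  have f4 : μ * mm + dt * μ / τ * m2 = dt * μ / τ * cHM := by
    have := congrArg (dt * μ * ·) e4
    have e : dt * μ * (1 / dt * mm - 0 + 1 / τ * m2) = μ * mm + dt * μ / τ * m2 := by
      field_simp
      ring
    rw [e] at this
    rw [this]
    ring
  have f5 : μ * (mH - myH) - dt * μ * b + dt * μ / τ * mH = dt * μ / τ * cHH := by
    have := congrArg (dt * μ * ·) e5
    have e : dt * μ * (1 / dt * (mH - myH) - b + 1 / τ * mH)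
        = μ * (mH - myH) - dt * μ * b + dt * μ / τ * mH := by
      field_simp
    rw [e] at this
    rw [this]
    ring
  have f6 : dt * μ / τ * h2 = dt * μ / τ * hH - dt * μ / τ * mH := by rw [e6]; ring
  -- The potential equations of both time levels replace the increment of (M, H) by increments of
  -- the field and of the applied field.
  have f7 : μ * h2 - μ * hyH = μ * (hH - hpH) - μ * (mH - myH) := by rw [e6, e7]; ring
  have g1 : μ * (ux - uy + du) = μ * (2 * uu) := by rw [nu]
  have g2 : μ * (mx - my + dm) = μ * (2 * mm) := by rw [nm]
  have g3 : μ * (hx - hy + dh) = μ * (2 * (h2 - hyH)) := by rw [nh]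
  have g4 : l * (tx - ty + dtx) = l * (2 * gθ) := by rw [nt]
  have r1 : dt * (μ / τ * (1 - χ / 4) * m2 + μ / (2 * τ) * h2 + vis + l * γ / δ * gψ)
      = dt * μ / τ * m2 - dt * μ / τ * (χ / 4 * m2) + 1 / 2 * (dt * μ / τ * h2) + dt * vis
        + l / δ * dt * (γ * gψ) := by
    field_simp
  have r2 : dt * (μ / τ * a2 + μ * τ / dt * I) = dt * μ / τ * a2 + μ * (τ * I) := by
    field_simp
  -- The second quarter of the dissipation of H; the first one is spent in `k3`, and the remaining
  -- half is the term μ/(2τ).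
  have r3 : μ * (dt / (4 * τ) * h2) = 1 / 4 * (dt * μ / τ * h2) := by
    ring
  have r4 : l / δ * (1 / δ) * d2 = l / δ ^ 2 * d2 := by
    field_simp
  rw [r1, r2]
  linarith

variable {p : Params} {hgrad : ∀ X ∈ S.pot, grad X ∈ S.mag}
  {bh : S.vel →ₗ[ℝ] S.vel →ₗ[ℝ] S.vel →ₗ[ℝ] ℝ} {bm : S.vel →ₗ[ℝ] S.mag →ₗ[ℝ] S.mag →ₗ[ℝ] ℝ}

theorem chi_wInner_le (p : Params) (θ : H1 Ω) (a b : L2v Ω) :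
    wInner (fun z => p.chi (val θ z)) a b
      ≤ wInner (fun z => p.chi (val θ z)) a a + p.chi0 / 4 * ‖b‖ ^ 2 :=
  wInner_le (aestronglyMeasurable_comp_val p.continuous_chi θ) (fun _ => p.chi_nonneg _)
    (fun _ => p.chi_le _) a b

/-- The test functions ψᵏ and θᵏ − θᵏ⁻¹ are admissible because the phase and potential spaces of the
Cahn–Hilliard pair coincide, and Hᵏ because gradients are magnetizations. The number `I` stands for
the time integral of the squared derivative of the applied field. -/
theorem SolvesStep.energy_le (hb : Bornology.IsBounded Ω) (hchem : S.chem = S.phase)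
    (heta : p.eta ≤ p.del)
    (hbh : ∀ u v w, bh u v w = - bh u w v) (hbm : ∀ u v w, bm u v w = - bm u w v)
    {dt : ℝ} (hdt : 0 < dt) {h h' : L2v Ω} {I : ℝ} (hI : ‖h - h'‖ ^ 2 ≤ dt * I)
    {y x : State S} (hy : SolvesPotential h' y) (hx : SolvesStep p hgrad bh bm dt h y x) :
    energy p x + (numDissipation p y x + dt * physDissipation p y x)
      ≤ energy p y + dt * ((p.mu0 / p.tau) * ‖h‖ ^ 2 + (p.mu0 * p.tau / dt) * I) := by
  have hb0 : bh y.U x.U x.U = 0 := by linarith [hbh y.U x.U x.U]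
  have hm0 : bm x.U x.M x.M = 0 := by linarith [hbm x.U x.M x.M]
  have a1 : 1 / dt * inner ℝ (val (x.θ : H1 Ω) - val (y.θ : H1 Ω)) (val (x.ψ : H1 Ω))
      - wInner (val (y.θ : H1 Ω)) (vval (x.U : Fin d → H1 Ω)) (grad (x.ψ : H1 Ω))
      - p.mob * ‖grad (x.ψ : H1 Ω)‖ ^ 2 = 0 := by
    rw [← real_inner_smul_left, ← real_inner_self_eq_norm_sq]
    exact hx.cahn1 ⟨x.ψ, hchem.le x.ψ.2⟩
  have a2 : inner ℝ (val (x.θ : H1 Ω) - val (y.θ : H1 Ω)) (val (x.ψ : H1 Ω))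
      + p.del * inner ℝ (grad (x.θ : H1 Ω) - grad (y.θ : H1 Ω)) (grad (x.θ : H1 Ω))
      + 1 / p.del * (∫ z in Ω, wellf (val (y.θ : H1 Ω) z)
          * (val (x.θ : H1 Ω) - val (y.θ : H1 Ω)) z)
      + 1 / p.eta * ‖val (x.θ : H1 Ω) - val (y.θ : H1 Ω)‖ ^ 2 = 0 := by
    rw [real_inner_comm, real_inner_comm (grad (x.θ : H1 Ω)), ← real_inner_self_eq_norm_sq,
      ← map_sub, ← map_sub]
    exact hx.cahn2 ⟨(x.θ : H1 Ω) - y.θ, hchem.ge (S.phase.sub_mem x.θ.2 y.θ.2)⟩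
  have a3 := hx.momentum x.U
  have a4 := hx.magnetization x.M
  have a5 : 1 / dt * (inner ℝ (x.M : L2v Ω) (grad (x.Φ : H1 Ω))
        - inner ℝ (y.M : L2v Ω) (grad (x.Φ : H1 Ω)))
      - bm x.U ⟨grad (x.Φ : H1 Ω), hgrad _ x.Φ.2⟩ x.M
      + 1 / p.tau * inner ℝ (x.M : L2v Ω) (grad (x.Φ : H1 Ω))
      = 1 / p.tau * wInner (fun z => p.chi (val (y.θ : H1 Ω) z)) (grad (x.Φ : H1 Ω))
          (grad (x.Φ : H1 Ω)) := by
    rw [← inner_sub_left, ← real_inner_smul_left]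
    exact hx.magnetization ⟨grad (x.Φ : H1 Ω), hgrad _ x.Φ.2⟩
  have a6 := hx.potential x.Φ
  have a7 := hy x.Φ
  rw [hx.incompressible x.P, hb0, wInner_comm, real_inner_smul_left] at a3
  rw [hm0, real_inner_smul_left, real_inner_self_eq_norm_sq] at a4
  rw [inner_sub_left] at a6 a7
  rw [real_inner_self_eq_norm_sq] at a6
  have n3 := norm_sub_sq_eq (grad (x.Φ : H1 Ω)) (grad (y.Φ : H1 Ω))
  rw [inner_sub_left, real_inner_self_eq_norm_sq] at n3
  have hdh := inner_le_of_sq_le (b := grad (x.Φ : H1 Ω)) hdt p.tau_pos hI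
  rw [inner_sub_left] at hdh
  have nu := norm_sub_sq_eq (vval (x.U : Fin d → H1 Ω)) (vval (y.U : Fin d → H1 Ω))
  have nm := norm_sub_sq_eq (x.M : L2v Ω) (y.M : L2v Ω)
  have nt := norm_sub_sq_eq (grad (x.θ : H1 Ω)) (grad (y.θ : H1 Ω))
  have hw := integral_wellF_le hb (val (y.θ : H1 Ω)) (val (x.θ : H1 Ω))
  have hc := chi_wInner_le p (y.θ : H1 Ω) (grad (x.Φ : H1 Ω)) (x.M : L2v Ω)
  have hh := inner_le_sq_add_sq h (grad (x.Φ : H1 Ω))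
  have hd2 := sq_nonneg ‖val (x.θ : H1 Ω) - val (y.θ : H1 Ω)‖
  unfold energy numDissipation physDissipation
  exact energy_balance hdt p.tau_pos p.del_pos p.eta_pos p.cap_pos p.mu0_pos heta
    a1 a2 a3 a4 a5 a6 a7 nu nm n3 nt hd2 hw hc hh hdh

theorem energy_estimate (hb : Bornology.IsBounded Ω) (hchem : S.chem = S.phase)
    (heta : p.eta ≤ p.del)
    (hbh : ∀ u v w, bh u v w = - bh u w v) (hbm : ∀ u v w, bm u v w = - bm u w v)
    {T : ℝ} (hT : 0 < T) {K : ℕ} (hK : 0 < K) {dt : ℝ} (hdt : dt = T / K) {ha : ℝ → L2v Ω}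
    (hha : ContDiffOn ℝ 1 ha (Set.Icc 0 T)) {x : ℕ → State S} (h0 : SolvesPotential (ha 0) (x 0))
    (hx : ∀ k ∈ Finset.Icc 1 K, SolvesStep p hgrad bh bm dt (ha (k * dt)) (x (k - 1)) (x k))
    {n : ℕ} (hn : n ≤ K) :
    energy p (x n) + ∑ k ∈ Finset.Icc 1 n, (numDissipation p (x (k - 1)) (x k)
        + dt * physDissipation p (x (k - 1)) (x k))
      ≤ energy p (x 0) + ∑ k ∈ Finset.Icc 1 n, dt * forcing p T dt ha k := by
  have hK' : (0 : ℝ) < K := by exact_mod_cast hK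
  have hdt0 : 0 < dt := by rw [hdt]; positivity
  induction n with
  | zero => simp
  | succ n ih =>
    -- The previous level satisfies its own potential equation: by assumption at level 0, as part of
    -- the preceding step afterwards.
    have hpot : SolvesPotential (ha (n * dt)) (x n) := by
      rcases Nat.eq_zero_or_pos n with rfl | hpos
      · simpa using h0
      · exact (hx n (Finset.mem_Icc.2 ⟨hpos, by omega⟩)).potential
    have hstep := hx (n + 1) (Finset.mem_Icc.2 ⟨by omega, hn⟩)
    rw [Nat.add_sub_cancel] at hstep
    have hle : ((n + 1 : ℕ) : ℝ) * dt ≤ T := by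
      have : ((n + 1 : ℕ) : ℝ) ≤ K := by exact_mod_cast hn
      calc ((n + 1 : ℕ) : ℝ) * dt ≤ K * dt := by gcongr
        _ = T := by rw [hdt]; field_simp
    have hI := norm_sub_sq_le_integral hha hT (a := n * dt) (b := (n + 1 : ℕ) * dt) (by positivity)
      (by push_cast; linarith) hle
    have e : ((n + 1 : ℕ) : ℝ) * dt - n * dt = dt := by push_cast; ring
    rw [e] at hI
    have key := hstep.energy_le hb hchem heta hbh hbm hdt0 hI hpot
    rw [Finset.sum_Icc_succ_top (by omega), Finset.sum_Icc_succ_top (by omega),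
      Nat.add_sub_cancel]
    have hf : forcing p T dt ha (n + 1) = (p.mu0 / p.tau) * ‖ha ((n + 1 : ℕ) * dt)‖ ^ 2
        + (p.mu0 * p.tau / dt) *
          ∫ s in (n * dt)..((n + 1 : ℕ) * dt), ‖derivWithin ha (Set.Icc 0 T) s‖ ^ 2 := by
      unfold forcing
      push_cast
      rw [add_sub_cancel_right]
    rw [hf]
    linarith [ih (by omega)]

end Energy

/-! ### Eliminations, multipliers and the abstract coupled problem. -/

section LinearAlgebra

/-- A functional that vanishes on the kernel of a constraint is represented by a multiplier. -/
theorem exists_multiplier {V Q : Type*} [AddCommGroup V] [Module ℝ V] [FiniteDimensional ℝ V]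
    [AddCommGroup Q] [Module ℝ Q] (b : Q →ₗ[ℝ] V →ₗ[ℝ] ℝ) (r : V →ₗ[ℝ] ℝ)
    (h : ∀ v, (∀ q, b q v = 0) → r v = 0) : ∃ q, ∀ v, b q v = r v := by
  have key : r ∈ LinearMap.range b := by
    rw [← Subspace.dualCoannihilator_dualAnnihilator_eq (W := LinearMap.range b),
      Submodule.mem_dualAnnihilator]
    intro v hv
    rw [Submodule.mem_dualCoannihilator] at hv
    exact h v fun q => hv _ (LinearMap.mem_range_self b q)
  obtain ⟨q, hq⟩ := key
  exact ⟨q, fun v => by rw [hq]⟩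

/-- Galerkin solution operator of a definite form. -/
theorem exists_solver {V : Type*} [AddCommGroup V] [Module ℝ V] [FiniteDimensional ℝ V]
    (b : V →ₗ[ℝ] V →ₗ[ℝ] ℝ) (hb : ∀ v, b v v = 0 → v = 0) :
    ∃ E : (V →ₗ[ℝ] ℝ) →ₗ[ℝ] V, ∀ r v, b (E r) v = r v := by
  have hinj : Function.Injective b := by
    rw [injective_iff_map_eq_zero]
    intro v hv
    exact hb v (by rw [hv, LinearMap.zero_apply])
  let e := LinearMap.linearEquivOfInjective b hinj (Subspace.dual_finrank_eq (K := ℝ) (V := V)).symm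
  refine ⟨e.symm, fun r v => ?_⟩
  exact LinearMap.congr_fun (e.apply_symm_apply r) v

/-- Galerkin projection onto the range of a linear map. -/
theorem exists_galerkin_projection {V E : Type*} [AddCommGroup V] [Module ℝ V]
    [FiniteDimensional ℝ V] [NormedAddCommGroup E] [InnerProductSpace ℝ E] (g : V →ₗ[ℝ] E) :
    ∃ G : E →ₗ[ℝ] V, ∀ h v, (inner ℝ (g (G h)) (g v) : ℝ) = inner ℝ h (g v) := by
  -- The map `g` may have a kernel (constants have zero gradient), so the orthogonal projection onto
  -- its range is lifted by a linear section.
  obtain ⟨s, hs⟩ := g.rangeRestrict.exists_rightInverse_of_surjective g.range_rangeRestrict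
  refine ⟨s ∘ₗ (LinearMap.range g).orthogonalProjectionOnto.toLinearMap, fun h v => ?_⟩
  have e : g (s ((LinearMap.range g).orthogonalProjectionOnto h))
      = (LinearMap.range g).orthogonalProjectionOnto h :=
    congrArg Subtype.val (LinearMap.congr_fun hs _)
  have h2 := Submodule.starProjection_inner_eq_zero (K := LinearMap.range g) h (g v)
    (LinearMap.mem_range_self g v)
  rw [inner_sub_left, sub_eq_zero] at h2
  simp only [LinearMap.comp_apply]
  exact (congrArg (fun z => inner ℝ z (g v)) e).trans h2.symm

theorem contDiff_linearMap {E F : Type*} [NormedAddCommGroup E] [NormedSpace ℝ E]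
    [FiniteDimensional ℝ E] [NormedAddCommGroup F] [NormedSpace ℝ F] (f : E →ₗ[ℝ] F)
    {n : WithTop ℕ∞} : ContDiff ℝ n f :=
  (LinearMap.toContinuousLinearMap f).contDiff

theorem ContDiff.bilinear {X E F : Type*} [NormedAddCommGroup X] [NormedSpace ℝ X]
    [NormedAddCommGroup E] [NormedSpace ℝ E] [FiniteDimensional ℝ E]
    [NormedAddCommGroup F] [NormedSpace ℝ F] [FiniteDimensional ℝ F] (b : E →ₗ[ℝ] F →ₗ[ℝ] ℝ)
    {f : X → E} {g : X → F} {n : WithTop ℕ∞} (hf : ContDiff ℝ n f) (hg : ContDiff ℝ n g) :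
    ContDiff ℝ n fun x => b (f x) (g x) := by
  let B : E →ₗ[ℝ] F →L[ℝ] ℝ := (LinearMap.toContinuousLinearMap (𝕜 := ℝ)).toLinearMap ∘ₗ b
  exact ((contDiff_linearMap B).comp hf).clm_apply hg

/-- A definite linear problem perturbed by a smooth nonlinearity without power is solvable. -/
theorem exists_forall_eq_zero_of_definite {V : Type*} [NormedAddCommGroup V] [NormedSpace ℝ V]
    [FiniteDimensional ℝ V] (B : V →ₗ[ℝ] V →ₗ[ℝ] ℝ) (hB : ∀ u, u ≠ 0 → 0 < B u u)
    (l : V →ₗ[ℝ] ℝ) (t : V → V →ₗ[ℝ] ℝ) (ht : ∀ v, ContDiff ℝ 1 fun u => t u v)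
    (ht0 : ∀ u, t u u = 0) : ∃ u, ∀ v, B u v + l v + t u v = 0 := by
  have hBc : Continuous fun u => B u u :=
    (ContDiff.bilinear (n := 0) B contDiff_id contDiff_id).continuous
  -- Coercivity from definiteness, by compactness of the unit sphere.
  obtain ⟨c, hc, hcB⟩ : ∃ c > 0, ∀ u, c * ‖u‖ ^ 2 ≤ B u u := by
    have hs : IsCompact (Metric.sphere (0 : V) 1) := isCompact_sphere 0 1
    rcases (Metric.sphere (0 : V) 1).eq_empty_or_nonempty with he | hne
    · refine ⟨1, one_pos, fun u => ?_⟩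
      by_cases hu : u = 0
      · simp [hu]
      · have : (‖u‖⁻¹ • u) ∈ Metric.sphere (0 : V) 1 := by
          simp [norm_smul, norm_ne_zero_iff.2 hu]
        rw [he] at this
        exact this.elim
    · obtain ⟨x, hx, hmin⟩ := hs.exists_isMinOn hne hBc.continuousOn
      have hx0 : x ≠ 0 := by
        rintro rfl
        simp at hx
      refine ⟨B x x, hB x hx0, fun u => ?_⟩
      by_cases hu : u = 0
      · simp [hu]
      · have hn : ‖u‖ ≠ 0 := norm_ne_zero_iff.2 hu
        have hm : (‖u‖⁻¹ • u) ∈ Metric.sphere (0 : V) 1 := by simp [norm_smul, hn]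
        have h1 : B x x ≤ B (‖u‖⁻¹ • u) (‖u‖⁻¹ • u) := hmin hm
        simp only [map_smul, LinearMap.smul_apply, smul_eq_mul] at h1
        calc B x x * ‖u‖ ^ 2 ≤ ‖u‖⁻¹ * (‖u‖⁻¹ * B u u) * ‖u‖ ^ 2 := by gcongr
          _ = B u u := by field_simp
  let L := LinearMap.toContinuousLinearMap l
  have hl : ∀ u, |l u| ≤ ‖L‖ * ‖u‖ := fun u => L.le_opNorm u
  refine exists_forall_eq_zero_of_coercive (fun u => B u + l + t u) (fun v => ?_)
    (R := (‖L‖ + 1) / c) fun u hu => ?_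
  · exact ((ContDiff.bilinear B contDiff_id contDiff_const).add contDiff_const).add (ht v)
  · simp only [LinearMap.add_apply, ht0, add_zero]
    have hR : 0 < (‖L‖ + 1) / c := by positivity
    have hu0 : 0 < ‖u‖ := hR.trans_le hu
    rw [div_le_iff₀ hc] at hu
    have h1 := hcB u
    have h2 := neg_le_of_abs_le (hl u)
    nlinarith

/-- Solvability of three definite linear problems that are coupled by a skew form and by a skew
magnetic force. -/
theorem exists_coupled_solution_of_normed {X M W : Type*}
    [NormedAddCommGroup X] [NormedSpace ℝ X] [FiniteDimensional ℝ X]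
    [NormedAddCommGroup M] [NormedSpace ℝ M] [FiniteDimensional ℝ M]
    [NormedAddCommGroup W] [NormedSpace ℝ W] [FiniteDimensional ℝ W]
    (qX : X →ₗ[ℝ] X →ₗ[ℝ] ℝ) (hX : ∀ u, u ≠ 0 → 0 < qX u u)
    (qM : M →ₗ[ℝ] M →ₗ[ℝ] ℝ) (hM : ∀ u, u ≠ 0 → 0 < qM u u)
    (qW : W →ₗ[ℝ] W →ₗ[ℝ] ℝ) (hW : ∀ u, u ≠ 0 → 0 < qW u u)
    (cpl : W →ₗ[ℝ] X →ₗ[ℝ] ℝ) (bm : W →ₗ[ℝ] M →ₗ[ℝ] M →ₗ[ℝ] ℝ)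
    (hbm : ∀ u v w, bm u v w = - bm u w v) (H : M →ₗ[ℝ] M) (H₀ : M)
    (lX : X →ₗ[ℝ] ℝ) (lM : M →ₗ[ℝ] ℝ) (lW : W →ₗ[ℝ] ℝ) :
    ∃ (ψ : X) (N : M) (U : W),
      (∀ v, qX ψ v + cpl U v + lX v = 0) ∧
      (∀ Z, qM N Z - bm U Z (N + (H N + H₀)) + lM Z = 0) ∧
      (∀ V, qW U V - cpl V ψ - bm V (H N + H₀) (N + (H N + H₀)) + lW V = 0) := by
  let π₁ : X × M × W →ₗ[ℝ] X := LinearMap.fst ℝ _ _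
  let π₂ : X × M × W →ₗ[ℝ] M := LinearMap.fst ℝ _ _ ∘ₗ LinearMap.snd ℝ _ _
  let π₃ : X × M × W →ₗ[ℝ] W := LinearMap.snd ℝ _ _ ∘ₗ LinearMap.snd ℝ _ _
  let B : X × M × W →ₗ[ℝ] X × M × W →ₗ[ℝ] ℝ :=
    qX.compl₁₂ π₁ π₁ + qM.compl₁₂ π₂ π₂ + qW.compl₁₂ π₃ π₃ + cpl.compl₁₂ π₃ π₁
      - (cpl.compl₁₂ π₃ π₁).flip
  have hBe : ∀ u v, B u v = qX u.1 v.1 + qM u.2.1 v.2.1 + qW u.2.2 v.2.2 + cpl u.2.2 v.1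
      - cpl v.2.2 u.1 := fun _ _ => rfl
  let t : X × M × W → X × M × W →ₗ[ℝ] ℝ := fun u =>
    -((bm u.2.2).flip (u.2.1 + (H u.2.1 + H₀)) ∘ₗ π₂)
      - (bm.flip (H u.2.1 + H₀)).flip (u.2.1 + (H u.2.1 + H₀)) ∘ₗ π₃
  have hte : ∀ u v, t u v = -bm u.2.2 v.2.1 (u.2.1 + (H u.2.1 + H₀))
      - bm v.2.2 (H u.2.1 + H₀) (u.2.1 + (H u.2.1 + H₀)) := fun _ _ => rfl
  have c1 : ContDiff ℝ 1 fun u : X × M × W => H u.2.1 + H₀ :=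
    ((contDiff_linearMap H).comp contDiff_snd.fst).add contDiff_const
  have c2 : ContDiff ℝ 1 fun u : X × M × W => u.2.1 + (H u.2.1 + H₀) := contDiff_snd.fst.add c1
  have key : ∃ u, ∀ v, B u v + (lX ∘ₗ π₁ + lM ∘ₗ π₂ + lW ∘ₗ π₃) v + t u v = 0 := by
    refine exists_forall_eq_zero_of_definite B (fun u hu => ?_) _ t (fun v => ?_) (fun u => ?_)
    · have nX : ∀ x, 0 ≤ qX x x := fun x => by
        by_cases hx : x = 0
        · simp [hx]
        · exact (hX x hx).le
      have nM : ∀ x, 0 ≤ qM x x := fun x => by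
        by_cases hx : x = 0
        · simp [hx]
        · exact (hM x hx).le
      have nW : ∀ x, 0 ≤ qW x x := fun x => by
        by_cases hx : x = 0
        · simp [hx]
        · exact (hW x hx).le
      rw [hBe]
      have a1 := nX u.1
      have a2 := nM u.2.1
      have a3 := nW u.2.2
      by_cases h1 : u.1 = 0
      · by_cases h2 : u.2.1 = 0
        · have h3 : u.2.2 ≠ 0 := fun h3 => hu (Prod.ext h1 (Prod.ext h2 h3))
          linarith [hW _ h3]
        · linarith [hM _ h2]
      · linarith [hX _ h1]
    · simp only [hte]
      exact (ContDiff.bilinear (bm.flip v.2.1) contDiff_snd.snd c2).neg.sub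
        (ContDiff.bilinear (bm v.2.2) c1 c2)
    -- With M = N + H the tested nonlinearity is −b(U, N, M) − b(U, H, M) = −b(U, M, M) = 0. This is
    -- why N = M − H is the unknown.
    · have h := hbm u.2.2 (u.2.1 + (H u.2.1 + H₀)) (u.2.1 + (H u.2.1 + H₀))
      have h' : bm u.2.2 (u.2.1 + (H u.2.1 + H₀)) (u.2.1 + (H u.2.1 + H₀))
        = bm u.2.2 u.2.1 (u.2.1 + (H u.2.1 + H₀))
          + bm u.2.2 (H u.2.1 + H₀) (u.2.1 + (H u.2.1 + H₀)) := by
        rw [map_add (bm u.2.2) u.2.1, LinearMap.add_apply]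
      rw [hte]
      linarith
  obtain ⟨u, hu⟩ := key
  refine ⟨u.1, u.2.1, u.2.2, fun v => ?_, fun Z => ?_, fun V => ?_⟩
  · have := hu (v, 0, 0)
    rw [hBe, hte] at this
    simpa [π₁, π₂, π₃] using this
  · have := hu (0, Z, 0)
    rw [hBe, hte] at this
    simp [π₁, π₂, π₃] at this
    simp
    linarith
  · have := hu (0, 0, V)
    rw [hBe, hte] at this
    simp [π₁, π₂, π₃] at this
    simp
    linarith

/-- `exists_coupled_solution_of_normed` without reference to norms. -/
theorem exists_coupled_solution {X M W : Type*}
    [AddCommGroup X] [Module ℝ X] [FiniteDimensional ℝ X]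
    [AddCommGroup M] [Module ℝ M] [FiniteDimensional ℝ M]
    [AddCommGroup W] [Module ℝ W] [FiniteDimensional ℝ W]
    (qX : X →ₗ[ℝ] X →ₗ[ℝ] ℝ) (hX : ∀ u, u ≠ 0 → 0 < qX u u)
    (qM : M →ₗ[ℝ] M →ₗ[ℝ] ℝ) (hM : ∀ u, u ≠ 0 → 0 < qM u u)
    (qW : W →ₗ[ℝ] W →ₗ[ℝ] ℝ) (hW : ∀ u, u ≠ 0 → 0 < qW u u)
    (cpl : W →ₗ[ℝ] X →ₗ[ℝ] ℝ) (bm : W →ₗ[ℝ] M →ₗ[ℝ] M →ₗ[ℝ] ℝ)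
    (hbm : ∀ u v w, bm u v w = - bm u w v) (H : M →ₗ[ℝ] M) (H₀ : M)
    (lX : X →ₗ[ℝ] ℝ) (lM : M →ₗ[ℝ] ℝ) (lW : W →ₗ[ℝ] ℝ) :
    ∃ (ψ : X) (N : M) (U : W),
      (∀ v, qX ψ v + cpl U v + lX v = 0) ∧
      (∀ Z, qM N Z - bm U Z (N + (H N + H₀)) + lM Z = 0) ∧
      (∀ V, qW U V - cpl V ψ - bm V (H N + H₀) (N + (H N + H₀)) + lW V = 0) := by
  -- Any norm will do; these are pulled back from coordinates.
  let : NormedAddCommGroup X := NormedAddCommGroup.induced X _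
    (Module.finBasis ℝ X).equivFun.toLinearMap (Module.finBasis ℝ X).equivFun.injective
  let : NormedSpace ℝ X := NormedSpace.induced ℝ X _ (Module.finBasis ℝ X).equivFun.toLinearMap
  let : NormedAddCommGroup M := NormedAddCommGroup.induced M _
    (Module.finBasis ℝ M).equivFun.toLinearMap (Module.finBasis ℝ M).equivFun.injective
  let : NormedSpace ℝ M := NormedSpace.induced ℝ M _ (Module.finBasis ℝ M).equivFun.toLinearMap
  let : NormedAddCommGroup W := NormedAddCommGroup.induced W _
    (Module.finBasis ℝ W).equivFun.toLinearMap (Module.finBasis ℝ W).equivFun.injective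
  let : NormedSpace ℝ W := NormedSpace.induced ℝ W _ (Module.finBasis ℝ W).equivFun.toLinearMap
  exact exists_coupled_solution_of_normed qX hX qM hM qW hW cpl bm hbm H H₀ lX lM lW

/-- The coupled problem with a multiplier for a linear constraint. -/
theorem exists_constrained_solution {X M Y Q : Type*}
    [AddCommGroup X] [Module ℝ X] [FiniteDimensional ℝ X]
    [AddCommGroup M] [Module ℝ M] [FiniteDimensional ℝ M]
    [AddCommGroup Y] [Module ℝ Y] [FiniteDimensional ℝ Y] [AddCommGroup Q] [Module ℝ Q]
    (qX : X →ₗ[ℝ] X →ₗ[ℝ] ℝ) (hX : ∀ u, u ≠ 0 → 0 < qX u u)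
    (qM : M →ₗ[ℝ] M →ₗ[ℝ] ℝ) (hM : ∀ u, u ≠ 0 → 0 < qM u u)
    (qY : Y →ₗ[ℝ] Y →ₗ[ℝ] ℝ) (hY : ∀ u, u ≠ 0 → 0 < qY u u)
    (cpl : Y →ₗ[ℝ] X →ₗ[ℝ] ℝ) (bm : Y →ₗ[ℝ] M →ₗ[ℝ] M →ₗ[ℝ] ℝ)
    (hbm : ∀ u v w, bm u v w = - bm u w v) (H : M →ₗ[ℝ] M) (H₀ : M)
    (lX : X →ₗ[ℝ] ℝ) (lM : M →ₗ[ℝ] ℝ) (lY : Y →ₗ[ℝ] ℝ) (b : Q →ₗ[ℝ] Y →ₗ[ℝ] ℝ)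
    {α μ : ℝ} (hα : 0 < α) (hμ : 0 < μ) :
    ∃ (ψ : X) (N : M) (U : Y) (P : Q),
      (∀ v, qX ψ v + cpl U v + lX v = 0) ∧
      (∀ Z, qM N Z - bm U Z (N + (H N + H₀)) + lM Z = 0) ∧
      (∀ V, qY U V - α * cpl V ψ - μ * bm V (H N + H₀) (N + (H N + H₀)) + lY V = b P V) ∧
      ∀ q, b q U = 0 := by
  let W : Submodule ℝ Y := LinearMap.ker b.flip
  have hW : ∀ V, V ∈ W ↔ ∀ q, b q V = 0 := fun V => by
    rw [LinearMap.mem_ker, LinearMap.ext_iff]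
    rfl
  -- Multiplying the first equation by α and the second by μ makes their couplings match those of
  -- the third. The constraint is built into the kernel `W`.
  obtain ⟨ψ, N, U, s1, s2, s3⟩ := exists_coupled_solution (α • qX)
    (fun u hu => mul_pos hα (hX u hu)) (μ • qM) (fun u hu => mul_pos hμ (hM u hu))
    (qY.compl₁₂ W.subtype W.subtype) (fun u hu => hY u fun h0 => hu (Subtype.ext h0))
    (α • cpl ∘ₗ W.subtype) (μ • bm ∘ₗ W.subtype)
    (fun u v w => by
      change μ * bm u v w = -(μ * bm u w v)
      rw [hbm]
      ring) H H₀ (α • lX) (μ • lM) (lY ∘ₗ W.subtype)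
  -- The residual of the third equation vanishes on `W`, hence is of the form b P. No inf-sup
  -- condition enters, as uniqueness of P is not claimed.
  obtain ⟨P, hP⟩ := exists_multiplier b (qY U - α • cpl.flip ψ
    - μ • (bm.flip (H N + H₀)).flip (N + (H N + H₀)) + lY) fun V hV => s3 ⟨V, (hW V).2 hV⟩
  refine ⟨ψ, N, U, P, fun v => ?_, fun Z => ?_, fun V => (hP V).symm, (hW _).1 U.2⟩
  · have h1 : α * qX ψ v + α * cpl U v + α * lX v = 0 := s1 v
    have h2 : α * (qX ψ v + cpl U v + lX v) = 0 := by linarith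
    exact (mul_eq_zero.1 h2).resolve_left hα.ne'
  · have h1 : μ * qM N Z - μ * bm U Z (N + (H N + H₀)) + μ * lM Z = 0 := s2 Z
    have h2 : μ * (qM N Z - bm U Z (N + (H N + H₀)) + lM Z) = 0 := by linarith
    exact (mul_eq_zero.1 h2).resolve_left hμ.ne'

/-- Elimination of the phase field: it is an affine function of the chemical potential, and its
linear part is strictly decreasing with respect to the mass form `m`. -/
theorem exists_phase_elimination {V : Type*} [AddCommGroup V] [Module ℝ V] [FiniteDimensional ℝ V]
    (m k : V →ₗ[ℝ] V →ₗ[ℝ] ℝ) (hms : ∀ u v, m u v = m v u) (hm : ∀ u, u ≠ 0 → 0 < m u u)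
    (hk : ∀ u, 0 ≤ k u u) {δ η γ dt : ℝ} (hδ : 0 < δ) (hη : 0 < η) (hγ : 0 < γ) (hdt : 0 < dt)
    (r : V →ₗ[ℝ] ℝ) (θ : V) :
    ∃ (e : V → V) (q : V →ₗ[ℝ] V →ₗ[ℝ] ℝ) (l : V →ₗ[ℝ] ℝ), (∀ u, u ≠ 0 → 0 < q u u) ∧
      (∀ ψ v, m ψ v + δ * k (e ψ) v + r v + 1 / η * m (e ψ - θ) v = 0) ∧
      ∀ ψ v, q ψ v + l v = γ * k ψ v - 1 / dt * m (e ψ - θ) v := by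
  let b := δ • k + (1 / η) • m
  have hbe : ∀ u v, b u v = δ * k u v + 1 / η * m u v := fun _ _ => rfl
  have hpos : ∀ u, u ≠ 0 → 0 < b u u := by
    intro u hu
    have h1 := hm u hu
    have h2 := hk u
    rw [hbe]
    positivity
  obtain ⟨E, hE⟩ := exists_solver b fun v hv => by
    by_contra hne
    exact (hpos v hne).ne' hv
  -- With z = E(mψ), symmetry of m gives m(z, ψ) = m(ψ, z) = b(z, z).
  have hpar : ∀ ψ, ψ ≠ 0 → 0 < m (E (m ψ)) ψ := fun ψ hψ => by
    rw [hms, ← hE (m ψ)]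
    refine hpos _ fun h0 => (hm ψ hψ).ne' ?_
    rw [← hE (m ψ) ψ, h0, map_zero, LinearMap.zero_apply]
  -- The second equation reads b(eψ − θ, ·) = −m(ψ, ·) − δk(θ, ·) − r, with b = δk + m/η inverted by
  -- `E`.
  refine ⟨fun ψ => θ - E (m ψ) - E (δ • k θ + r), (1 / dt) • m ∘ₗ E ∘ₗ m + γ • k,
    (1 / dt) • m (E (δ • k θ + r)), fun u hu => ?_, fun ψ v => ?_, fun ψ v => ?_⟩
  · have h1 := hpar u hu
    have h2 := hk u
    simp only [LinearMap.add_apply, LinearMap.smul_apply, LinearMap.comp_apply, smul_eq_mul]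
    positivity
  · have h1 := hE (m ψ) v
    have h2 := hE (δ • k θ + r) v
    simp only [hbe, LinearMap.add_apply, LinearMap.smul_apply, smul_eq_mul] at h1 h2
    simp only [map_sub, LinearMap.sub_apply]
    linarith
  · simp only [map_sub, LinearMap.sub_apply, LinearMap.add_apply, LinearMap.smul_apply,
      LinearMap.comp_apply, smul_eq_mul]
    ring

/-- The magnetization form, after elimination of the potential, is positive definite. -/
theorem magnetic_form_pos {E : Type*} [NormedAddCommGroup E] [InnerProductSpace ℝ E] {N H AH : E}
    {dt τ χ : ℝ} (hdt : 0 < dt) (hτ : 0 < τ) (hχ : χ ≤ 4) (hH : inner ℝ (N + H) H = -‖H‖ ^ 2)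
    (hA : inner ℝ AH (N + H) ≤ inner ℝ AH H + χ / 4 * ‖N + H‖ ^ 2) (hN : N ≠ 0) :
    0 < (1 / dt) * inner ℝ (N + H) N + (1 / τ) * inner ℝ (N + H) N - (1 / τ) * inner ℝ AH N := by
  have h1 : inner ℝ (N + H) N = ‖N + H‖ ^ 2 + ‖H‖ ^ 2 := by
    have : inner ℝ (N + H) N = inner ℝ (N + H) (N + H) - inner ℝ (N + H) H := by
      rw [← inner_sub_right, add_sub_cancel_right]
    rw [this, hH, real_inner_self_eq_norm_sq]
    ring
  rw [inner_add_right] at hA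
  have h2 : 0 < ‖N + H‖ ^ 2 + ‖H‖ ^ 2 := by
    by_contra hcon
    have e1 : ‖H‖ = 0 := by nlinarith [sq_nonneg ‖N + H‖, sq_nonneg ‖H‖]
    have e2 : ‖N + H‖ = 0 := by nlinarith [sq_nonneg ‖N + H‖, sq_nonneg ‖H‖]
    rw [norm_eq_zero] at e1 e2
    rw [e1, add_zero] at e2
    exact hN e2
  -- With M = N + H, (AH, N) = (AH, M) − (AH, H) ≤ (χ/4)‖M‖², and χ ≤ 4. Strict positivity then
  -- comes from the time derivative.
  have h3 : inner ℝ AH N ≤ ‖N + H‖ ^ 2 + ‖H‖ ^ 2 := by nlinarith [sq_nonneg ‖N + H‖, sq_nonneg ‖H‖]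
  have h4 : (1 / τ) * inner ℝ AH N ≤ (1 / τ) * (‖N + H‖ ^ 2 + ‖H‖ ^ 2) := by gcongr
  have h5 : 0 < (1 / dt) * (‖N + H‖ ^ 2 + ‖H‖ ^ 2) := by positivity
  rw [h1]
  linarith

/-- Elimination of the magnetic potential: the effective field `H N + H₀` is an affine function of
`N`, the difference of magnetization and effective field. -/
theorem exists_magnetic_elimination {E X : Type*} [NormedAddCommGroup E] [InnerProductSpace ℝ E]
    [AddCommGroup X] [Module ℝ X] [FiniteDimensional ℝ X] (S : Submodule ℝ E) (g : X →ₗ[ℝ] E)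
    (hg : ∀ x, g x ∈ S) (A : E →ₗ[ℝ] E) {χ τ dt : ℝ} (hχ : χ ≤ 4)
    (hA : ∀ a b, inner ℝ (A a) b ≤ inner ℝ (A a) a + χ / 4 * ‖b‖ ^ 2)
    (hτ : 0 < τ) (hdt : 0 < dt) (h M : E) :
    ∃ (H : S →ₗ[ℝ] S) (H₀ : S) (q : S →ₗ[ℝ] S →ₗ[ℝ] ℝ) (l : S →ₗ[ℝ] ℝ),
      (∀ u, u ≠ 0 → 0 < q u u) ∧
      (∀ N : S, ∃ Φ : X, g Φ = ((H N + H₀ : S) : E) ∧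
        ∀ x, (inner ℝ (g Φ) (g x) : ℝ) = inner ℝ (h - ((N + (H N + H₀) : S) : E)) (g x)) ∧
      ∀ N Z : S, q N Z + l Z = inner ℝ ((1 / dt) • (((N + (H N + H₀) : S) : E) - M)) (Z : E)
          + 1 / τ * inner ℝ ((N + (H N + H₀) : S) : E) (Z : E)
          - 1 / τ * inner ℝ (A ((H N + H₀ : S) : E)) (Z : E) := by
  obtain ⟨G, hG⟩ := exists_galerkin_projection g
  let γ : X →ₗ[ℝ] S := g.codRestrict S hg
  let i := S.subtype
  -- Inserting M = N + H into H = P(h − M), where PH = H, yields 2H = P(h − N).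
  let H : S →ₗ[ℝ] S := -((1 / 2 : ℝ) • γ ∘ₗ G ∘ₗ i)
  let H₀ : S := (1 / 2 : ℝ) • γ (G h)
  have hH : ∀ N : S, (H N : E) = -((1 / 2 : ℝ) • g (G (N : E))) := fun _ => rfl
  have hH₀ : (H₀ : E) = (1 / 2 : ℝ) • g (G h) := rfl
  clear_value H H₀
  let q : S →ₗ[ℝ] S →ₗ[ℝ] ℝ :=
    (innerₗ E).compl₁₂ ((1 / dt) • (i + i ∘ₗ H) + (1 / τ) • (i + i ∘ₗ H)
      - (1 / τ) • A ∘ₗ i ∘ₗ H) i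
  let l : S →ₗ[ℝ] ℝ := innerₗ E ((1 / dt) • ((H₀ : E) - M) + (1 / τ) • (H₀ : E)
    - (1 / τ) • A H₀) ∘ₗ i
  have hq : ∀ u v, q u v = inner ℝ ((1 / dt) • ((u : E) + H u)
    + (1 / τ) • ((u : E) + H u) - (1 / τ) • A (H u)) (v : E) := fun _ _ => rfl
  have hl : ∀ v, l v = inner ℝ ((1 / dt) • ((H₀ : E) - M)
    + (1 / τ) • (H₀ : E) - (1 / τ) • A H₀) (v : E) := fun _ => rfl
  clear_value q l
  refine ⟨H, H₀, q, l, fun u hu => ?_, fun N => ⟨(1 / 2 : ℝ) • G (h - (N : E)), ?_⟩,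
    fun N Z => ?_⟩
  · rw [hq, inner_sub_left, inner_add_left, real_inner_smul_left, real_inner_smul_left,
      real_inner_smul_left]
    refine magnetic_form_pos hdt hτ hχ ?_ (hA _ _) fun h0 => hu (Subtype.ext h0)
    have h1 := hG (u : E) (G (u : E))
    rw [← real_inner_self_eq_norm_sq, hH]
    simp only [inner_add_left, inner_neg_left, inner_neg_right, real_inner_smul_left,
      real_inner_smul_right]
    linarith
  · have e : g ((1 / 2 : ℝ) • G (h - (N : E))) = ((H N + H₀ : S) : E) := by
      rw [Submodule.coe_add, hH, hH₀, map_smul, map_sub, map_sub]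
      module
    refine ⟨e, fun x => ?_⟩
    rw [Submodule.coe_add, ← e, map_smul, ← sub_sub, inner_sub_left, real_inner_smul_left, hG]
    ring
  · rw [hq, hl]
    simp only [Submodule.coe_add, map_add, inner_add_left, inner_sub_left, real_inner_smul_left]
    ring

end LinearAlgebra

/-! ### Solvability of one time step and of the scheme. -/

section Existence

variable {d : ℕ} {Ω : Set (Pt d)} {S : Spaces Ω}

/-- The velocity as an `L²` field, as a linear map. -/
def vvalₗ : (Fin d → H1 Ω) →ₗ[ℝ] L2v Ω where
  toFun := vval
  map_add' U V := by
    ext i : 1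
    simp [vval]
  map_smul' c U := by
    ext i : 1
    simp [vval]

/-- The divergence, as a linear map. -/
def dvgₗ : (Fin d → H1 Ω) →ₗ[ℝ] L2 Ω where
  toFun := dvg
  map_add' U V := by simp [dvg, Finset.sum_add_distrib]
  map_smul' c U := by simp [dvg, Finset.smul_sum]

theorem vval_injective (ho : IsOpen Ω) :
    Function.Injective (vval : (Fin d → H1 Ω) → L2v Ω) := by
  intro U V h
  funext i
  exact val_injective ho (congrArg (fun w : L2v Ω => w i) h)

set_option maxHeartbeats 2000000 in
/-- The Cahn–Hilliard equations of one time step, after elimination of the phase field. -/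
theorem exists_phase_form (ho : IsOpen Ω) (hb : Bornology.IsBounded Ω) (p : Params)
    {V : Submodule ℝ (H1 Ω)} [FiniteDimensional ℝ V] {dt : ℝ} (hdt : 0 < dt) (θ : V) :
    ∃ (e : V → V) (q : V →ₗ[ℝ] V →ₗ[ℝ] ℝ) (l : V →ₗ[ℝ] ℝ), (∀ u, u ≠ 0 → 0 < q u u) ∧
      (∀ ψ v : V, inner ℝ (val (ψ : H1 Ω)) (val (v : H1 Ω))
        + p.del * inner ℝ (grad (e ψ : H1 Ω)) (grad (v : H1 Ω))
        + 1 / p.del * (∫ z in Ω, wellf (val (θ : H1 Ω) z) * val (v : H1 Ω) z)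
        + 1 / p.eta * inner ℝ (val (e ψ : H1 Ω) - val (θ : H1 Ω)) (val (v : H1 Ω)) = 0) ∧
      ∀ ψ v : V, q ψ v + l v = p.mob * inner ℝ (grad (ψ : H1 Ω)) (grad (v : H1 Ω))
        - inner ℝ ((1 / dt) • (val (e ψ : H1 Ω) - val (θ : H1 Ω))) (val (v : H1 Ω)) := by
  obtain ⟨f, hf⟩ := exists_wellf_eq_inner hb (val (θ : H1 Ω))
  obtain ⟨r, hr⟩ : ∃ r : V →ₗ[ℝ] ℝ, ∀ v : V,
      r v = 1 / p.del * ∫ z in Ω, wellf (val (θ : H1 Ω) z) * val (v : H1 Ω) z :=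
    ⟨(innerₗ (L2 Ω) ((1 / p.del) • f)).comp (val.comp V.subtype), fun v => by
      rw [hf, ← real_inner_smul_left]
      rfl⟩
  obtain ⟨m, hm⟩ : ∃ m : V →ₗ[ℝ] V →ₗ[ℝ] ℝ,
      ∀ u v, m u v = inner ℝ (val (u : H1 Ω)) (val (v : H1 Ω)) :=
    ⟨(innerₗ (L2 Ω)).compl₁₂ (val.comp V.subtype) (val.comp V.subtype), fun _ _ => rfl⟩
  obtain ⟨k, hk⟩ : ∃ k : V →ₗ[ℝ] V →ₗ[ℝ] ℝ,
      ∀ u v, k u v = inner ℝ (grad (u : H1 Ω)) (grad (v : H1 Ω)) :=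
    ⟨(innerₗ (L2v Ω)).compl₁₂ (grad.comp V.subtype) (grad.comp V.subtype), fun _ _ => rfl⟩
  obtain ⟨e, q, l, h1, h2, h3⟩ := exists_phase_elimination (V := V) m k
    (fun u v => by rw [hm u v, hm v u, real_inner_comm])
    (fun u hu => by
      rw [hm u u]
      refine lt_of_le_of_ne real_inner_self_nonneg fun h => hu (Subtype.ext ?_)
      exact val_injective ho ((inner_self_eq_zero.1 h.symm).trans (map_zero _).symm))
    (fun u => (real_inner_self_nonneg (x := grad (u : H1 Ω))).trans_eq (hk u u).symm)
    p.del_pos p.eta_pos p.mob_pos hdt r θ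
  have hs : ∀ ψ v, m (e ψ - θ) v
      = inner ℝ (val (e ψ : H1 Ω) - val (θ : H1 Ω)) (val (v : H1 Ω)) := fun ψ v => by
    rw [hm (e ψ - θ) v, Submodule.coe_sub, map_sub]
  refine ⟨e, q, l, h1, fun ψ v => ?_, fun ψ v => ?_⟩
  · have h := h2 ψ v
    rw [hs ψ v, hk (e ψ) v, hm ψ v, hr v] at h
    exact h
  · have h := h3 ψ v
    rw [hs ψ v, hk ψ v] at h
    exact h.trans (congrArg _ (real_inner_smul_left _ _ _).symm)

/-- The magnetization equation of one time step, after elimination of the magnetic potential. -/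
theorem exists_magnetic_form (S : Spaces Ω) (hgrad : ∀ X ∈ S.pot, grad X ∈ S.mag) (p : Params)
    (hchi : p.chi0 ≤ 4) {dt : ℝ} (hdt : 0 < dt) (θ : H1 Ω) (h : L2v Ω) (M : S.mag) :
    ∃ (H : S.mag →ₗ[ℝ] S.mag) (H₀ : S.mag) (q : S.mag →ₗ[ℝ] S.mag →ₗ[ℝ] ℝ) (l : S.mag →ₗ[ℝ] ℝ),
      (∀ u, u ≠ 0 → 0 < q u u) ∧
      (∀ N : S.mag, ∃ Φ : S.pot, grad (Φ : H1 Ω) = ((H N + H₀ : S.mag) : L2v Ω) ∧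
        ∀ X : S.pot, (inner ℝ (grad (Φ : H1 Ω)) (grad (X : H1 Ω)) : ℝ)
          = inner ℝ (h - ((N + (H N + H₀) : S.mag) : L2v Ω)) (grad (X : H1 Ω))) ∧
      ∀ N Z : S.mag, q N Z + l Z
        = inner ℝ ((1 / dt) • (((N + (H N + H₀) : S.mag) : L2v Ω) - (M : L2v Ω))) (Z : L2v Ω)
          + 1 / p.tau * inner ℝ ((N + (H N + H₀) : S.mag) : L2v Ω) (Z : L2v Ω)
          - 1 / p.tau * wInner (fun z => p.chi (val θ z)) ((H N + H₀ : S.mag) : L2v Ω) Z := by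
  have := S.pot_fin
  obtain ⟨A, hA⟩ := exists_wInner_eq_inner
    (aestronglyMeasurable_comp_val p.continuous_chi θ) (C := p.chi0)
    fun x => by rw [abs_of_nonneg (p.chi_nonneg _)]; exact p.chi_le _
  obtain ⟨H, H₀, q, l, h1, h2, h3⟩ := exists_magnetic_elimination (E := L2v Ω) (X := S.pot) S.mag
    (grad.comp S.pot.subtype) (fun X => hgrad _ X.2) A hchi
    (fun a b => by
      rw [← hA, ← hA]
      exact chi_wInner_le p _ _ _) p.tau_pos hdt h (M : L2v Ω)
  refine ⟨H, H₀, q, l, h1, h2, fun N Z => ?_⟩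
  rw [hA]
  exact h3 N Z

/-- The momentum equation of one time step, without pressure and forces. -/
theorem exists_velocity_form (ho : IsOpen Ω) (p : Params) {V : Submodule ℝ (Fin d → H1 Ω)}
    (β : V →ₗ[ℝ] V →ₗ[ℝ] ℝ) (hβ : ∀ v, β v v = 0) {dt : ℝ} (hdt : 0 < dt) (θ : H1 Ω) (U₀ : V) :
    ∃ (q : V →ₗ[ℝ] V →ₗ[ℝ] ℝ) (l : V →ₗ[ℝ] ℝ), (∀ u, u ≠ 0 → 0 < q u u) ∧
      ∀ u v : V, q u v + l v
        = inner ℝ ((1 / dt) • (vval (u : Fin d → H1 Ω) - vval (U₀ : Fin d → H1 Ω)))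
            (vval (v : Fin d → H1 Ω))
          + β u v + viscForm (fun z => p.nu (val θ z)) (u : Fin d → H1 Ω) (v : Fin d → H1 Ω) := by
  obtain ⟨B, hB⟩ := exists_viscForm_eq
    (aestronglyMeasurable_comp_val p.continuous_nu θ) (C := max p.nuw p.nuf)
    fun x => by rw [abs_of_nonneg (p.nu_nonneg _)]; exact p.nu_upper _
  let i : V →ₗ[ℝ] L2v Ω := vvalₗ.comp V.subtype
  let q : V →ₗ[ℝ] V →ₗ[ℝ] ℝ :=
    (1 / dt) • (innerₗ (L2v Ω)).compl₁₂ i i + β + B.compl₁₂ V.subtype V.subtype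
  let l : V →ₗ[ℝ] ℝ := -((1 / dt) • (innerₗ (L2v Ω) (i U₀)).comp i)
  have hq : ∀ u v, q u v = (1 / dt) * inner ℝ (vval (u : Fin d → H1 Ω)) (vval (v : Fin d → H1 Ω))
    + β u v + B u v := fun _ _ => rfl
  have hl : ∀ v, l v = -((1 / dt) * inner ℝ (vval (U₀ : Fin d → H1 Ω))
    (vval (v : Fin d → H1 Ω))) := fun _ => rfl
  clear_value q l
  refine ⟨q, l, fun u hu => ?_, fun u v => ?_⟩
  · have h1 : 0 < (inner ℝ (vval (u : Fin d → H1 Ω)) (vval (u : Fin d → H1 Ω)) : ℝ) := by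
      refine lt_of_le_of_ne real_inner_self_nonneg fun h0 => hu ?_
      have h0' := inner_self_eq_zero.1 h0.symm
      exact Subtype.ext (vval_injective ho (h0'.trans (map_zero vvalₗ).symm))
    have h3 : 0 ≤ B u u := by
      rw [← hB]
      exact viscForm_self_nonneg (fun _ => p.nu_nonneg _) _
    rw [hq, hβ]
    positivity
  · have e1 : inner ℝ ((1 / dt) • (vval (u : Fin d → H1 Ω) - vval (U₀ : Fin d → H1 Ω)))
        (vval (v : Fin d → H1 Ω)) = 1 / dt * (inner ℝ (vval (u : Fin d → H1 Ω))
          (vval (v : Fin d → H1 Ω)) - inner ℝ (vval (U₀ : Fin d → H1 Ω))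
          (vval (v : Fin d → H1 Ω))) := by
      rw [real_inner_smul_left, inner_sub_left]
    have e2 := hq u v
    have e3 := hl v
    have e4 := hB u v
    linarith

-- After elimination of θ and Φ the unknowns are ψ, N = M − H, U and P. The weights α = λ/δ and μ₀
-- are those of the capillary and magnetic forces in the momentum equation.
set_option maxHeartbeats 2000000 in
theorem exists_solvesStep (hd : d = 2 ∨ d = 3) (ho : IsOpen Ω) (hb : Bornology.IsBounded Ω)
    (hc : Convex ℝ Ω) (p : Params) (hchi : p.chi0 ≤ 4) (hchem : S.chem = S.phase)
    (hgrad : ∀ X ∈ S.pot, grad X ∈ S.mag)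
    (bh : S.vel →ₗ[ℝ] S.vel →ₗ[ℝ] S.vel →ₗ[ℝ] ℝ) (hbh : ∀ u v w, bh u v w = - bh u w v)
    (bm : S.vel →ₗ[ℝ] S.mag →ₗ[ℝ] S.mag →ₗ[ℝ] ℝ) (hbm : ∀ u v w, bm u v w = - bm u w v)
    {dt : ℝ} (hdt : 0 < dt) (h : L2v Ω) (y : State S) :
    ∃ x : State S, SolvesStep p hgrad bh bm dt h y x := by
  have := S.phase_fin
  have := S.mag_fin
  have := S.vel_fin
  obtain ⟨e, qX, lX, pX, hch2, hch1⟩ := exists_phase_form ho hb p hdt y.θ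
  obtain ⟨H, H₀, qM, lM, pM, hpot, hmag⟩ := exists_magnetic_form S hgrad p hchi hdt y.θ h y.M
  obtain ⟨qV, lV, pV, hvel⟩ := exists_velocity_form ho p (bh y.U)
    (fun v => by linarith [hbh y.U v v]) hdt y.θ y.U
  obtain ⟨C, hC⟩ := exists_coupling hd ho hb hc (y.θ : H1 Ω) S.vel S.vel_zero
  obtain ⟨D, hD⟩ : ∃ D : S.pres →ₗ[ℝ] S.vel →ₗ[ℝ] ℝ,
      ∀ P V, D P V = inner ℝ (P : L2 Ω) (dvg (V : Fin d → H1 Ω)) :=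
    ⟨(innerₗ (L2 Ω)).compl₁₂ S.pres.subtype (dvgₗ.comp S.vel.subtype), fun _ _ => rfl⟩
  obtain ⟨c, hcpl⟩ : ∃ c : S.vel →ₗ[ℝ] S.phase →ₗ[ℝ] ℝ,
      ∀ U v, c U v = wInner (val (y.θ : H1 Ω)) (vval (U : Fin d → H1 Ω)) (grad (v : H1 Ω)) :=
    ⟨(innerₗ (L2v Ω)).compl₁₂ C (grad.comp S.phase.subtype), fun U v => (hC U _).symm⟩
  obtain ⟨ψ, N, U, P, s1, s2, s3, s4⟩ := exists_constrained_solution (X := S.phase) (M := S.mag)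
    (Y := S.vel) (Q := S.pres) qX pX qM pM qV pV c bm hbm
    H H₀ lX lM lV D (div_pos p.cap_pos p.del_pos) p.mu0_pos
  obtain ⟨Φ, hΦ, hΦX⟩ := hpot N
  refine ⟨⟨e ψ, ⟨ψ, hchem.ge ψ.2⟩, N + (H N + H₀), Φ, U, P⟩, ?_, ?_, ?_, hΦX, ?_, ?_⟩
  · intro Λ
    have h1 := s1 Λ
    have h2 := hch1 ψ Λ
    rw [hcpl U Λ] at h1
    dsimp only
    linarith
  · intro Υ
    exact hch2 ψ ⟨Υ, hchem.le Υ.2⟩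
  · intro Z
    have h1 := s2 Z
    have h2 := hmag N Z
    dsimp only
    rw [hΦ]
    linarith
  · intro V
    have h1 := s3 V
    have h2 := hvel U V
    have h3 : (⟨grad (Φ : H1 Ω), hgrad _ Φ.2⟩ : S.mag) = H N + H₀ := Subtype.ext hΦ
    have h4 : p.mu0 * bm V ⟨grad (Φ : H1 Ω), hgrad _ Φ.2⟩ (N + (H N + H₀))
        = p.mu0 * bm V (H N + H₀) (N + (H N + H₀)) := by rw [h3]
    rw [hD P V, hcpl V ψ, wInner_comm] at h1
    change _ = p.mu0 * bm V ⟨grad (Φ : H1 Ω), hgrad _ Φ.2⟩ (N + (H N + H₀)) + _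
    dsimp only
    linarith
  · intro Q
    exact (hD _ _).symm.trans (s4 Q)

theorem exists_solution (hd : d = 2 ∨ d = 3) (ho : IsOpen Ω) (hb : Bornology.IsBounded Ω)
    (hc : Convex ℝ Ω) (p : Params) (hchi : p.chi0 ≤ 4) (hchem : S.chem = S.phase)
    (hgrad : ∀ X ∈ S.pot, grad X ∈ S.mag)
    (bh : S.vel →ₗ[ℝ] S.vel →ₗ[ℝ] S.vel →ₗ[ℝ] ℝ) (hbh : ∀ u v w, bh u v w = - bh u w v)
    (bm : S.vel →ₗ[ℝ] S.mag →ₗ[ℝ] S.mag →ₗ[ℝ] ℝ) (hbm : ∀ u v w, bm u v w = - bm u w v)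
    {dt : ℝ} (hdt : 0 < dt) (ha : ℝ → L2v Ω) (θ : S.phase) (M : S.mag) (U : S.vel) :
    ∃ x : ℕ → State S, (x 0).θ = θ ∧ (x 0).M = M ∧ (x 0).U = U ∧ SolvesPotential (ha 0) (x 0) ∧
      ∀ k : ℕ, 1 ≤ k → SolvesStep p hgrad bh bm dt (ha (k * dt)) (x (k - 1)) (x k) := by
  have := S.pot_fin
  obtain ⟨G, hG⟩ := exists_galerkin_projection (V := S.pot) (E := L2v Ω) (grad.comp S.pot.subtype)
  choose step hstep using fun (k : ℕ) (y : State S) =>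
    exists_solvesStep hd ho hb hc p hchi hchem hgrad bh hbh bm hbm hdt (ha (k * dt)) y
  -- Chemical potential and pressure at level 0 are set to 0: neither the first step nor the energy
  -- refers to them.
  let x : ℕ → State S := fun n => Nat.rec ⟨θ, 0, M, G (ha 0 - (M : L2v Ω)), U, 0⟩
    (fun k y => step (k + 1) y) n
  refine ⟨x, rfl, rfl, rfl, fun X => hG _ X, fun k hk => ?_⟩
  obtain ⟨n, rfl⟩ := Nat.exists_eq_add_of_le' hk
  exact hstep (n + 1) (x n)

end Existence

end Ferro

end

/-! ### The theorem. -/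

theorem theorem4 (d : ℕ) (hd : d = 2 ∨ d = 3) (Ω : Set (EuclideanSpace ℝ (Fin d)))
    (hΩ_open : IsOpen Ω) (hΩ_bdd : Bornology.IsBounded Ω) (hΩ_convex : Convex ℝ Ω)
    (p : Ferro.Params) (hchi : p.chi0 ≤ 4) (heta : p.eta ≤ p.del)
    (S : Ferro.Spaces Ω) (hchem : S.chem = S.phase)
    (hgrad : ∀ X ∈ S.pot, Ferro.grad X ∈ S.mag)
    (bh : S.vel →ₗ[ℝ] S.vel →ₗ[ℝ] S.vel →ₗ[ℝ] ℝ) (hbh : ∀ u v w, bh u v w = - bh u w v)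
    (bm : S.vel →ₗ[ℝ] S.mag →ₗ[ℝ] S.mag →ₗ[ℝ] ℝ) (hbm : ∀ u v w, bm u v w = - bm u w v)
    (T : ℝ) (hT : 0 < T) (K : ℕ) (hK : 0 < K) (dt : ℝ) (hdt : dt = T / K)
    (ha : ℝ → Ferro.L2v Ω) (hha : ContDiffOn ℝ 1 ha (Set.Icc 0 T)) :
    -- every step is solvable, whatever the previous time level
    (∀ k ∈ Finset.Icc 1 K, ∀ y : Ferro.State S, ∃ x : Ferro.State S,
      Ferro.SolvesStep p hgrad bh bm dt (ha (k * dt)) y x) ∧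
    -- hence, for all initial data, the scheme has a solution on all time levels
    (∀ (θ₀ : S.phase) (M₀ : S.mag) (U₀ : S.vel), ∃ x : ℕ → Ferro.State S,
      (x 0).θ = θ₀ ∧ (x 0).M = M₀ ∧ (x 0).U = U₀ ∧ Ferro.SolvesPotential (ha 0) (x 0) ∧
      ∀ k ∈ Finset.Icc 1 K,
        Ferro.SolvesStep p hgrad bh bm dt (ha (k * dt)) (x (k - 1)) (x k)) ∧
    -- every solution satisfies the discrete energy estimate
    (∀ x : ℕ → Ferro.State S, Ferro.SolvesPotential (ha 0) (x 0) →
      (∀ k ∈ Finset.Icc 1 K,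
        Ferro.SolvesStep p hgrad bh bm dt (ha (k * dt)) (x (k - 1)) (x k)) →
      Ferro.energy p (x K)
          + ∑ k ∈ Finset.Icc 1 K, (Ferro.numDissipation p (x (k - 1)) (x k)
              + dt * Ferro.physDissipation p (x (k - 1)) (x k))
        ≤ Ferro.energy p (x 0) + ∑ k ∈ Finset.Icc 1 K, dt * Ferro.forcing p T dt ha k) := by
  have hdt0 : 0 < dt := by
    rw [hdt]
    positivity
  exact ⟨fun k _ y => Ferro.exists_solvesStep hd hΩ_open hΩ_bdd hΩ_convex p hchi hchem hgrad bh hbh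
      bm hbm hdt0 _ y,
    fun θ₀ M₀ U₀ =>
      let ⟨x, h1, h2, h3, h4, h5⟩ := Ferro.exists_solution hd hΩ_open hΩ_bdd hΩ_convex p hchi hchem
        hgrad bh hbh bm hbm hdt0 ha θ₀ M₀ U₀
      ⟨x, h1, h2, h3, h4, fun k hk => h5 k (Finset.mem_Icc.1 hk).1⟩,
    fun x h0 hx => Ferro.energy_estimate hΩ_bdd hchem heta hbh hbm hT hK hdt hha h0 hx le_rfl⟩
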